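/- Let $R$ be a field of characteristic $0$. \textbf{Diagrams.} A \emph{trivalent diagram} is a finite connected graph $D$ (multiple edges and loops allowed) with an embedded oriented circle $S^1\subset D$, all of whose vertices are trivalent, and with a cyclic order of the three incoming edges at every vertex outside of $S^1$, up to homeomorphism respecting these data ($S^1$ itself, without vertices, is allowed). Its degree is half its number of vertices; it is a \emph{chord diagram} if all its vertices lie on $S^1$. Let $A$ be the $R$-vector space generated by trivalent diagrams modulo the (STU)-relations $D_Y=D_{ab}-D_{ba}$. Here $D_{ab}$ and $D_{ba}$ differ by interchanging the endpoints of two edges $a,b$ at neighbouring vertices of $S^1$ ($a$ before $b$ in $D_{ab}$), and $D_Y$ arises by joining $a,b$ to a new vertex outside of $S^1$, which is connected by a new edge $p$ to one point of $S^1$ in place of these two endpoints, with cyclic order $(p,b,a)$. $A$ is a commutative graded $R$-algebra with the connected sum along the circle as multiplication and with unit $S^1$; it is spanned by chord diagrams. Let $A_d$ be the span of the diagrams of degree $d$. \textbf{Weight systems of Lie algebras.} Let $\mathfrak g$ be a Lie algebra over $R$, $\omega\in\mathfrak g\otimes\mathfrak g$, and $\rho:\mathfrak g\to\operatorname{End}M$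 a finite-dimensional representation. Represent a chord diagram $D$ of degree $d$ by a permutation $\pi\in S_{2d}$: the chord-ends $1,\dots,2d$ are joined in pairs $\{2k-1,2k\}$, and the chord-end $i$ is placed at the $\pi(i)$-th position on the circle (in the order of its orientation). Then $$W_{\mathfrak g,\omega,\rho}(D):=\operatorname{tr}\Bigl(\gamma\bigl(\pi\cdot\rho^{\otimes 2d}(\omega^{\otimes d})\bigr)\Bigr),$$ where $\pi\cdot(\varphi_1\otimes\dots\otimes\varphi_{2d})=\varphi_{\pi^{-1}(1)}\otimes\dots\otimes\varphi_{\pi^{-1}(2d)}$ and $\gamma(\varphi_1\otimes\dots\otimes\varphi_{2d})=\varphi_1\circ\dots\circ\varphi_{2d}$; for $D=S^1$ this is $\dim M$. For $n\ge 2$ let $\mathfrak g_n$ be $\mathfrak{gl}_n(R)$, respectively $\mathfrak{so}_n(R)$ (the skew-symmetric $n\times n$ matrices), with the defining representation $\tau$ on $R^n$. Let $\omega=\sum_i e_i\otimes e_i'$ be the Casimir element, where $(e_i)$, $(e_i')$ are bases of $\mathfrak g_n$ with $(e_j',e_i)=\delta_{ij}$ for the bilinear form $(a,b)=\operatorname{tr}(\tau(a)\tau(b))$,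 respectively $(a,b)=\frac12\operatorname{tr}(\tau(a)\tau(b))$. For $a_1,\dots,a_r\in R$ let $\Omega=(a_1\omega,\dots,a_r\omega)\in(\mathfrak g_n\otimes\mathfrak g_n)^{\oplus r}\subset\mathfrak g_n^{\oplus r}\otimes\mathfrak g_n^{\oplus r}$, and let $\tau^{\otimes r}$ be the representation of $\mathfrak g_n^{\oplus r}$ on $(R^n)^{\otimes r}$ in which the $i$-th summand acts by $\tau$ on the $i$-th factor. \textbf{The polynomial $W_{r,\underline x}$.} For a chord diagram $D$ let $W(D)=0$ if two chords of $D$ intersect (i.e.\ their endpoints alternate on the circle) and $W(D)=1$ otherwise, and let $$W_{r,\underline x}(D)=\sum_{D=D_1\cup\dots\cup D_r}x_1^{\deg D_1}\cdots x_r^{\deg D_r}\,W(D_1\cdots D_r)\in R[x_1,\dots,x_r],$$ where the sum is over all functions from the set of chords of $D$ to $\{1,\dots,r\}$, $D_i$ is $S^1$ with the chords that are mapped to $i$, and $D_1\cdots D_r$ is the connected sum. \textbf{Proposition.} For $\mathfrak g=\mathfrak{gl}$ or $\mathfrak g=\mathfrak{so}$ and every integer $r\ge1$ there exists a morphism of $R$-algebras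 $$W_{\mathfrak g,r}:A\longrightarrow R[x_1,\dots,x_r]^{S_r}[t]$$ such that for all chord diagrams $D$, all $a_1,\dots,a_r\in R$ and all integers $n\ge2$ $$W_{\mathfrak g_n^{\oplus r},\Omega,\tau^{\otimes r}}(D)=n^r\,W_{\mathfrak g,r}(D)(a_1,\dots,a_r,n).$$ Moreover, for every $d\ge0$ the degree in $t$ of $W_{\mathfrak g,r}(x)$ is $\le d$ for all $x\in A_d$, and for every chord diagram $D$ of degree $d$ the coefficient of $t^d$ in $W_{\mathfrak g,r}(D)$ is $W_{r,\underline x}(D)$. -/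

import Mathlib

/-! ## Trivalent diagrams -/

/-- The part of a trivalent diagram outside the oriented circle, given by its half-edges:
`edge` sends a half-edge to the other half of the same edge, and `vert` sends a half-edge to the
next one in the cyclic order at its vertex.  The fixed points of `vert` are the half-edges that
end on the circle (the legs), its 3-cycles are the vertices outside of the circle.  The last field
says that every component reaches the circle, i.e. that the trivalent diagram is connected. -/
structure Web (H : Type) where
  edge : H → H
  vert : H → H
  edge_edge : ∀ h, edge (edge h) = h
  edge_ne : ∀ h, edge h ≠ h
  vert_vert_vert : ∀ h, vert (vert (vert h)) = h
  connected : ∀ s : Set H, (∀ h ∈ s, edge h ∈ s) → (∀ h ∈ s, vert h ∈ s) →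
    (∀ h, vert h = h → h ∈ s) → ∀ h, h ∈ s

/-- A representative of a trivalent diagram: `legs` lists the legs in the order in which they are
met on the oriented circle, starting at some base point of the circle. -/
structure Diagram (H : Type) extends Web H where
  legs : List H
  nodup : legs.Nodup
  mem_legs : ∀ h, h ∈ legs ↔ vert h = h

namespace Diagram

/-- Homeomorphism of diagrams respecting the oriented circle (whose base point is irrelevant) and
the cyclic orders of the vertices. -/
def Equivalent {H K : Type} (D : Diagram H) (E : Diagram K) : Prop :=
  ∃ e : H ≃ K, (∀ h, e (D.edge h) = E.edge (e h)) ∧ (∀ h, e (D.vert h) = E.vert (e h)) ∧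
    D.legs.map e ~r E.legs

theorem Equivalent.refl {H : Type} (D : Diagram H) : D.Equivalent D :=
  ⟨Equiv.refl H, fun _ => rfl, fun _ => rfl, by simpa using List.IsRotated.refl _⟩

theorem Equivalent.symm {H K : Type} {D : Diagram H} {E : Diagram K} (h : D.Equivalent E) :
    E.Equivalent D := by
  obtain ⟨e, h1, h2, h3⟩ := h
  refine ⟨e.symm, fun k => ?_, fun k => ?_, ?_⟩
  · rw [Equiv.symm_apply_eq, h1]; simp
  · rw [Equiv.symm_apply_eq, h2]; simp
  · simpa using (h3.symm.map e.symm)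

theorem Equivalent.trans {H K L : Type} {D : Diagram H} {E : Diagram K} {F : Diagram L}
    (h : D.Equivalent E) (h' : E.Equivalent F) : D.Equivalent F := by
  obtain ⟨e, h1, h2, h3⟩ := h
  obtain ⟨f, k1, k2, k3⟩ := h'
  refine ⟨e.trans f, fun k => ?_, fun k => ?_, ?_⟩
  · simp [h1, k1]
  · simp [h2, k2]
  · have := (h3.map f).trans k3
    simpa using this

/-- Transport of a diagram along a bijection of its half-edges. -/
def relabel {H K : Type} (D : Diagram H) (e : H ≃ K) : Diagram K where
  edge k := e (D.edge (e.symm k))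
  vert k := e (D.vert (e.symm k))
  edge_edge k := by simp [D.edge_edge]
  edge_ne k h := D.edge_ne (e.symm k) (by rw [Equiv.eq_symm_apply]; exact h)
  vert_vert_vert k := by simp [D.vert_vert_vert]
  connected s h1 h2 h3 k := by
    have := D.connected (e ⁻¹' s) (fun h hh => by simpa using h1 _ hh)
      (fun h hh => by simpa using h2 _ hh) (fun h hh => h3 _ (by simp [hh])) (e.symm k)
    simpa using this
  legs := D.legs.map e
  nodup := D.nodup.map e.injective
  mem_legs k := by
    obtain ⟨h, rfl⟩ := e.surjective k
    rw [List.mem_map_of_injective e.injective, D.mem_legs]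
    simp

theorem equivalent_relabel {H K : Type} (D : Diagram H) (e : H ≃ K) :
    D.Equivalent (D.relabel e) :=
  ⟨e, fun h => by simp [relabel], fun h => by simp [relabel], List.IsRotated.refl _⟩

/-- The degree: half the number of trivalent vertices, which are the legs' endpoints on the circle
and the vertices outside of the circle, each of the latter carrying three half-edges. -/
def degree {H : Type} [Fintype H] (D : Diagram H) : ℕ :=
  (D.legs.length + (Fintype.card H - D.legs.length) / 3) / 2

/-- The oriented circle without any vertex. -/
def circle : Diagram (Fin 0) where
  edge := id
  vert := id
  edge_edge _ := rfl
  edge_ne h := h.elim0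
  vert_vert_vert _ := rfl
  connected _ _ _ _ h := h.elim0
  legs := []
  nodup := List.nodup_nil
  mem_legs h := h.elim0

/-- The connected sum of two diagrams, cut open at their base points. -/
def append {H K : Type} (D : Diagram H) (E : Diagram K) : Diagram (H ⊕ K) where
  edge := Sum.map D.edge E.edge
  vert := Sum.map D.vert E.vert
  edge_edge h := by cases h <;> simp [D.edge_edge, E.edge_edge]
  edge_ne h := by cases h <;> simp [D.edge_ne, E.edge_ne]
  vert_vert_vert h := by cases h <;> simp [D.vert_vert_vert, E.vert_vert_vert]
  connected s h1 h2 h3 := by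
    rintro (h | h)
    · exact D.connected (Sum.inl ⁻¹' s) (fun x hx => h1 _ hx) (fun x hx => h2 _ hx)
        (fun x hx => h3 _ (by simp [hx])) h
    · exact E.connected (Sum.inr ⁻¹' s) (fun x hx => h1 _ hx) (fun x hx => h2 _ hx)
        (fun x hx => h3 _ (by simp [hx])) h
  legs := D.legs.map Sum.inl ++ E.legs.map Sum.inr
  nodup := by
    rw [List.nodup_append]
    refine ⟨D.nodup.map Sum.inl_injective, E.nodup.map Sum.inr_injective, ?_⟩
    simp
  mem_legs h := by cases h <;> simp [D.mem_legs, E.mem_legs]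

/-- If `a`, `b` are the first two legs of a diagram, then interchange them. -/
def swap {H : Type} (D : Diagram H) (a b : H) (l : List H) (hl : D.legs = a :: b :: l) :
    Diagram H where
  toWeb := D.toWeb
  legs := b :: a :: l
  nodup := by
    have := D.nodup
    rw [hl] at this
    exact (List.Perm.swap b a l).nodup_iff.1 this
  mem_legs h := by
    rw [← D.mem_legs, hl]
    exact (List.Perm.swap a b l).mem_iff

end Diagram

open Classical in
/-- Joining two legs `a`, `b` of a web to a new vertex with a new edge to the circle:
the new leg is `inr false`, the other half of its edge is `inr true`, and the cyclic order at the
new vertex is `inr true`, `b`, `a`. -/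
noncomputable def Web.fuse {H : Type} (W : Web H) (a b : H) (hab : a ≠ b) (ha : W.vert a = a)
    (hb : W.vert b = b) : Web (H ⊕ Bool) where
  edge := Sum.map W.edge not
  vert := Sum.elim
    (fun h => if h = a then Sum.inr true else if h = b then Sum.inl a else Sum.inl (W.vert h))
    (fun x => if x = true then Sum.inl b else Sum.inr false)
  edge_edge h := by cases h <;> simp [W.edge_edge]
  edge_ne h := by cases h <;> simp [W.edge_ne]
  vert_vert_vert h := by
    have h3 := W.vert_vert_vert
    have key : ∀ x y, W.vert y = y → W.vert x = y → x = y := by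
      intro x y hy hx
      have := h3 x
      rw [hx, hy, hy] at this
      exact this.symm
    rcases h with h | h
    · by_cases h1 : h = a
      · subst h1; simp [Ne.symm hab]
      by_cases h2 : h = b
      · subst h2; simp [h1]
      have e1 : W.vert h ≠ a := fun e => h1 (key _ _ ha e)
      have e2 : W.vert h ≠ b := fun e => h2 (key _ _ hb e)
      have e3 : W.vert (W.vert h) ≠ a := fun e => e1 (key _ _ ha e)
      have e4 : W.vert (W.vert h) ≠ b := fun e => e2 (key _ _ hb e)
      simp [h1, h2, e1, e2, e3, e4, h3]
    · cases h <;> simp [Ne.symm hab]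
  connected s h1 h2 h3 := by
    have hq : Sum.inr false ∈ s := h3 _ (by simp)
    have hp : Sum.inr true ∈ s := by simpa using h1 _ hq
    have hbs : Sum.inl b ∈ s := by simpa using h2 _ hp
    have has : Sum.inl a ∈ s := by simpa [Ne.symm hab] using h2 _ hbs
    rintro (h | h)
    · refine W.connected (Sum.inl ⁻¹' s) (fun x hx => by simpa using h1 _ hx) ?_ ?_ h
      · intro x hx
        by_cases e1 : x = a
        · subst e1; simpa [ha] using has
        by_cases e2 : x = b
        · subst e2; simpa [hb] using hbs
        simpa [e1, e2] using h2 _ hx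
      · intro x hx
        by_cases e1 : x = a
        · subst e1; exact has
        by_cases e2 : x = b
        · subst e2; exact hbs
        exact h3 _ (by simp [e1, e2, hx])
    · cases h
      · exact hq
      · exact hp

theorem Diagram.fuse_aux {H : Type} (D : Diagram H) {a b : H} {l : List H}
    (hl : D.legs = a :: b :: l) : a ≠ b ∧ D.vert a = a ∧ D.vert b = b := by
  have h := D.nodup
  rw [hl] at h
  refine ⟨?_, (D.mem_legs a).1 (by simp [hl]), (D.mem_legs b).1 (by simp [hl])⟩
  rintro rfl
  simp at h

/-- If `a`, `b` are the first two legs of a diagram, then replace their endpoints on the circle by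
a single one, from which an edge leads to a new vertex where `a` and `b` end. -/
noncomputable def Diagram.fuse {H : Type} (D : Diagram H) (a b : H) (l : List H)
    (hl : D.legs = a :: b :: l) : Diagram (H ⊕ Bool) where
  toWeb := D.toWeb.fuse a b (D.fuse_aux hl).1 (D.fuse_aux hl).2.1 (D.fuse_aux hl).2.2
  legs := Sum.inr false :: l.map Sum.inl
  nodup := by
    have h := D.nodup
    rw [hl] at h
    simp only [List.nodup_cons] at h
    simp [h.2.2.map Sum.inl_injective]
  mem_legs h := by
    have hn := D.nodup
    rw [hl] at hn
    have hab := (D.fuse_aux hl).1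
    rcases h with h | h
    · have := D.mem_legs h
      rw [hl] at this
      simp only [List.nodup_cons, List.mem_cons, not_or] at hn this
      by_cases h1 : h = a
      · subst h1; simp [Web.fuse, hn.1.2]
      by_cases h2 : h = b
      · subst h2; simp [Web.fuse, h1, hn.2.1, Ne.symm h1]
      simp [Web.fuse, h1, h2] at this ⊢
      exact this
    · cases h <;> simp [Web.fuse]

instance diagramSetoid : Setoid (Σ n : ℕ, Diagram (Fin n)) where
  r D E := D.2.Equivalent E.2
  iseqv := ⟨fun D => .refl D.2, fun h => h.symm, fun h h' => h.trans h'⟩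

/-- Trivalent diagrams: equivalence classes of the representatives above. -/
def TrivalentDiagram : Type := Quotient diagramSetoid

/-- The equivalence class of a representative. -/
noncomputable def Diagram.toClass {H : Type} [Fintype H] (D : Diagram H) : TrivalentDiagram :=
  Quotient.mk diagramSetoid ⟨Fintype.card H, D.relabel (Fintype.equivFin H)⟩

theorem Diagram.toClass_eq {H K : Type} [Fintype H] [Fintype K] {D : Diagram H} {E : Diagram K}
    (h : D.Equivalent E) : D.toClass = E.toClass :=
  Quotient.sound ((D.equivalent_relabel _).symm.trans (h.trans (E.equivalent_relabel _)))

/-- The (STU)-relations. -/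
def stuRelations (R : Type*) [CommRing R] : Set (TrivalentDiagram →₀ R) :=
  {y | ∃ (n : ℕ) (D : Diagram (Fin n)) (a b : Fin n) (l : List (Fin n))
      (hl : D.legs = a :: b :: l),
    y = Finsupp.single (D.fuse a b l hl).toClass 1 -
      (Finsupp.single D.toClass 1 - Finsupp.single (D.swap a b l hl).toClass 1)}

/-- The vector space `A` generated by trivalent diagrams modulo the (STU)-relations. -/
def DiagramAlgebra (R : Type*) [CommRing R] : Type _ :=
  (TrivalentDiagram →₀ R) ⧸ Submodule.span R (stuRelations R)

namespace DiagramAlgebra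

noncomputable instance (R : Type*) [CommRing R] : AddCommGroup (DiagramAlgebra R) :=
  inferInstanceAs (AddCommGroup ((TrivalentDiagram →₀ R) ⧸ Submodule.span R (stuRelations R)))

noncomputable instance (R : Type*) [CommRing R] : Module R (DiagramAlgebra R) :=
  inferInstanceAs (Module R ((TrivalentDiagram →₀ R) ⧸ Submodule.span R (stuRelations R)))

/-- The quotient map. -/
noncomputable def proj (R : Type*) [CommRing R] :
    (TrivalentDiagram →₀ R) →ₗ[R] DiagramAlgebra R :=
  (Submodule.span R (stuRelations R)).mkQ

/-- The class in `A` of a trivalent diagram. -/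
noncomputable def of (R : Type*) [CommRing R] (D : TrivalentDiagram) : DiagramAlgebra R :=
  proj R (Finsupp.single D 1)

/-- The class in `A` of a representative of a trivalent diagram. -/
noncomputable def mk (R : Type*) [CommRing R] {H : Type} [Fintype H] (D : Diagram H) :
    DiagramAlgebra R :=
  of R D.toClass

variable {R : Type*} [CommRing R]

theorem mk_eq {H K : Type} [Fintype H] [Fintype K] {D : Diagram H} {E : Diagram K}
    (h : D.Equivalent E) : mk R D = mk R E := by
  rw [mk, mk, Diagram.toClass_eq h]

end DiagramAlgebra

namespace DiagramAlgebra

section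
variable (R : Type*) [CommRing R]

theorem stu {H : Type} [Fintype H] (D : Diagram H) (a b : H) (l : List H)
    (hl : D.legs = a :: b :: l) :
    mk R (D.fuse a b l hl) = mk R D - mk R (D.swap a b l hl) := by
  classical
  set e := Fintype.equivFin H
  have hl' : (D.relabel e).legs = e a :: e b :: l.map e := by simp [Diagram.relabel, hl]
  have h1 : mk R D = mk R (D.relabel e) := mk_eq (D.equivalent_relabel e)
  have h2 : mk R (D.swap a b l hl) = mk R ((D.relabel e).swap _ _ _ hl') :=
    mk_eq ⟨e, fun h => by simp [Diagram.relabel, Diagram.swap],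
      fun h => by simp [Diagram.relabel, Diagram.swap],
      by simpa [Diagram.swap] using List.IsRotated.refl _⟩
  have h3 : mk R (D.fuse a b l hl) = mk R ((D.relabel e).fuse _ _ _ hl') := by
    refine mk_eq ⟨e.sumCongr (Equiv.refl _), ?_, ?_, ?_⟩
    · rintro (h | h) <;> simp [Diagram.relabel, Diagram.fuse, Web.fuse]
    · rintro (h | h)
      · by_cases h1 : h = a
        · simp [Diagram.relabel, Diagram.fuse, Web.fuse, h1]
        by_cases h2 : h = b
        · subst h2; simp [Diagram.relabel, Diagram.fuse, Web.fuse, h1]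
        simp [Diagram.relabel, Diagram.fuse, Web.fuse, h1, h2]
      · cases h <;> simp [Diagram.relabel, Diagram.fuse, Web.fuse]
    · simpa [Diagram.fuse, Function.comp_def] using List.IsRotated.refl _
  rw [h1, h2, h3, ← sub_eq_zero]
  simp only [mk, of]
  rw [← map_sub, ← map_sub]
  exact (Submodule.Quotient.mk_eq_zero _).2 (Submodule.subset_span ⟨_, _, _, _, _, hl', rfl⟩)

theorem cons_rot_inj {α : Type*} {c : α} {s t : List α} (hn : (c :: s).Nodup)
    (h : c :: s ~r c :: t) : s = t := by
  obtain ⟨n, hn'⟩ := h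
  rw [← List.rotate_mod] at hn'
  have hlt : n % (c :: s).length < (c :: s).length := Nat.mod_lt _ (by simp)
  have h0 : (c :: s)[n % (c :: s).length]? = some c := by
    rw [← List.head?_rotate hlt, hn']; rfl
  rw [List.getElem?_eq_getElem hlt] at h0
  have h1 : (c :: s)[n % (c :: s).length] = (c :: s)[0] := by simpa using h0
  have h2 : n % (c :: s).length = 0 := (hn.getElem_inj_iff).1 h1
  rw [h2] at hn'
  simpa using hn'

/-- `l` lists the legs of the web `W`. -/
def Lists {H : Type} (W : Web H) (l : List H) : Prop :=
  l.Nodup ∧ ∀ h, h ∈ l ↔ W.vert h = h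

open Classical in
/-- The class of the web `W` with legs ordered by `l`. -/
noncomputable def br {H : Type} [Fintype H] (W : Web H) (l : List H) : DiagramAlgebra R :=
  if h : Lists W l then mk R ⟨W, l, h.1, h.2⟩ else 0

variable {R}
variable {H K : Type} [Fintype H] [Fintype K]

theorem mk_eq_br (D : Diagram H) : mk R D = br R D.toWeb D.legs := by
  rw [br, dif_pos ⟨D.nodup, D.mem_legs⟩]

theorem Lists.perm {H : Type} {W : Web H} {l l' : List H} (h : Lists W l) (p : l.Perm l') : Lists W l' :=
  ⟨p.nodup_iff.1 h.1, fun x => by rw [← h.2, p.mem_iff]⟩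

theorem br_rot {W : Web H} {l l' : List H} (h : l ~r l') : br R W l = br R W l' := by
  by_cases hl : Lists W l
  · have hl' := hl.perm h.perm
    rw [br, br, dif_pos hl, dif_pos hl']
    exact mk_eq ⟨Equiv.refl _, fun _ => rfl, fun _ => rfl, by simpa using h⟩
  · have hl' : ¬ Lists W l' := fun h' => hl (h'.perm h.perm.symm)
    rw [br, br, dif_neg hl, dif_neg hl']

theorem br_iso {W : Web H} {V : Web K} {l : List H} {m : List K} (e : H ≃ K)
    (h1 : ∀ h, e (W.edge h) = V.edge (e h)) (h2 : ∀ h, e (W.vert h) = V.vert (e h))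
    (h3 : l.map e ~r m) : br R W l = br R V m := by
  have key : Lists W l ↔ Lists V (l.map e) := by
    simp only [Lists, List.nodup_map_iff e.injective, and_congr_right_iff]
    intro _
    rw [e.forall_congr_left]
    refine forall_congr' fun k => ?_
    obtain ⟨h, rfl⟩ := e.surjective k
    rw [List.mem_map_of_injective e.injective, ← h2, e.injective.eq_iff]
    simp
  rw [← br_rot h3]
  by_cases hl : Lists W l
  · rw [br, br, dif_pos hl, dif_pos (key.1 hl)]
    exact mk_eq ⟨e, h1, h2, List.IsRotated.refl _⟩
  · rw [br, br, dif_neg hl, dif_neg (fun h => hl (key.2 h))]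

theorem br_fuse {W : Web H} {a b : H} {l : List H} (h : Lists W (a :: b :: l)) (hab : a ≠ b)
    (ha : W.vert a = a) (hb : W.vert b = b) :
    br R (W.fuse a b hab ha hb) (Sum.inr false :: l.map Sum.inl) =
      br R W (a :: b :: l) - br R W (b :: a :: l) := by
  have := stu R ⟨W, _, h.1, h.2⟩ a b l rfl
  simp only [mk_eq_br] at this
  exact this

/-- Attaching the leg `a` to the two ends of a chord. -/
theorem br_chord {W : Web H} {a b : H} {r s : List H} (h : Lists W (a :: b :: r))
    (hb : W.vert (W.edge b) = W.edge b) (hab : a ≠ W.edge b)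
    (hs : W.edge b :: s ~r b :: r) :
    br R W (a :: b :: r) - br R W (b :: a :: r) +
      (br R W (a :: W.edge b :: s) - br R W (W.edge b :: a :: s)) = 0 := by
  classical
  set b' := W.edge b with hb'
  have hne : b' ≠ b := W.edge_ne b
  have hfa : W.vert a = a := (h.2 a).1 (by simp)
  have hfb : W.vert b = b := (h.2 b).1 (by simp)
  have hn := h.1
  simp only [List.nodup_cons, List.mem_cons, not_or] at hn
  have hmem : b' ∈ r := by
    have := (h.2 b').2 hb
    simpa [hab.symm, hne] using this
  obtain ⟨r1, r2, rfl⟩ := List.append_of_mem hmem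
  have hs' : s = r2 ++ b :: r1 := by
    have h1 : b' :: s ~r b' :: (r2 ++ b :: r1) := by
      refine hs.trans ?_
      have := List.isRotated_append (l := b :: r1) (l' := b' :: r2)
      simpa using this
    have hnd : (b' :: s).Nodup := by
      rw [hs.nodup_iff, List.nodup_cons]; exact hn.2
    exact cons_rot_inj hnd h1
  subst hs'
  have hL : Lists W (b' :: a :: (r2 ++ b :: r1)) := by
    refine h.perm ?_
    rw [← Multiset.coe_eq_coe]
    simp only [← Multiset.cons_coe, ← Multiset.coe_add, ← Multiset.singleton_add]
    abel
  have e1 := br_fuse (R := R) h hn.1.1 hfa hfb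
  have e2 := br_fuse (R := R) hL hab.symm hb hfa
  have e3 : br R (W.fuse a b hn.1.1 hfa hfb)
      (Sum.inr false :: (r1 ++ b' :: r2).map Sum.inl) = 
      br R (W.fuse b' a hab.symm hb hfa) (Sum.inr false :: (r2 ++ b :: r1).map Sum.inl) := by
    set φ : Equiv.Perm (H ⊕ Bool) := ((Equiv.swap (Sum.inr false) (Sum.inl b)).trans
      (Equiv.swap (Sum.inr true) (Sum.inl b'))).trans
      (Equiv.swap (Sum.inr true) (Sum.inr false)) with hφ
    have p1 : φ (Sum.inr false) = Sum.inl b := by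
      simp [hφ, Equiv.swap_apply_of_ne_of_ne, hne.symm]
    have p2 : φ (Sum.inl b) = Sum.inr true := by
      simp [hφ, Equiv.swap_apply_of_ne_of_ne]
    have p3 : φ (Sum.inr true) = Sum.inl b' := by
      simp [hφ, Equiv.swap_apply_of_ne_of_ne]
    have p4 : φ (Sum.inl b') = Sum.inr false := by
      simp [hφ, Equiv.swap_apply_of_ne_of_ne, hne]
    have p5 : ∀ x, x ≠ b → x ≠ b' → φ (Sum.inl x) = Sum.inl x := by
      intro x h1 h2
      simp [hφ, Equiv.swap_apply_of_ne_of_ne, h1, h2]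
    have hbb : W.edge b' = b := by rw [hb', W.edge_edge]
    refine br_iso φ ?_ ?_ ?_
    · rintro (x | x)
      · by_cases h1 : x = b
        · subst h1; simp [Web.fuse, p2, ← hb', p4]
        by_cases h2 : x = b'
        · subst h2; simp [Web.fuse, p2, hbb, p4]
        have h3 : W.edge x ≠ b := fun e => h2 (by rw [hb', ← e, W.edge_edge])
        have h4 : W.edge x ≠ b' := fun e => h1 (by rw [← hbb, ← e, W.edge_edge])
        simp [Web.fuse, p5, h1, h2, h3, h4]
      · cases x <;> simp [Web.fuse, p1, p3, ← hb', hbb]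
    · rintro (x | x)
      · by_cases h1 : x = b
        · subst h1; simp [Web.fuse, p2, p5, hab, hn.1.1, Ne.symm hn.1.1]
        by_cases h2 : x = b'
        · subst h2; simp [Web.fuse, p4, hb, hne, hab.symm]
        by_cases h3 : x = a
        · subst h3; simp [Web.fuse, p3, p5, h1, h2]
        have key : ∀ x y, W.vert y = y → W.vert x = y → x = y := by
          intro x y hy hx
          have := W.vert_vert_vert x
          rw [hx, hy, hy] at this
          exact this.symm
        have h4 : W.vert x ≠ b := fun e => h1 (key _ _ hfb e)
        have h5 : W.vert x ≠ b' := fun e => h2 (key _ _ hb e)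
        simp [Web.fuse, p5, h1, h2, h3, h4, h5]
      · cases x
        · simp [Web.fuse, p1, hne.symm, Ne.symm hn.1.1, hfb]
        · simp [Web.fuse, p2, p3]
    · have hm1 : r1.map (φ ∘ Sum.inl) = r1.map Sum.inl := by
        refine List.map_congr_left fun x hx => p5 x ?_ ?_
        · rintro rfl; simp [hx] at hn
        · intro e
          have := hn.2.2
          rw [List.nodup_append] at this
          exact this.2.2 x hx b' (by simp) e
      have hm2 : r2.map (φ ∘ Sum.inl) = r2.map Sum.inl := by
        refine List.map_congr_left fun x hx => p5 x ?_ ?_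
        · rintro rfl; simp [hx] at hn
        · intro e
          have := hn.2.2
          rw [List.nodup_append, List.nodup_cons] at this
          exact this.2.1.1 (e ▸ hx)
      simp only [List.map_cons, List.map_append, List.map_map, hm1, hm2, p1, p4]
      exact List.isRotated_append (l := (Sum.inl b : H ⊕ Bool) :: r1.map Sum.inl)
        (l' := Sum.inr false :: r2.map Sum.inl)
  rw [← e1, e3, e2]
  abel

open Classical in
/-- Moving the leg `a` past a block `t` of chords. -/
theorem br_move_chords {W : Web H} {a : H} {t v : List H} (h : Lists W (a :: (t ++ v)))
    (ht : ∀ b ∈ t, W.edge b ∈ t) : br R W (a :: (t ++ v)) = br R W (t ++ a :: v) := by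
  have hn := h.1
  simp only [List.nodup_cons, List.mem_append, not_or] at hn
  have hch : ∀ b : H, b ∈ t → ∃ s, b :: s ~r t ++ v := by
    intro b hb
    obtain ⟨t1, t2, rfl⟩ := List.append_of_mem hb
    exact ⟨t2 ++ v ++ t1, by
      simpa using (List.isRotated_append (l := t1) (l' := b :: (t2 ++ v))).symm⟩
  choose! S hS using hch
  let Y : H → DiagramAlgebra R := fun b => br R W (a :: b :: S b) - br R W (b :: a :: S b)
  have hY : ∀ t1 t2 b, t = t1 ++ b :: t2 →
      Y b = br R W (t1 ++ a :: b :: (t2 ++ v)) - br R W (t1 ++ b :: a :: (t2 ++ v)) := by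
    intro t1 t2 b e
    have hb : b ∈ t := by simp [e]
    have hs : S b = t2 ++ v ++ t1 := by
      have h1 : b :: S b ~r b :: (t2 ++ v ++ t1) := by
        refine (hS b hb).trans ?_
        have := List.isRotated_append (l := t1) (l' := b :: (t2 ++ v))
        rw [e]
        simpa using this
      refine cons_rot_inj ?_ h1
      rw [(hS b hb).nodup_iff]
      exact hn.2
    simp only [Y, hs]
    congr 1
    · refine br_rot ?_
      simpa using (List.isRotated_append (l := t1) (l' := a :: b :: (t2 ++ v))).symm
    · refine br_rot ?_
      simpa using (List.isRotated_append (l := t1) (l' := b :: a :: (t2 ++ v))).symm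
  have htel : ∀ t2 t1, t = t1 ++ t2 →
      br R W (t1 ++ a :: (t2 ++ v)) - br R W (t1 ++ t2 ++ a :: v) = (t2.map Y).sum := by
    intro t2
    induction t2 with
    | nil => intro t1 e; simp
    | cons b t2 ih =>
      intro t1 e
      have := ih (t1 ++ [b]) (by simp [e])
      rw [List.map_cons, List.sum_cons, ← this, hY t1 t2 b e]
      simp
  have h0 := htel t [] rfl
  simp only [List.nil_append] at h0
  rw [← sub_eq_zero, h0]
  have hnt : t.Nodup := (List.nodup_append.1 hn.2).1
  rw [← List.sum_toFinset Y hnt]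
  refine Finset.sum_involution (fun b _ => W.edge b) ?_ ?_ ?_ ?_
  · intro b hb
    rw [List.mem_toFinset] at hb
    have hb' := ht b hb
    refine br_chord ?_ ?_ ?_ ?_
    · exact h.perm ((hS b hb).perm.symm.cons a)
    · exact (h.2 _).1 (by simp [hb'])
    · rintro rfl; exact hn.1.1 hb'
    · exact (hS _ hb').trans (hS b hb).symm
  · intro b _ _; exact W.edge_ne b
  · intro b hb; rw [List.mem_toFinset] at hb ⊢; exact ht b hb
  · intro b _; exact W.edge_edge b

end
end DiagramAlgebra

theorem Web.vert_inj {H : Type} (W : Web H) {x y : H} (h : W.vert x = W.vert y) : x = y := by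
  rw [← W.vert_vert_vert x, h, W.vert_vert_vert]

open Classical in
/-- Removing the leg `c`, its edge, and the vertex at the other end of this edge. -/
noncomputable def Web.unfuse {H : Type} (W : Web H) (c : H) (hc : W.vert c = c)
    (hp : W.vert (W.edge c) ≠ W.edge c) : Web {h : H // h ≠ c ∧ h ≠ W.edge c} where
  edge h := ⟨W.edge h, fun e => h.2.2 ((W.edge_edge h.1).symm.trans (congrArg W.edge e)),
    fun e => h.2.1 (by rw [← W.edge_edge h.1, e, W.edge_edge])⟩
  vert h := if hh : h.1 = W.vert (W.edge c) ∨ h.1 = W.vert (W.vert (W.edge c)) then h else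
    ⟨W.vert h, fun e => h.2.1 (W.vert_inj (e.trans hc.symm)), fun e =>
      hh (Or.inr ((W.vert_vert_vert h.1).symm.trans (congrArg (fun x => W.vert (W.vert x)) e)))⟩
  edge_edge h := Subtype.ext (W.edge_edge _)
  edge_ne h e := W.edge_ne h.1 (congrArg Subtype.val e)
  vert_vert_vert h := by
    by_cases hh : h.1 = W.vert (W.edge c) ∨ h.1 = W.vert (W.vert (W.edge c))
    · simp [hh]
    · have key : ∀ x : H, x ≠ W.edge c → ¬ (x = W.vert (W.edge c) ∨
          x = W.vert (W.vert (W.edge c))) → ¬ (W.vert x = W.vert (W.edge c) ∨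
          W.vert x = W.vert (W.vert (W.edge c))) := by
        rintro x h1 h2 (e | e)
        · exact h1 (W.vert_inj e)
        · exact h2 (Or.inl (W.vert_inj e))
      have h1 := key _ h.2.2 hh
      have h2 : W.vert h.1 ≠ W.edge c := fun e =>
        hh (Or.inr ((W.vert_vert_vert h.1).symm.trans (congrArg (fun x => W.vert (W.vert x)) e)))
      have h3 := key _ h2 h1
      simp only [hh, h1, h3, dite_false]
      exact Subtype.ext (W.vert_vert_vert _)
  connected s h1 h2 h3 := by
    have hb : ∀ h : {h : H // h ≠ c ∧ h ≠ W.edge c}, h.1 = W.vert (W.edge c) ∨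
        h.1 = W.vert (W.vert (W.edge c)) → h ∈ s := fun h hh => h3 h (by simp [hh])
    have nc : ∀ x, W.vert x = c → x = c := fun x e => W.vert_inj (e.trans hc.symm)
    have e1 : W.vert (W.edge c) ≠ c := fun e => W.edge_ne c (nc _ e)
    have e2 : W.vert (W.vert (W.edge c)) ≠ c := fun e => e1 (nc _ e)
    have e3 : W.vert (W.vert (W.edge c)) ≠ W.edge c := fun e => hp (by
      have := congrArg W.vert e; rw [W.vert_vert_vert] at this; exact this.symm)
    have key := W.connected {x | ∀ hx : x ≠ c ∧ x ≠ W.edge c, (⟨x, hx⟩ : Subtype _) ∈ s} ?_ ?_ ?_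
    · exact fun h => key h.1 h.2
    · intro x hx hx'
      have hx2 : x ≠ c ∧ x ≠ W.edge c :=
        ⟨fun e => hx'.2 (by rw [e]), fun e => hx'.1 (by rw [e, W.edge_edge])⟩
      exact h1 _ (hx hx2)
    · intro x hx hx'
      by_cases hxc : x = c
      · exact absurd (by rw [hxc, hc]) hx'.1
      by_cases hxp : x = W.edge c
      · exact hb _ (Or.inl (by simp [hxp]))
      by_cases hh : x = W.vert (W.edge c) ∨ x = W.vert (W.vert (W.edge c))
      · rcases hh with hh | hh
        · exact hb _ (Or.inr (by simp [hh]))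
        · exact absurd (by rw [hh, W.vert_vert_vert]) hx'.2
      · simpa [hh] using h2 _ (hx ⟨hxc, hxp⟩)
    · intro x hx hx'
      refine h3 _ ?_
      by_cases hh : x = W.vert (W.edge c) ∨ x = W.vert (W.vert (W.edge c))
      · simp [hh]
      · simp [hh, hx]

namespace DiagramAlgebra
section
variable {R : Type*} [CommRing R] {H : Type} [Fintype H]

open Classical in
/-- Every leg `c` whose edge leads to a vertex outside of the circle can be removed by (STU). -/
theorem br_unfuse {W : Web H} {c : H} {l : List H} (h : Lists W (c :: l)) (hc : W.vert c = c)
    (hp : W.vert (W.edge c) ≠ W.edge c) :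
    ∃ (a b : {h : H // h ≠ c ∧ h ≠ W.edge c}) (l' : List {h : H // h ≠ c ∧ h ≠ W.edge c}),
      l'.map Subtype.val = l ∧ Lists (W.unfuse c hc hp) (a :: b :: l') ∧
      b.1 = W.vert (W.edge c) ∧ a.1 = W.vert (W.vert (W.edge c)) ∧
      br R W (c :: l) = br R (W.unfuse c hc hp) (a :: b :: l') -
        br R (W.unfuse c hc hp) (b :: a :: l') := by
  have nc : ∀ x, W.vert x = c → x = c := fun x e => W.vert_inj (e.trans hc.symm)
  have e1 : W.vert (W.edge c) ≠ c := fun e => W.edge_ne c (nc _ e)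
  have e2 : W.vert (W.vert (W.edge c)) ≠ c := fun e => e1 (nc _ e)
  have e3 : W.vert (W.vert (W.edge c)) ≠ W.edge c := fun e => hp (by
    have := congrArg W.vert e; rw [W.vert_vert_vert] at this; exact this.symm)
  have e4 : W.vert (W.vert (W.edge c)) ≠ W.vert (W.edge c) := fun e => hp (W.vert_inj e)
  have hl : ∀ x ∈ l, x ≠ c ∧ x ≠ W.edge c := by
    intro x hx
    have hn := h.1
    rw [List.nodup_cons] at hn
    refine ⟨fun e => hn.1 (e ▸ hx), fun e => hp ?_⟩
    rw [← e]
    exact (h.2 x).1 (by simp [hx])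
  let a : {h : H // h ≠ c ∧ h ≠ W.edge c} := ⟨W.vert (W.vert (W.edge c)), e2, e3⟩
  let b : {h : H // h ≠ c ∧ h ≠ W.edge c} := ⟨W.vert (W.edge c), e1, hp⟩
  have hab : a ≠ b := fun e => e4 (congrArg Subtype.val e)
  have hmap : (l.pmap Subtype.mk hl).map Subtype.val = l := by simp [List.map_pmap]
  have hL : Lists (W.unfuse c hc hp) (a :: b :: l.pmap Subtype.mk hl) := by
    have hnot : ∀ x ∈ l, x ≠ W.vert (W.edge c) ∧ x ≠ W.vert (W.vert (W.edge c)) := by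
      intro x hx
      have hvx := (h.2 x).1 (by simp [hx])
      constructor
      · intro e
        rw [e] at hvx
        exact hp (W.vert_inj hvx)
      · intro e
        rw [e] at hvx
        exact hp (W.vert_inj (W.vert_inj hvx))
    constructor
    · have hn := h.1
      rw [List.nodup_cons] at hn
      simp only [List.nodup_cons, List.mem_cons, not_or]
      refine ⟨⟨hab, ?_⟩, ?_, ?_⟩
      · intro hm
        have := List.mem_map_of_mem (f := Subtype.val) hm
        rw [hmap] at this
        exact (hnot _ this).2 rfl
      · intro hm
        have := List.mem_map_of_mem (f := Subtype.val) hm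
        rw [hmap] at this
        exact (hnot _ this).1 rfl
      · refine List.Nodup.of_map Subtype.val ?_
        rw [hmap]; exact hn.2
    · intro x
      have hx : x ∈ l.pmap Subtype.mk hl ↔ x.1 ∈ l := by
        rw [← List.mem_map_of_injective Subtype.val_injective, hmap]
      rw [List.mem_cons, List.mem_cons, hx]
      have hxl := h.2 x.1
      simp only [List.mem_cons, x.2.1, false_or] at hxl
      by_cases hh : x.1 = W.vert (W.edge c) ∨ x.1 = W.vert (W.vert (W.edge c))
      · have : (W.unfuse c hc hp).vert x = x := by simp [Web.unfuse, hh]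
        simp only [this, iff_true]
        rcases hh with hh | hh
        · exact Or.inr (Or.inl (Subtype.ext hh))
        · exact Or.inl (Subtype.ext hh)
      · have h1 : x ≠ a := fun e => hh (Or.inr (congrArg Subtype.val e))
        have h2 : x ≠ b := fun e => hh (Or.inl (congrArg Subtype.val e))
        simp only [h1, h2, false_or, hxl]
        simp [Web.unfuse, hh, Subtype.ext_iff]
  refine ⟨a, b, l.pmap Subtype.mk hl, hmap, hL, rfl, rfl, ?_⟩
  have ha : (W.unfuse c hc hp).vert a = a := (hL.2 a).1 (by simp)
  have hb : (W.unfuse c hc hp).vert b = b := (hL.2 b).1 (by simp)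
  rw [← br_fuse hL hab ha hb]
  symm
  have hbij : Function.Bijective (Sum.elim Subtype.val (fun x : Bool => if x = true then
      W.edge c else c) : {h : H // h ≠ c ∧ h ≠ W.edge c} ⊕ Bool → H) := by
    constructor
    · rintro (x | x) (y | y) hxy
      · exact congrArg Sum.inl (Subtype.ext hxy)
      · cases y
        · exact absurd hxy x.2.1
        · exact absurd hxy x.2.2
      · cases x
        · exact absurd hxy.symm y.2.1
        · exact absurd hxy.symm y.2.2
      · cases x <;> cases y
        · rfl
        · exact absurd hxy.symm (W.edge_ne c)
        · exact absurd hxy (W.edge_ne c)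
        · rfl
    · intro x
      by_cases h1 : x = c
      · exact ⟨Sum.inr false, by simp [h1]⟩
      by_cases h2 : x = W.edge c
      · exact ⟨Sum.inr true, by simp [h2]⟩
      exact ⟨Sum.inl ⟨x, h1, h2⟩, rfl⟩
  refine br_iso (Equiv.ofBijective _ hbij) ?_ ?_ ?_
  · rintro (x | x)
    · simp [Web.fuse, Web.unfuse]
    · cases x <;> simp [Web.fuse, W.edge_edge]
  · rintro (x | x)
    · by_cases h1 : x = a
      · subst h1; simp [Web.fuse, a, W.vert_vert_vert]
      by_cases h2 : x = b
      · subst h2; simp [Web.fuse, h1, a, b]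
      have h3 : ¬ (x.1 = W.vert (W.edge c) ∨ x.1 = W.vert (W.vert (W.edge c))) := by
        rintro (e | e)
        · exact h2 (Subtype.ext e)
        · exact h1 (Subtype.ext e)
      simp [Web.fuse, Web.unfuse, h1, h2, h3]
    · cases x <;> simp [Web.fuse, hc, b]
  · simp only [List.map_cons, List.map_map, Equiv.ofBijective_apply]
    simpa [List.map_pmap] using List.IsRotated.refl _

/-- Moving the leg `a` past a block `t` of legs belonging to a union `T` of components. -/
theorem br_move (n : ℕ) : ∀ {H : Type} [Fintype H] (_ : Fintype.card H = n) {W : Web H}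
    {a : H} {t v : List H} (_ : Lists W (a :: (t ++ v))) (T : Set H)
    (_ : ∀ h ∈ T, W.edge h ∈ T) (_ : ∀ h ∈ T, W.vert h ∈ T)
    (_ : ∀ h, W.vert h = h → (h ∈ T ↔ h ∈ t)),
    br R W (a :: (t ++ v)) = br R W (t ++ a :: v) := by
  classical
  induction n using Nat.strong_induction_on with
  | _ n ih =>
  intro H _ hcard W a t v h T hT1 hT2 hT3
  have hleg : ∀ b ∈ t, W.vert b = b := fun b hb => (h.2 b).1 (by simp [hb])
  by_cases hch : ∀ b ∈ t, W.vert (W.edge b) = W.edge b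
  · exact br_move_chords h fun b hb =>
      (hT3 _ (hch b hb)).1 (hT1 _ ((hT3 _ (hleg b hb)).2 hb))
  push Not at hch
  obtain ⟨c, hct, hp⟩ := hch
  have hc := hleg c hct
  obtain ⟨t1, t2, rfl⟩ := List.append_of_mem hct
  have r1 : a :: (t1 ++ c :: t2 ++ v) ~r c :: (t2 ++ v ++ a :: t1) := by
    simpa using List.isRotated_append (l := a :: t1) (l' := c :: (t2 ++ v))
  have r2 : t1 ++ c :: t2 ++ a :: v ~r c :: (t2 ++ a :: v ++ t1) := by
    simpa using List.isRotated_append (l := t1) (l' := c :: (t2 ++ a :: v))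
  have L1 := h.perm r1.perm
  have L2 : Lists W (c :: (t2 ++ a :: v ++ t1)) := by
    refine L1.perm ?_
    rw [← Multiset.coe_eq_coe]
    simp only [← Multiset.cons_coe, ← Multiset.coe_add, ← Multiset.singleton_add]
    abel
  obtain ⟨x, y, l, hl, Lx, hy, hx, E1⟩ := br_unfuse (R := R) L1 hc hp
  obtain ⟨x', y', l', hl', Lx', hy', hx', E2⟩ := br_unfuse (R := R) L2 hc hp
  obtain rfl : x = x' := Subtype.ext (hx.trans hx'.symm)
  obtain rfl : y = y' := Subtype.ext (hy.trans hy'.symm)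
  rw [br_rot r1, br_rot r2, E1, E2]
  obtain ⟨t2v, at1, rfl, hA, hB⟩ := List.map_eq_append_iff.1 hl
  obtain ⟨t2', v', rfl, hC, hD⟩ := List.map_eq_append_iff.1 hA
  obtain ⟨a', t1', rfl, hE, hF⟩ := List.map_eq_cons_iff.1 hB
  obtain rfl : l' = t2' ++ a' :: v' ++ t1' := by
    apply Subtype.val_injective.list_map
    rw [hl']
    simp [hC, hD, hE, hF]
  have hlt : Fintype.card {h : H // h ≠ c ∧ h ≠ W.edge c} < n := by
    rw [← hcard]
    exact Fintype.card_subtype_lt (x := c) (by simp)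
  have hpT : W.edge c ∈ T := hT1 _ ((hT3 _ hc).2 hct)
  have key : ∀ p q : {h : H // h ≠ c ∧ h ≠ W.edge c}, (p = x ∧ q = y ∨ p = y ∧ q = x) →
      br R (W.unfuse c hc hp) (p :: q :: (t2' ++ v' ++ a' :: t1')) =
        br R (W.unfuse c hc hp) (p :: q :: (t2' ++ a' :: v' ++ t1')) := by
    intro p q hpq
    have Lpq : Lists (W.unfuse c hc hp) (p :: q :: (t2' ++ v' ++ a' :: t1')) := by
      rcases hpq with ⟨rfl, rfl⟩ | ⟨rfl, rfl⟩
      · exact Lx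
      · exact Lx.perm (List.Perm.swap _ _ _)
    have s1 : p :: q :: (t2' ++ v' ++ a' :: t1') ~r a' :: ((t1' ++ p :: q :: t2') ++ v') := by
      simpa using List.isRotated_append (l := p :: q :: (t2' ++ v')) (l' := a' :: t1')
    have s2 : p :: q :: (t2' ++ a' :: v' ++ t1') ~r (t1' ++ p :: q :: t2') ++ a' :: v' := by
      simpa using List.isRotated_append (l := p :: q :: (t2' ++ a' :: v')) (l' := t1')
    rw [br_rot s1, br_rot s2]
    refine ih _ hlt rfl (Lpq.perm s1.perm) {z | z.1 ∈ T} ?_ ?_ ?_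
    · intro z hz; exact hT1 _ hz
    · intro z hz
      by_cases hh : z.1 = W.vert (W.edge c) ∨ z.1 = W.vert (W.vert (W.edge c))
      · simpa [Web.unfuse, hh] using hz
      · simpa [Web.unfuse, hh] using hT2 _ hz
    · intro z hz
      have hpqm : (z = p ∨ z = q) ↔ (z = x ∨ z = y) := by
        rcases hpq with ⟨rfl, rfl⟩ | ⟨rfl, rfl⟩
        · rfl
        · exact or_comm
      have hmem : z ∈ t1' ++ p :: q :: t2' ↔ (z = x ∨ z = y) ∨ (z.1 ∈ t1 ∨ z.1 ∈ t2) := by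
        rw [← hpqm, ← hF, ← hC, List.mem_map_of_injective Subtype.val_injective,
          List.mem_map_of_injective Subtype.val_injective]
        simp only [List.mem_append, List.mem_cons]
        tauto
      rw [hmem]
      by_cases hh : z.1 = W.vert (W.edge c) ∨ z.1 = W.vert (W.vert (W.edge c))
      · have hxy : z = x ∨ z = y := by
          rcases hh with hh | hh
          · exact Or.inr (Subtype.ext (hh.trans hy.symm))
          · exact Or.inl (Subtype.ext (hh.trans hx.symm))
        have hzT : z.1 ∈ T := by
          rcases hh with hh | hh
          · rw [hh]; exact hT2 _ hpT
          · rw [hh]; exact hT2 _ (hT2 _ hpT)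
        simp [hxy, hzT]
      · have hxy : ¬ (z = x ∨ z = y) := by
          rintro (e | e)
          · exact hh (Or.inr (by rw [e, hx]))
          · exact hh (Or.inl (by rw [e, hy]))
        have hzv : W.vert z.1 = z.1 := by
          have := congrArg Subtype.val hz
          simpa [Web.unfuse, hh] using this
        have := hT3 _ hzv
        simp only [List.mem_append, List.mem_cons, z.2.1, false_or] at this
        simp [hxy, this]
  rw [key x y (Or.inl ⟨rfl, rfl⟩), key y x (Or.inr ⟨rfl, rfl⟩)]

end
end DiagramAlgebra

namespace DiagramAlgebra
section
variable (R : Type*) [CommRing R] {H K L : Type} [Fintype H] [Fintype K] [Fintype L]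

theorem mk_append_comm (D : Diagram H) (E : Diagram K) :
    mk R (D.append E) = mk R (E.append D) := by
  refine mk_eq ⟨Equiv.sumComm H K, ?_, ?_, ?_⟩
  · rintro (h | h) <;> simp [Diagram.append]
  · rintro (h | h) <;> simp [Diagram.append]
  · simpa [Diagram.append, Function.comp_def] using List.isRotated_append

theorem br_append_rot (D : Diagram H) (E : Diagram K) (n : ℕ) :
    br R (D.append E).toWeb ((D.legs.rotate n).map Sum.inl ++ E.legs.map Sum.inr) =
      br R (D.append E).toWeb (D.legs.map Sum.inl ++ E.legs.map Sum.inr) := by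
  induction n with
  | zero => simp
  | succ n ih =>
    rw [← ih, ← List.rotate_rotate]
    have hp : (D.legs.rotate n).Perm D.legs := List.rotate_perm _ _
    generalize D.legs.rotate n = l at hp
    rcases l with _ | ⟨a, s⟩
    · simp
    simp only [List.rotate_cons_succ, List.rotate_zero, List.map_append, List.map_cons,
      List.map_nil, List.append_assoc, List.cons_append, List.nil_append]
    have r1 : (s.map Sum.inl ++ (Sum.inl a : H ⊕ K) :: E.legs.map Sum.inr) ~r
        Sum.inl a :: (E.legs.map Sum.inr ++ s.map Sum.inl) :=
      List.isRotated_append (l := s.map Sum.inl)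
        (l' := (Sum.inl a : H ⊕ K) :: E.legs.map Sum.inr)
    have r2 : (E.legs.map Sum.inr ++ (Sum.inl a : H ⊕ K) :: s.map Sum.inl) ~r
        Sum.inl a :: (s.map Sum.inl ++ E.legs.map Sum.inr) :=
      List.isRotated_append (l := E.legs.map Sum.inr)
        (l' := (Sum.inl a : H ⊕ K) :: s.map Sum.inl)
    rw [br_rot r1, ← br_rot r2]
    have h0 : Lists (D.append E).toWeb (D.legs.map Sum.inl ++ E.legs.map Sum.inr) :=
      ⟨(D.append E).nodup, (D.append E).mem_legs⟩
    refine br_move _ rfl (h0.perm ?_) (Set.range Sum.inr) ?_ ?_ ?_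
    · have := ((hp.map Sum.inl).append_right (E.legs.map (Sum.inr : K → H ⊕ K))).symm
      exact this.trans (List.Perm.cons _ List.perm_append_comm)
    · rintro _ ⟨k, rfl⟩; exact ⟨E.edge k, rfl⟩
    · rintro _ ⟨k, rfl⟩; exact ⟨E.vert k, rfl⟩
    · rintro (h | k) hk
      · simp
      · simp only [Set.mem_range, Sum.inr.injEq, exists_eq, List.mem_map, exists_eq_right, true_iff]
        rw [E.mem_legs]
        simpa [Diagram.append] using hk

theorem mk_append_left {D : Diagram H} {D' : Diagram L} (h : D.Equivalent D') (E : Diagram K) :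
    mk R (D.append E) = mk R (D'.append E) := by
  obtain ⟨e, h1, h2, n, h3⟩ := h
  have h4 : (D.relabel e).legs.rotate n = D'.legs := h3
  rw [mk_eq_br, mk_eq_br]
  have e1 : br R (D.append E).toWeb (D.append E).legs =
      br R ((D.relabel e).append E).toWeb
        ((D.relabel e).legs.map Sum.inl ++ E.legs.map Sum.inr) := by
    refine br_iso (e.sumCongr (Equiv.refl K)) ?_ ?_ ?_
    · rintro (h | h) <;> simp [Diagram.append, Diagram.relabel]
    · rintro (h | h) <;> simp [Diagram.append, Diagram.relabel]
    · simpa [Diagram.append, Diagram.relabel, Function.comp_def] using List.IsRotated.refl _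
  rw [e1, ← br_append_rot R (D.relabel e) E n, h4]
  refine br_iso (Equiv.refl _) ?_ ?_ ?_
  · rintro (h | h) <;> simp [Diagram.append, Diagram.relabel, h1]
  · rintro (h | h) <;> simp [Diagram.append, Diagram.relabel, h2]
  · simpa [Diagram.append] using List.IsRotated.refl _

theorem mk_append_congr {H' K' : Type} [Fintype H'] [Fintype K'] {D : Diagram H} {D' : Diagram H'}
    {E : Diagram K} {E' : Diagram K'} (h : D.Equivalent D') (h' : E.Equivalent E') :
    mk R (D.append E) = mk R (D'.append E') := by
  rw [mk_append_left R h, mk_append_comm, mk_append_left R h', mk_append_comm]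

/-- The connected sum of trivalent diagrams, which is well defined in `A`. -/
noncomputable def connectedSum (D E : TrivalentDiagram) : DiagramAlgebra R :=
  Quotient.liftOn₂ D E (fun D E => mk R (D.2.append E.2))
    (fun _ _ _ _ h h' => mk_append_congr R h h')

theorem connectedSum_toClass (D : Diagram H) (E : Diagram K) :
    connectedSum R D.toClass E.toClass = mk R (D.append E) :=
  mk_append_congr R (D.equivalent_relabel _).symm (E.equivalent_relabel _).symm

theorem exists_toClass (x : TrivalentDiagram) :
    ∃ (n : ℕ) (D : Diagram (Fin n)), D.toClass = x := by
  induction x using Quotient.inductionOn with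
  | h D => exact ⟨D.1, D.2, Quotient.sound (D.2.equivalent_relabel _).symm⟩

theorem connectedSum_comm (x y : TrivalentDiagram) :
    connectedSum R x y = connectedSum R y x := by
  obtain ⟨n, D, rfl⟩ := exists_toClass x
  obtain ⟨m, E, rfl⟩ := exists_toClass y
  rw [connectedSum_toClass, connectedSum_toClass, mk_append_comm]

theorem connectedSum_stu (D : Diagram H) (a b : H) (l : List H) (hl : D.legs = a :: b :: l)
    (y : TrivalentDiagram) :
    connectedSum R (D.fuse a b l hl).toClass y =
      connectedSum R D.toClass y - connectedSum R (D.swap a b l hl).toClass y := by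
  obtain ⟨m, E, rfl⟩ := exists_toClass y
  simp only [connectedSum_toClass]
  have hl' : (D.append E).legs =
      Sum.inl a :: Sum.inl b :: (l.map Sum.inl ++ E.legs.map Sum.inr) := by
    simp [Diagram.append, hl]
  have e1 : mk R ((D.swap a b l hl).append E) = mk R ((D.append E).swap _ _ _ hl') :=
    mk_eq ⟨Equiv.refl _, fun _ => rfl, fun _ => rfl, by
      simpa [Diagram.append, Diagram.swap] using List.IsRotated.refl _⟩
  rw [e1, ← stu R (D.append E) _ _ _ hl']
  refine mk_eq ⟨(Equiv.sumAssoc H Bool (Fin m)).trans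
    (((Equiv.refl H).sumCongr (Equiv.sumComm Bool (Fin m))).trans
      (Equiv.sumAssoc H (Fin m) Bool).symm), ?_, ?_, ?_⟩
  · rintro ((h | h) | h) <;> simp [Diagram.append, Diagram.fuse, Web.fuse]
  · rintro ((h | h) | h)
    · by_cases h1 : h = a
      · simp [Diagram.append, Diagram.fuse, Web.fuse, h1]
      by_cases h2 : h = b
      · subst h2; simp [Diagram.append, Diagram.fuse, Web.fuse, h1]
      simp [Diagram.append, Diagram.fuse, Web.fuse, h1, h2]
    · cases h <;> simp [Diagram.append, Diagram.fuse, Web.fuse]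
    · simp [Diagram.append, Diagram.fuse, Web.fuse]
  · simpa [Diagram.append, Diagram.fuse, Function.comp_def] using List.IsRotated.refl _

/-- Connected sum with `y`, as a linear map. -/
noncomputable def mulRight (y : TrivalentDiagram) : DiagramAlgebra R →ₗ[R] DiagramAlgebra R :=
  (Submodule.span R (stuRelations R)).liftQ
    (Finsupp.linearCombination R fun x => connectedSum R x y) <| by
      rw [Submodule.span_le]
      rintro _ ⟨n, D, a, b, l, hl, rfl⟩
      simp [connectedSum_stu]

@[simp]
theorem mulRight_of (x y : TrivalentDiagram) : mulRight R y (of R x) = connectedSum R x y := by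
  have : mulRight R y (of R x) =
    Finsupp.linearCombination R (fun x => connectedSum R x y) (Finsupp.single x 1) := rfl
  rw [this]; simp

theorem linearMap_ext {M : Type*} [AddCommGroup M] [Module R M] {f g : DiagramAlgebra R →ₗ[R] M}
    (h : ∀ x, f (of R x) = g (of R x)) : f = g := by
  refine Submodule.linearMap_qext (Submodule.span R (stuRelations R)) ?_
  refine Finsupp.lhom_ext' fun x => LinearMap.ext_ring ?_
  exact h x

/-- The bilinear multiplication of `A` given by connected sum. -/
noncomputable def mulHom : DiagramAlgebra R →ₗ[R] DiagramAlgebra R →ₗ[R] DiagramAlgebra R :=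
  (Submodule.span R (stuRelations R)).liftQ
    (Finsupp.linearCombination R fun y => mulRight R y) <| by
      rw [Submodule.span_le]
      rintro _ ⟨n, D, a, b, l, hl, rfl⟩
      simp only [SetLike.mem_coe, LinearMap.mem_ker, map_sub, Finsupp.linearCombination_single,
        one_smul]
      refine linearMap_ext R fun x => ?_
      simp [connectedSum_comm R x, connectedSum_stu]

@[simp]
theorem mulHom_of (x y : TrivalentDiagram) :
    mulHom R (of R x) (of R y) = connectedSum R x y := by
  have : mulHom R (of R x) =
    Finsupp.linearCombination R (fun y => mulRight R y) (Finsupp.single x 1) := rfl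
  rw [this]; simp [connectedSum_comm R x]

theorem mulHom_comm (x y : DiagramAlgebra R) : mulHom R x y = mulHom R y x := by
  have : mulHom R = (mulHom R).flip := by
    refine linearMap_ext R fun x => linearMap_ext R fun y => ?_
    simp [connectedSum_comm R x]
  exact LinearMap.congr_fun (LinearMap.congr_fun this x) y

theorem mulHom_mk (D : Diagram H) (E : Diagram K) :
    mulHom R (mk R D) (mk R E) = mk R (D.append E) := by
  rw [mk, mk, mulHom_of, connectedSum_toClass]

theorem mulHom_assoc (x y z : DiagramAlgebra R) :
    mulHom R (mulHom R x y) z = mulHom R x (mulHom R y z) := by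
  have key : ∀ a b c : TrivalentDiagram, mulHom R (mulHom R (of R a) (of R b)) (of R c) =
      mulHom R (of R a) (mulHom R (of R b) (of R c)) := by
    intro a b c
    obtain ⟨n, D, rfl⟩ := exists_toClass a
    obtain ⟨m, E, rfl⟩ := exists_toClass b
    obtain ⟨k, F, rfl⟩ := exists_toClass c
    change mulHom R (mulHom R (mk R D) (mk R E)) (mk R F) =
      mulHom R (mk R D) (mulHom R (mk R E) (mk R F))
    simp only [mulHom_mk]
    refine mk_eq ⟨Equiv.sumAssoc _ _ _, ?_, ?_, ?_⟩
    · rintro ((h | h) | h) <;> simp [Diagram.append]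
    · rintro ((h | h) | h) <;> simp [Diagram.append]
    · simpa [Diagram.append, Function.comp_def] using List.IsRotated.refl _
  have h1 : ∀ a b : TrivalentDiagram, mulHom R (mulHom R (of R a) (of R b)) =
      (mulHom R (of R a)).comp (mulHom R (of R b)) := fun a b =>
    linearMap_ext R fun c => key a b c
  have h2 : ∀ a : TrivalentDiagram, (mulHom R).comp (mulHom R (of R a)) =
      (LinearMap.llcomp R _ _ _ (mulHom R (of R a))).comp (mulHom R) := fun a =>
    linearMap_ext R fun b => h1 a b
  have h3 : (LinearMap.llcomp R _ _ _ (mulHom R)).comp (mulHom R) =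
      (LinearMap.lcomp R _ (mulHom R)).comp ((LinearMap.llcomp R _ _ _).comp (mulHom R)) :=
    linearMap_ext R fun a => h2 a
  exact LinearMap.congr_fun (LinearMap.congr_fun (LinearMap.congr_fun h3 x) y) z

theorem one_mulHom (x : DiagramAlgebra R) : mulHom R (mk R Diagram.circle) x = x := by
  have : mulHom R (mk R Diagram.circle) = LinearMap.id := by
    refine linearMap_ext R fun x => ?_
    obtain ⟨n, D, rfl⟩ := exists_toClass x
    change mulHom R (mk R Diagram.circle) (mk R D) = mk R D
    rw [mulHom_mk]
    refine mk_eq ⟨Equiv.emptySum (Fin 0) (Fin n), ?_, ?_, ?_⟩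
    · rintro (h | h)
      · exact h.elim0
      · simp [Diagram.append]
    · rintro (h | h)
      · exact h.elim0
      · simp [Diagram.append]
    · simpa [Diagram.append, Diagram.circle, Function.comp_def] using List.IsRotated.refl _
  rw [this]; rfl

end

/-- The multiplication of `A` is the connected sum, its unit is the oriented circle. -/
noncomputable instance (R : Type*) [CommRing R] : CommRing (DiagramAlgebra R) :=
  { (inferInstance : AddCommGroup (DiagramAlgebra R)) with
    mul := fun x y => mulHom R x y
    one := mk R Diagram.circle
    left_distrib := fun x y z => (mulHom R x).map_add y z
    right_distrib := fun x y z => (mulHom R).map_add₂ x y z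
    zero_mul := fun x => (mulHom R).map_zero₂ x
    mul_zero := fun x => (mulHom R x).map_zero
    mul_assoc := mulHom_assoc R
    one_mul := one_mulHom R
    mul_one := fun x => (mulHom_comm R x _).trans (one_mulHom R x)
    mul_comm := mulHom_comm R }

noncomputable instance (R : Type*) [CommRing R] : Algebra R (DiagramAlgebra R) :=
  Algebra.ofModule (fun r x y => (mulHom R).map_smul₂ r x y)
    (fun r x y => (mulHom R x).map_smul r y)

theorem one_def (R : Type*) [CommRing R] : (1 : DiagramAlgebra R) = mk R Diagram.circle := rfl

theorem mk_mul_mk (R : Type*) [CommRing R] {H K : Type} [Fintype H] [Fintype K]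
    (D : Diagram H) (E : Diagram K) : mk R D * mk R E = mk R (D.append E) :=
  mulHom_mk R D E

/-- The homogeneous elements of degree `d` of `A`. -/
noncomputable def homogeneous (R : Type*) [CommRing R] (d : ℕ) : Submodule R (DiagramAlgebra R) :=
  Submodule.span R {x | ∃ (n : ℕ) (D : Diagram (Fin n)), D.degree = d ∧ x = mk R D}

end DiagramAlgebra

/-! ## Chord diagrams and the polynomial `W_{r,x}` -/

/-- The chord diagram with `d` chords belonging to a permutation `π`: the chord-ends
`0, 1, …, 2d-1` are joined in pairs `{0,1}, {2,3}, …`, and the chord-end `i` is placed at the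
position `π i` on the circle.  Every chord diagram of degree `d` is of this form. -/
def chordDiagram {d : ℕ} (π : Equiv.Perm (Fin (2 * d))) : Diagram (Fin (2 * d)) where
  edge i := if h : i.1 % 2 = 0 then ⟨i.1 + 1, by omega⟩ else ⟨i.1 - 1, by omega⟩
  vert i := i
  edge_edge i := by
    apply Fin.ext
    by_cases h : i.1 % 2 = 0
    · have : ¬ (i.1 + 1) % 2 = 0 := by omega
      simp [h, this]
    · have : (i.1 - 1) % 2 = 0 := by omega
      simp only [h, this, dite_true, dite_false]
      omega
  edge_ne i h := by
    have := congrArg Fin.val h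
    by_cases h : i.1 % 2 = 0
    · simp [h] at this
    · simp only [h, dite_false] at this
      omega
  vert_vert_vert _ := rfl
  connected _ _ _ h i := h i rfl
  legs := List.ofFn fun j => π.symm j
  nodup := List.nodup_ofFn.2 π.symm.injective
  mem_legs i := by simp [List.mem_ofFn, π.symm.surjective i]

namespace Diagram

open Classical in
/-- The value `W(D)` for a chord diagram `D`: it is `0` if two chords `{a, a'}` and `{b, b'}`
intersect, i.e. if their ends are met in the order `a, b, a', b'`, and `1` otherwise. -/
noncomputable def W (R : Type*) [CommRing R] {H : Type} (D : Diagram H) : R :=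
  if ∃ a b : H, [a, b, D.edge a, D.edge b].Sublist D.legs then 0 else 1

/-- The functions from the set of components of the complement of the circle to `{1, …, r}`. -/
def Coloring {H : Type} (D : Diagram H) (r : ℕ) : Type :=
  {φ : H → Fin r // ∀ h, φ (D.edge h) = φ h ∧ φ (D.vert h) = φ h}

noncomputable instance {H : Type} [Fintype H] (D : Diagram H) (r : ℕ) : Fintype (D.Coloring r) := by
  classical exact inferInstanceAs (Fintype {φ : H → Fin r // _})

/-- The subdiagram `D_i` consisting of the circle and the components of color `i`. -/
def sub {H : Type} (D : Diagram H) {r : ℕ} (φ : D.Coloring r) (i : Fin r) :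
    Diagram {h : H // φ.1 h = i} where
  edge h := ⟨D.edge h, ((φ.2 h).1).trans h.2⟩
  vert h := ⟨D.vert h, ((φ.2 h).2).trans h.2⟩
  edge_edge h := Subtype.ext (D.edge_edge h)
  edge_ne h e := D.edge_ne h (congrArg Subtype.val e)
  vert_vert_vert h := Subtype.ext (D.vert_vert_vert h)
  connected s h1 h2 h3 h := by
    refine D.connected {x | ∀ hx : φ.1 x = i, (⟨x, hx⟩ : Subtype _) ∈ s} ?_ ?_ ?_ h.1 h.2
    · intro x hx hx'
      exact h1 _ (hx (((φ.2 x).1).symm.trans hx'))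
    · intro x hx hx'
      exact h2 _ (hx (((φ.2 x).2).symm.trans hx'))
    · intro x hx hx'
      exact h3 _ (Subtype.ext hx)
  legs := (D.legs.filter fun h => φ.1 h = i).attachWith _ (by simp)
  nodup := by
    apply List.Nodup.of_map Subtype.val
    rw [List.attachWith_map_subtype_val]
    exact D.nodup.filter _
  mem_legs h := by
    simp [List.mem_attachWith, D.mem_legs, h.2, Subtype.ext_iff]

/-- The connected sum `D_1 … D_r` of a finite family of diagrams, cut open at their base points. -/
def sigma {r : ℕ} {H : Fin r → Type} (D : ∀ i, Diagram (H i)) : Diagram (Σ i, H i) where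
  edge h := ⟨h.1, (D h.1).edge h.2⟩
  vert h := ⟨h.1, (D h.1).vert h.2⟩
  edge_edge h := by simp [(D h.1).edge_edge]
  edge_ne h := by
    obtain ⟨i, h⟩ := h
    simpa using (D i).edge_ne h
  vert_vert_vert h := by simp [(D h.1).vert_vert_vert]
  connected s h1 h2 h3 h := (D h.1).connected {x | (⟨h.1, x⟩ : Σ i, H i) ∈ s}
    (fun _ hx => h1 _ hx) (fun _ hx => h2 _ hx) (fun x hx => h3 ⟨h.1, x⟩ (by simp [hx])) h.2
  legs := (List.finRange r).flatMap fun i => (D i).legs.map (Sigma.mk i)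
  nodup := by
    rw [List.nodup_flatMap]
    refine ⟨fun i _ => (D i).nodup.map sigma_mk_injective, ?_⟩
    refine (List.nodup_finRange r).imp ?_
    intro i j hij x hx hy
    simp only [List.mem_map] at hx hy
    obtain ⟨a, -, rfl⟩ := hx
    obtain ⟨b, -, hb⟩ := hy
    exact hij (congrArg Sigma.fst hb).symm
  mem_legs h := by
    obtain ⟨i, h⟩ := h
    have : (⟨i, h⟩ : Σ i, H i) ∈ (List.finRange r).flatMap (fun i => (D i).legs.map (Sigma.mk i)) ↔
        h ∈ (D i).legs := by
      simp only [List.mem_flatMap, List.mem_finRange, true_and, List.mem_map]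
      constructor
      · rintro ⟨j, x, hx, hxe⟩
        obtain rfl : j = i := congrArg Sigma.fst hxe
        obtain rfl : x = h := by simpa using hxe
        exact hx
      · intro hx
        exact ⟨i, h, hx, rfl⟩
    rw [this, (D i).mem_legs]
    simp

/-- The polynomial `W_{r,x}(D)` for a chord diagram `D`. -/
noncomputable def Wx (R : Type*) [CommRing R] (r : ℕ) {H : Type} [Fintype H] (D : Diagram H) :
    MvPolynomial (Fin r) R :=
  ∑ φ : D.Coloring r, (∏ i, MvPolynomial.X i ^ (D.sub φ i).degree) *
    MvPolynomial.C (W R (sigma fun i => D.sub φ i))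

end Diagram

/-! ## Weight systems of Lie algebras -/

open scoped TensorProduct DirectSum

attribute [local instance 100] LieRing.ofAssociativeRing

section LieWeights

variable {R : Type*} [Field R]

/-- The bilinear form `(a, b) = tr (ρ a ∘ ρ b)` of a representation `ρ`. -/
noncomputable def repForm {g M : Type*} [LieRing g] [LieAlgebra R g] [AddCommGroup M] [Module R M]
    (ρ : g →ₗ⁅R⁆ Module.End R M) : LinearMap.BilinForm R g :=
  ((LinearMap.mul R (Module.End R M)).compl₁₂ (ρ : g →ₗ[R] Module.End R M)
    (ρ : g →ₗ[R] Module.End R M)).compr₂ (LinearMap.trace R M)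

@[simp]
theorem repForm_apply {g M : Type*} [LieRing g] [LieAlgebra R g] [AddCommGroup M] [Module R M]
    (ρ : g →ₗ⁅R⁆ Module.End R M) (a b : g) :
    repForm ρ a b = LinearMap.trace R M (ρ a * ρ b) := rfl

/-- The Casimir element `∑ e_i ⊗ e_i'` of a nondegenerate bilinear form, for a basis `e_i` and
the basis `e_i'` with `(e_j', e_i) = δ_{ij}`. -/
noncomputable def casimir {g : Type*} [AddCommGroup g] [Module R g] [FiniteDimensional R g]
    (B : LinearMap.BilinForm R g) (hB : B.Nondegenerate) : g ⊗[R] g :=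
  ∑ i, Module.finBasis R g i ⊗ₜ[R] B.dualBasis hB (Module.finBasis R g) i

/-- The tensor power `ω^{⊗d}` of `ω ∈ V ⊗ V` as an element of `V^{⊗2d}`: the component of degree
`2d` of the `d`-th power of `ω` in the tensor algebra. -/
noncomputable def tensorPow {V : Type*} [AddCommGroup V] [Module R V] (ω : V ⊗[R] V) (d : ℕ) :
    ⨂[R]^(2 * d) V :=
  TensorAlgebra.toDirectSum
    (TensorProduct.lift ((LinearMap.mul R (TensorAlgebra R V)).compl₁₂ (TensorAlgebra.ι R)
      (TensorAlgebra.ι R)) ω ^ d) (2 * d)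

/-- The value of the weight system belonging to `ω ∈ g ⊗ g` and a representation `ρ` on the chord
diagram of a permutation `π`: apply `ρ` to all factors of `ω^{⊗d}`, permute the factors by `π`,
compose the endomorphisms, and take the trace. -/
noncomputable def lieWeight {g M : Type*} [LieRing g] [LieAlgebra R g] [AddCommGroup M]
    [Module R M] (ω : g ⊗[R] g) (ρ : g →ₗ⁅R⁆ Module.End R M) {d : ℕ}
    (π : Equiv.Perm (Fin (2 * d))) : R :=
  LinearMap.trace R M
    (PiTensorProduct.lift (MultilinearMap.mkPiAlgebraFin R (2 * d) (Module.End R M))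
      (PiTensorProduct.reindex R (fun _ => Module.End R M) π
        (PiTensorProduct.map (fun _ => (ρ : g →ₗ[R] Module.End R M)) (tensorPow ω d))))

/-- The element `(a_1 ω, …, a_r ω)` of `(g ⊗ g)^{⊕r} ⊂ g^{⊕r} ⊗ g^{⊕r}`. -/
noncomputable def sumTensor {g : Type*} [AddCommGroup g] [Module R g] {r : ℕ} (a : Fin r → R)
    (ω : g ⊗[R] g) : (⨁ _ : Fin r, g) ⊗[R] (⨁ _ : Fin r, g) :=
  ∑ i, a i • TensorProduct.map (DirectSum.lof R (Fin r) (fun _ => g) i)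
    (DirectSum.lof R (Fin r) (fun _ => g) i) ω

/-- The endomorphism of `M^{⊗r}` acting as `u` on the `i`-th factor. -/
noncomputable def actOn {M : Type*} [AddCommGroup M] [Module R M] {r : ℕ} (i : Fin r) :
    Module.End R M →ₗ[R] Module.End R (⨂[R] _ : Fin r, M) :=
  (PiTensorProduct.mapMultilinear R (fun _ : Fin r => M) (fun _ : Fin r => M)).toLinearMap
    (fun _ => LinearMap.id) i

theorem actOn_apply {M : Type*} [AddCommGroup M] [Module R M] {r : ℕ} (i : Fin r)
    (u : Module.End R M) : actOn i u =
      PiTensorProduct.map (Function.update (fun _ : Fin r => (1 : Module.End R M)) i u) := rfl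

theorem actOn_mul {M : Type*} [AddCommGroup M] [Module R M] {r : ℕ} (i : Fin r)
    (u v : Module.End R M) : actOn i (u * v) = actOn i u * actOn i v := by
  rw [actOn_apply, actOn_apply, actOn_apply, ← PiTensorProduct.map_mul]
  congr 1
  funext j
  by_cases h : j = i
  · subst h; simp
  · simp [h]

theorem actOn_comm {M : Type*} [AddCommGroup M] [Module R M] {r : ℕ} {i j : Fin r} (hij : i ≠ j)
    (u v : Module.End R M) : actOn i u * actOn j v = actOn j v * actOn i u := by
  rw [actOn_apply, actOn_apply, ← PiTensorProduct.map_mul, ← PiTensorProduct.map_mul]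
  congr 1
  funext k
  by_cases h : k = i
  · subst h; simp [hij]
  · by_cases h' : k = j
    · subst h'; simp [h]
    · simp [h, h']

/-- The representation `τ^{⊗r}` of `g^{⊕r}` on `M^{⊗r}`, where the `i`-th summand acts by `τ` on
the `i`-th factor. -/
noncomputable def tensorRep {g M : Type*} [LieRing g] [LieAlgebra R g] [AddCommGroup M]
    [Module R M] (r : ℕ) (τ : g →ₗ⁅R⁆ Module.End R M) :
    (⨁ _ : Fin r, g) →ₗ⁅R⁆ Module.End R (⨂[R] _ : Fin r, M) :=
  DirectSum.toLieAlgebra (Module.End R (⨂[R] _ : Fin r, M))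
    (fun i => { actOn i ∘ₗ (τ : g →ₗ[R] Module.End R M) with
      map_lie' := fun {x y} => by
        change actOn i (τ ⁅x, y⁆) = ⁅actOn i (τ x), actOn i (τ y)⁆
        rw [LieHom.map_lie, Ring.lie_def, Ring.lie_def, map_sub, actOn_mul, actOn_mul] })
    (fun i j hij x y => by
      change ⁅actOn i (τ x), actOn j (τ y)⁆ = 0
      rw [Ring.lie_def, actOn_comm hij, sub_self])

end LieWeights

/-- The two families of Lie algebras `gl_n` and `so_n`. -/
inductive ClassicalFamily
  | gl
  | so

namespace ClassicalFamily

variable (R : Type*) [Field R]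

/-- The Lie algebra `gl_n` of all `n × n` matrices, or the Lie algebra `so_n` of all
skew-symmetric ones. -/
def lieAlg (F : ClassicalFamily) (n : ℕ) : LieSubalgebra R (Matrix (Fin n) (Fin n) R) :=
  match F with
  | gl => ⊤
  | so => LieAlgebra.Orthogonal.so (Fin n) R

/-- The defining representation `τ` on `R^n`. -/
noncomputable def definingRep (F : ClassicalFamily) (n : ℕ) :
    F.lieAlg R n →ₗ⁅R⁆ Module.End R (Fin n → R) :=
  (lieEquivMatrix' (R := R) (n := Fin n)).symm.toLieHom.comp (F.lieAlg R n).incl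

/-- The bilinear form: `tr (τ a ∘ τ b)` for `gl_n`, and half of it for `so_n`. -/
noncomputable def form (F : ClassicalFamily) (n : ℕ) : LinearMap.BilinForm R (F.lieAlg R n) :=
  match F with
  | gl => repForm (definingRep R gl n)
  | so => (1 / 2 : R) • repForm (definingRep R so n)

theorem repForm_definingRep (F : ClassicalFamily) (n : ℕ) (a b : F.lieAlg R n) :
    repForm (definingRep R F n) a b = (a.1 * b.1).trace := by
  rw [repForm_apply]
  have : definingRep R F n a * definingRep R F n b = Matrix.toLin' (a.1 * b.1) := by
    rw [Matrix.toLin'_mul]; rfl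
  rw [this, Matrix.trace_toLin'_eq]

theorem form_nondegenerate [CharZero R] (F : ClassicalFamily) (n : ℕ) :
    (F.form R n).Nondegenerate := by
  have hsymm : ∀ a b, F.form R n a b = F.form R n b a := by
    intro a b
    cases F
    · simp only [form]
      rw [repForm_definingRep, repForm_definingRep, Matrix.trace_mul_comm]
    · simp only [form, LinearMap.smul_apply]
      rw [repForm_definingRep, repForm_definingRep, Matrix.trace_mul_comm]
  have hrefl : (F.form R n).IsRefl := fun a b h => by rw [hsymm, h]
  refine hrefl.nondegenerate_iff_separatingLeft.2 ?_
  intro a ha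
  apply Subtype.ext
  ext i j
  have htr : ∀ (A : Matrix (Fin n) (Fin n) R) (i j : Fin n),
      (A * Matrix.single j i 1).trace = A i j := by
    intro A i j
    simp [Matrix.trace_mul_single]
  cases F
  · have := ha ⟨Matrix.single j i 1, trivial⟩
    simp only [form] at this
    rw [repForm_definingRep, htr] at this
    exact this
  · have hmem : Matrix.single j i 1 - Matrix.single i j 1 ∈ lieAlg R so n := by
      simp [lieAlg]
    have := ha ⟨_, hmem⟩
    simp only [form, LinearMap.smul_apply] at this
    rw [repForm_definingRep, mul_sub, Matrix.trace_sub, htr, htr] at this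
    have ha' : a.1.transpose = -a.1 := (LieAlgebra.Orthogonal.mem_so (Fin n) R a.1).1 a.2
    have hji : a.1 j i = - a.1 i j := by
      have := congrFun (congrFun ha' i) j
      simpa using this
    rw [hji] at this
    simp only [smul_eq_mul] at this
    have h2 : a.1 i j = 0 := by linear_combination this
    exact h2

/-- The Casimir element `ω` of this bilinear form. -/
noncomputable def casimirElement [CharZero R] (F : ClassicalFamily) (n : ℕ) :
    F.lieAlg R n ⊗[R] F.lieAlg R n :=
  casimir (F.form R n) (form_nondegenerate R F n)

end ClassicalFamily

/-! ## Representatives of orbits -/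

/-- `S` contains exactly one element of every nontrivial orbit of `σ`, all orbits being of the
form `{h, σ h, σ (σ h)}`. -/
def IsReps {H : Type} (σ : H → H) (S : Finset H) : Prop :=
  (∀ s ∈ S, σ s ≠ s) ∧ ∀ h, σ h ≠ h → ∃! s, s ∈ S ∧ (s = h ∨ s = σ h ∨ s = σ (σ h))

/-- All orbits of `σ` have the form `{h, σ h, σ (σ h)}`. -/
def SmallOrbits {H : Type} (σ : H → H) : Prop :=
  ∀ h, σ (σ h) = h ∨ σ (σ (σ h)) = h

theorem SmallOrbits.injective {H : Type} {σ : H → H} (hσ : SmallOrbits σ) :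
    Function.Injective σ := by
  intro x y hxy
  rcases hσ x with h1 | h1 <;> rcases hσ y with h2 | h2
  · rw [← h1, hxy, h2]
  · rw [hxy] at h1
    have : σ x = y := by rw [← h1]; exact h2
    grind
  · grind
  · rw [← h1, hxy, h2]

theorem exists_isReps {H : Type} [Fintype H] {σ : H → H} (hσ : SmallOrbits σ) :
    ∃ S, IsReps σ S := by
  classical
  have hinj := (Fintype.equivFin H).injective
  set k : H → Fin (Fintype.card H) := ⇑(Fintype.equivFin H)
  refine ⟨Finset.univ.filter fun h => σ h ≠ h ∧ k h ≤ k (σ h) ∧ k h ≤ k (σ (σ h)), ?_, ?_⟩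
  · intro s hs
    exact (Finset.mem_filter.1 hs).2.1
  · intro h hh
    have hi := hσ.injective
    simp only [Finset.mem_filter, Finset.mem_univ, true_and]
    have hk : ∀ x y, k x ≤ k y → k y ≤ k x → x = y := fun x y h1 h2 => hinj (le_antisymm h1 h2)
    have ht : ∀ x y, k x ≤ k y ∨ k y ≤ k x := fun x y => le_total _ _
    have htr : ∀ x y z, k x ≤ k y → k y ≤ k z → k x ≤ k z := fun x y z => le_trans
    obtain ⟨m, hm, hm'⟩ := Finset.exists_min_image {h, σ h, σ (σ h)} k ⟨h, by simp⟩
    simp only [Finset.mem_insert, Finset.mem_singleton, forall_eq_or_imp, forall_eq] at hm hm'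
    refine ⟨m, ?_, ?_⟩
    · rcases hσ h with h2 | h3 <;> grind
    · rintro s ⟨⟨h1, h2, h3⟩, h4⟩
      rcases hσ h with h5 | h5 <;> grind

theorem IsReps.prod_eq {H : Type} {R : Type*} [CommMonoid R] {σ : H → H} (hσ : SmallOrbits σ)
    {S T : Finset H} (hS : IsReps σ S) (hT : IsReps σ T) (g : H → R) (hg : ∀ h, g (σ h) = g h) :
    ∏ h ∈ S, g h = ∏ h ∈ T, g h := by
  classical
  have h1 : ∀ s ∈ S, ∃ t, t ∈ T ∧ (t = s ∨ t = σ s ∨ t = σ (σ s)) := fun s hs =>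
    (hT.2 s (hS.1 s hs)).exists
  choose! i hi hi' using h1
  have hsymm : ∀ s t, (t = s ∨ t = σ s ∨ t = σ (σ s)) → (s = t ∨ s = σ t ∨ s = σ (σ t)) := by
    intro s t h
    have := hσ.injective
    rcases hσ s with h5 | h5 <;> grind
  refine Finset.prod_bij (fun s _ => i s) (fun s hs => hi s hs) ?_ ?_ ?_
  · intro a ha b hb hab
    refine (hS.2 (i a) (hT.1 _ (hi a ha))).unique ⟨ha, hsymm _ _ (hi' a ha)⟩
      ⟨hb, ?_⟩
    rw [hab]
    exact hsymm _ _ (hi' b hb)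
  · intro t ht
    obtain ⟨s, ⟨hs, hst⟩, -⟩ := hS.2 t (hT.1 t ht)
    refine ⟨s, hs, ?_⟩
    exact (hT.2 s (hS.1 s hs)).unique ⟨hi s hs, hi' s hs⟩ ⟨ht, hsymm _ _ hst⟩
  · intro s hs
    rcases hi' s hs with h | h | h <;> rw [h] <;> simp [hg]

theorem IsReps.map {H K : Type} {σ : H → H} {τ : K → K} {S : Finset H} (hS : IsReps σ S)
    (e : H ≃ K) (he : ∀ h, e (σ h) = τ (e h)) : IsReps τ (S.map e.toEmbedding) := by
  constructor
  · intro k hk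
    obtain ⟨h, hh, rfl⟩ := Finset.mem_map.1 hk
    simpa [← he] using hS.1 h hh
  · intro k hk
    obtain ⟨h, rfl⟩ := e.surjective k
    rw [← he, e.injective.ne_iff] at hk
    obtain ⟨s, hs, hs'⟩ := hS.2 h hk
    refine ⟨e s, ?_, ?_⟩
    · simpa [← he] using hs
    · intro y hy
      obtain ⟨t, rfl⟩ := e.surjective y
      rw [hs' t (by simpa [← he] using hy)]

theorem IsReps.sum {H K : Type} {σ : H → H} {τ : K → K} {S : Finset H} {T : Finset K}
    (hS : IsReps σ S) (hT : IsReps τ T) : IsReps (Sum.map σ τ) (S.disjSum T) := by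
  constructor
  · rintro (s | s) hs
    · simpa using hS.1 s (by simpa using hs)
    · simpa using hT.1 s (by simpa using hs)
  · rintro (h | h) hh
    · obtain ⟨s, hs, hs'⟩ := hS.2 h (by simpa using hh)
      refine ⟨Sum.inl s, by simpa using hs, ?_⟩
      rintro (y | y) hy
      · rw [hs' y (by simpa using hy)]
      · simp at hy
    · obtain ⟨s, hs, hs'⟩ := hT.2 h (by simpa using hh)
      refine ⟨Sum.inr s, by simpa using hs, ?_⟩
      rintro (y | y) hy
      · simp at hy
      · rw [hs' y (by simpa using hy)]

theorem isReps_not : IsReps not {true} := by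
  constructor
  · simp
  · intro h _
    refine ⟨true, ?_, ?_⟩
    · cases h <;> simp
    · simp

/-- A set of representatives. -/
noncomputable def reps {H : Type} [Fintype H] (σ : H → H) : Finset H := by
  classical exact if h : ∃ S, IsReps σ S then h.choose else ∅

theorem isReps_reps {H : Type} [Fintype H] {σ : H → H} (hσ : SmallOrbits σ) :
    IsReps σ (reps σ) := by
  rw [reps, dif_pos (exists_isReps hσ)]
  exact (exists_isReps hσ).choose_spec

namespace Web
variable {H : Type} (W : Web H)

theorem smallOrbits_edge : SmallOrbits W.edge := fun h => Or.inl (W.edge_edge h)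
theorem smallOrbits_vert : SmallOrbits W.vert := fun h => Or.inr (W.vert_vert_vert h)

theorem isReps_edge_fuse {a b : H} (hab : a ≠ b) (ha : W.vert a = a) (hb : W.vert b = b)
    {S : Finset H} (hS : IsReps W.edge S) :
    IsReps (W.fuse a b hab ha hb).edge (S.disjSum {true}) :=
  hS.sum isReps_not

theorem vert_ne_of_ne {a h : H} (ha : W.vert a = a) (h1 : h ≠ a) : W.vert h ≠ a := fun e =>
  h1 (W.vert_inj (e.trans ha.symm))

theorem isReps_vert_fuse {a b : H} (hab : a ≠ b) (ha : W.vert a = a) (hb : W.vert b = b)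
    {S : Finset H} (hS : IsReps W.vert S) :
    IsReps (W.fuse a b hab ha hb).vert (S.disjSum {true}) := by
  constructor
  · rintro (s | s) hs
    · have := hS.1 s (by simpa using hs)
      have h1 : s ≠ a := by rintro rfl; exact this ha
      have h2 : s ≠ b := by rintro rfl; exact this hb
      simpa [Web.fuse, h1, h2] using this
    · obtain rfl : s = true := by simpa using hs
      simp [Web.fuse]
  · rintro (h | h) hh
    · by_cases h1 : h = a
      · subst h1
        refine ⟨Sum.inr true, by simp [Web.fuse], ?_⟩
        rintro (y | y) hy
        · simp only [Finset.inl_mem_disjSum] at hy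
          have := hS.1 y hy.1
          simp [Web.fuse] at hy
          rcases hy.2 with rfl | rfl
          · exact absurd ha this
          · exact absurd hb this
        · simp at hy; simp [hy]
      by_cases h2 : h = b
      · subst h2
        refine ⟨Sum.inr true, by simp [Web.fuse, hab.symm], ?_⟩
        rintro (y | y) hy
        · simp only [Finset.inl_mem_disjSum] at hy
          have := hS.1 y hy.1
          simp [Web.fuse, hab.symm] at hy
          rcases hy.2 with rfl | rfl
          · exact absurd hb this
          · exact absurd ha this
        · simp at hy; simp [hy]
      have h3 := W.vert_ne_of_ne ha h1
      have h4 := W.vert_ne_of_ne hb h2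
      obtain ⟨s, hs, hs'⟩ := hS.2 h (by simpa [Web.fuse, h1, h2] using hh)
      refine ⟨Sum.inl s, by simpa [Web.fuse, h1, h2, h3, h4] using hs, ?_⟩
      rintro (y | y) hy
      · rw [hs' y (by simpa [Web.fuse, h1, h2, h3, h4] using hy)]
      · simp [Web.fuse, h1, h2, h3, h4] at hy
    · cases h
      · simp [Web.fuse] at hh
      · refine ⟨Sum.inr true, by simp, ?_⟩
        rintro (y | y) hy
        · simp only [Finset.inl_mem_disjSum] at hy
          have := hS.1 y hy.1
          simp [Web.fuse, hab.symm] at hy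
          rcases hy.2 with rfl | rfl
          · exact absurd hb this
          · exact absurd ha this
        · simp at hy; simp [hy]

end Web

open Classical in
@[to_additive]
theorem IsReps.prod_orbits {H : Type} [Fintype H] {R : Type*} [CommMonoid R] {σ : H → H}
    (hσ : SmallOrbits σ) {S : Finset H} (hS : IsReps σ S) (g : H → R) :
    ∏ h ∈ S, ∏ x ∈ {h, σ h, σ (σ h)}, g x = ∏ h with σ h ≠ h, g h := by
  choose! r hr hr' using hS.2
  have hi := hσ.injective
  rw [← Finset.prod_fiberwise_of_maps_to (s := Finset.univ.filter fun h => σ h ≠ h) (t := S)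
    (g := r) (fun h hh => (hr h (by simpa using hh)).1)]
  refine Finset.prod_congr rfl fun s hs => Finset.prod_congr ?_ fun _ _ => rfl
  ext x
  have h1 := hS.1 s hs
  simp only [Finset.mem_insert, Finset.mem_singleton, Finset.mem_filter, Finset.mem_univ, true_and]
  constructor
  · intro hx
    have hx' : σ x ≠ x := by grind
    refine ⟨hx', (hr' x hx' s ⟨hs, ?_⟩).symm⟩
    rcases hσ s with h5 | h5 <;> grind
  · rintro ⟨h2, h3⟩
    have := (hr x h2).2
    rw [h3] at this
    rcases hσ x with h5 | h5 <;> grind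

@[to_additive]
theorem Web.prod_edge_reps {H : Type} [Fintype H] {R : Type*} [CommMonoid R] (W : Web H)
    {S : Finset H} (hS : IsReps W.edge S) (g : H → R) :
    ∏ h ∈ S, g h * g (W.edge h) = ∏ h, g h := by
  classical
  have hp := hS.prod_orbits W.smallOrbits_edge g
  rw [Finset.filter_true_of_mem fun h _ => W.edge_ne h] at hp
  rw [← hp]
  refine Finset.prod_congr rfl fun h _ => ?_
  have : ({h, W.edge h, W.edge (W.edge h)} : Finset H) = {h, W.edge h} := by
    ext; simp [W.edge_edge]; tauto
  rw [this, Finset.prod_pair (W.edge_ne h).symm]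

open Classical in
theorem Web.prod_vert_reps {H : Type} [Fintype H] {R : Type*} [CommMonoid R]
    (W : Web H) {S : Finset H} (hS : IsReps W.vert S) (g : H → R) :
    ∏ h ∈ S, g h * g (W.vert h) * g (W.vert (W.vert h)) = ∏ h with W.vert h ≠ h, g h := by
  rw [← hS.prod_orbits W.smallOrbits_vert g]
  refine Finset.prod_congr rfl fun h hh => ?_
  have h1 := hS.1 h hh
  have h2 : W.vert (W.vert h) ≠ W.vert h := fun e => h1 (W.vert_inj e)
  have h3 : h ≠ W.vert (W.vert h) := fun e => h1 (by
    have := congrArg W.vert e; rwa [W.vert_vert_vert] at this)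
  rw [Finset.prod_insert (by simp [h1.symm, h3]), Finset.prod_pair h2.symm, mul_assoc]

/-! ## State sums -/

/-- The data of a state sum for trivalent diagrams: for a Lie algebra with an invariant scalar
product, `e` are the endomorphisms by which generators of the Lie algebra act, `w` are the
coefficients of the Casimir element, and `f` are the structure constants. -/
structure WeightData (R : Type*) [CommRing R] (ι : Type*) [Fintype ι] (A : Type*) [Ring A]
    [Algebra R A] where
  e : ι → A
  w : ι → ι → R
  f : ι → ι → ι → R
  w_symm : ∀ x y, w x y = w y x
  f_cyc : ∀ x y z, f x y z = f y z x
  stu : ∀ a b, ∑ p, ∑ q, (w p q * f p b a) • e q = e a * e b - e b * e a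

namespace WeightData

variable {R : Type*} [CommRing R] {ι : Type*} [Fintype ι] {A : Type*} [Ring A] [Algebra R A]
  (X : WeightData R ι A)

/-- The contribution of edges and vertices to a state. -/
noncomputable def coef {H : Type} [Fintype H] (W : Web H) (c : H → ι) : R :=
  (∏ h ∈ reps W.edge, X.w (c h) (c (W.edge h))) *
    ∏ h ∈ reps W.vert, X.f (c h) (c (W.vert h)) (c (W.vert (W.vert h)))

theorem coef_eq {H : Type} [Fintype H] (W : Web H) (c : H → ι) {S T : Finset H}
    (hS : IsReps W.edge S) (hT : IsReps W.vert T) : X.coef W c =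
      (∏ h ∈ S, X.w (c h) (c (W.edge h))) *
        ∏ h ∈ T, X.f (c h) (c (W.vert h)) (c (W.vert (W.vert h))) := by
  rw [coef]
  congr 1
  · refine (isReps_reps W.smallOrbits_edge).prod_eq W.smallOrbits_edge hS
      (fun h => X.w (c h) (c (W.edge h))) fun h => ?_
    rw [W.edge_edge, X.w_symm]
  · refine (isReps_reps W.smallOrbits_vert).prod_eq W.smallOrbits_vert hT
      (fun h => X.f (c h) (c (W.vert h)) (c (W.vert (W.vert h)))) fun h => ?_
    rw [W.vert_vert_vert, ← X.f_cyc]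

open Classical in
/-- The sum over all states of a diagram that is cut open at the base point. -/
noncomputable def stateSum {H : Type} [Fintype H] (D : Diagram H) : A :=
  ∑ c : H → ι, X.coef D.toWeb c • (D.legs.map fun h => X.e (c h)).prod

theorem stateSum_def {H : Type} [Fintype H] [Fintype (H → ι)] (D : Diagram H) : X.stateSum D =
    ∑ c : H → ι, X.coef D.toWeb c • (D.legs.map fun h => X.e (c h)).prod := by
  rw [stateSum]
  congr!

variable {H K : Type} [Fintype H] [Fintype K]

theorem coef_equiv {W : Web H} {V : Web K} (e : H ≃ K) (h1 : ∀ h, e (W.edge h) = V.edge (e h))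
    (h2 : ∀ h, e (W.vert h) = V.vert (e h)) (c : K → ι) :
    X.coef V c = X.coef W (c ∘ e) := by
  rw [X.coef_eq V c ((isReps_reps W.smallOrbits_edge).map e h1)
    ((isReps_reps W.smallOrbits_vert).map e h2), coef, Finset.prod_map, Finset.prod_map]
  simp [h1, h2]

open Classical in
theorem stateSum_equiv {D : Diagram H} {E : Diagram K} (e : H ≃ K)
    (h1 : ∀ h, e (D.edge h) = E.edge (e h)) (h2 : ∀ h, e (D.vert h) = E.vert (e h)) :
    X.stateSum D = ∑ c : K → ι, X.coef E.toWeb c •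
      ((D.legs.map e).map fun k => X.e (c k)).prod := by
  rw [stateSum]
  refine Fintype.sum_equiv (e.arrowCongr (Equiv.refl ι)) _ _ fun c => ?_
  rw [X.coef_equiv e h1 h2]
  congr 2
  · funext h; simp
  · simp [Function.comp_def]

theorem trace_stateSum_equivalent {M : Type*} [AddCommGroup M] [Module R M] (tr : A →ₗ[R] M)
    (htr : ∀ x y, tr (x * y) = tr (y * x)) {D : Diagram H} {E : Diagram K}
    (h : D.Equivalent E) : tr (X.stateSum D) = tr (X.stateSum E) := by
  classical
  obtain ⟨e, h1, h2, n, h3⟩ := h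
  rw [X.stateSum_equiv e h1 h2]
  simp only [stateSum, map_sum]
  refine Fintype.sum_congr _ _ fun c => ?_
  rw [map_smul, map_smul, ← h3]
  congr 1
  generalize D.legs.map e = l
  rw [List.map_rotate]
  generalize l.map _ = l
  rw [← List.rotate_mod]
  by_cases hl : l = []
  · simp [hl]
  have : n % l.length ≤ l.length := (Nat.mod_lt _ (List.length_pos_iff.2 hl)).le
  rw [List.rotate_eq_drop_append_take this, List.prod_append, htr, ← List.prod_append,
    List.take_append_drop]

theorem stateSum_append (D : Diagram H) (E : Diagram K) :
    X.stateSum (D.append E) = X.stateSum D * X.stateSum E := by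
  classical
  rw [X.stateSum_def (D.append E), X.stateSum_def D, X.stateSum_def E, Finset.sum_mul_sum,
    ← Fintype.sum_prod_type']
  refine Fintype.sum_equiv (Equiv.sumArrowEquivProdArrow H K ι) _ _ fun c => ?_
  rw [X.coef_eq (D.append E).toWeb c
    ((isReps_reps D.smallOrbits_edge).sum (isReps_reps E.smallOrbits_edge))
    ((isReps_reps D.smallOrbits_vert).sum (isReps_reps E.smallOrbits_vert)), coef, coef]
  simp only [Finset.prod_disjSum, Diagram.append, Sum.map_inl, Sum.map_inr,
    Equiv.sumArrowEquivProdArrow, Equiv.coe_fn_mk, List.map_append,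
    List.map_map, Function.comp_def, List.prod_append, smul_mul_smul_comm]
  congr 1
  ring

theorem stateSum_circle : X.stateSum Diagram.circle = 1 := by
  classical
  have : ∀ σ : Fin 0 → Fin 0, reps σ = ∅ := fun σ => Finset.eq_empty_of_isEmpty _
  simp [stateSum, coef, Diagram.circle, this]

theorem stateSum_fuse (D : Diagram H) (a b : H) (l : List H) (hl : D.legs = a :: b :: l) :
    X.stateSum (D.fuse a b l hl) = X.stateSum D - X.stateSum (D.swap a b l hl) := by
  classical
  obtain ⟨hab, ha, hb⟩ := D.fuse_aux hl
  have hS := isReps_reps D.smallOrbits_edge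
  have hT := isReps_reps D.smallOrbits_vert
  rw [X.stateSum_def (D.fuse a b l hl), X.stateSum_def D, X.stateSum_def (D.swap a b l hl),
    ← Finset.sum_sub_distrib]
  refine (Fintype.sum_equiv (Equiv.sumArrowEquivProdArrow H Bool ι) _ (fun cd =>
    X.coef (D.fuse a b l hl).toWeb ((Equiv.sumArrowEquivProdArrow H Bool ι).symm cd) •
      ((D.fuse a b l hl).legs.map fun h => X.e
        ((Equiv.sumArrowEquivProdArrow H Bool ι).symm cd h)).prod) fun c => by
          rw [Equiv.symm_apply_apply]).trans ?_
  rw [Fintype.sum_prod_type]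
  refine Fintype.sum_congr _ _ fun c => ?_
  have hnb : ∀ h ∈ reps D.vert, h ≠ a ∧ h ≠ b ∧ D.vert h ≠ a ∧ D.vert h ≠ b := by
    intro h hh
    have := hT.1 h hh
    have h1 : h ≠ a := by rintro rfl; exact this ha
    have h2 : h ≠ b := by rintro rfl; exact this hb
    exact ⟨h1, h2, D.vert_ne_of_ne ha h1, D.vert_ne_of_ne hb h2⟩
  have hco : ∀ d : Bool → ι, X.coef (D.fuse a b l hl).toWeb
      ((Equiv.sumArrowEquivProdArrow H Bool ι).symm (c, d)) = X.coef D.toWeb c *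
        (X.w (d true) (d false) * X.f (d true) (c b) (c a)) := by
    intro d
    rw [X.coef_eq (D.fuse a b l hl).toWeb _ (D.isReps_edge_fuse hab ha hb hS)
      (D.isReps_vert_fuse hab ha hb hT), coef]
    simp only [Finset.prod_disjSum, Finset.prod_singleton]
    rw [Finset.prod_congr (s₁ := reps D.vert) rfl (g := fun h => X.f (c h) (c (D.vert h)) (c (D.vert (D.vert h))))]
    · simp [Diagram.fuse, Web.fuse, Equiv.sumArrowEquivProdArrow, hab.symm]
      ring
    · intro h hh
      obtain ⟨h1, h2, h3, h4⟩ := hnb h hh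
      simp [Diagram.fuse, Web.fuse, Equiv.sumArrowEquivProdArrow, h1, h2, h3, h4]
  simp only [hco]
  have hsw : (D.swap a b l hl).toWeb = D.toWeb := rfl
  have hsl : (D.swap a b l hl).legs = b :: a :: l := rfl
  have hfl : (D.fuse a b l hl).legs = Sum.inr false :: l.map Sum.inl := rfl
  rw [hsw, hsl, hfl, hl, ← smul_sub]
  simp only [List.map_cons, List.prod_cons, List.map_map, Function.comp_def, mul_smul,
    ← Finset.smul_sum]
  congr 1
  rw [← mul_assoc, ← mul_assoc, ← sub_mul, ← X.stu, ← (Equiv.boolArrowEquivProd ι).symm.sum_comp,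
    Fintype.sum_prod_type, Finset.sum_comm, Finset.sum_mul]
  refine Fintype.sum_congr _ _ fun p => ?_
  rw [Finset.sum_mul]
  refine Fintype.sum_congr _ _ fun q => ?_
  simp [Equiv.boolArrowEquivProd, Equiv.sumArrowEquivProdArrow, mul_smul]

/-- The linear form on `A` given by a state sum and a trace. -/
noncomputable def linearWeight {M : Type*} [AddCommGroup M] [Module R M] (tr : A →ₗ[R] M)
    (htr : ∀ x y, tr (x * y) = tr (y * x)) : DiagramAlgebra R →ₗ[R] M :=
  (Submodule.span R (stuRelations R)).liftQ
    (Finsupp.linearCombination R fun x : TrivalentDiagram =>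
      Quotient.liftOn x (fun D => tr (X.stateSum D.2))
        fun _ _ h => X.trace_stateSum_equivalent tr htr h) <| by
      rw [Submodule.span_le]
      rintro _ ⟨n, D, a, b, l, hl, rfl⟩
      have key : ∀ {H : Type} [Fintype H] (D : Diagram H), Quotient.liftOn D.toClass
          (fun D => tr (X.stateSum D.2)) (fun _ _ h => X.trace_stateSum_equivalent tr htr h) =
            tr (X.stateSum D) := fun D =>
        (X.trace_stateSum_equivalent tr htr (D.equivalent_relabel _)).symm
      simp [key, stateSum_fuse]

theorem linearWeight_mk {M : Type*} [AddCommGroup M] [Module R M] (tr : A →ₗ[R] M)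
    (htr : ∀ x y, tr (x * y) = tr (y * x)) (D : Diagram H) :
    X.linearWeight tr htr (DiagramAlgebra.mk R D) = tr (X.stateSum D) := by
  have h1 : X.linearWeight tr htr (DiagramAlgebra.mk R D) =
    Finsupp.linearCombination R (fun x : TrivalentDiagram =>
      Quotient.liftOn x (fun D => tr (X.stateSum D.2))
        fun _ _ h => X.trace_stateSum_equivalent tr htr h) (Finsupp.single D.toClass 1) := rfl
  rw [h1, Finsupp.linearCombination_single, one_smul]
  exact (X.trace_stateSum_equivalent tr htr (D.equivalent_relabel _)).symm

/-- If `g` permutes the generators up to signs, compatibly with `w` and `f`, then it commutes with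
all state sums. -/
theorem commute_stateSum (g : A) (σ : Equiv.Perm ι) (s : ι → R) (hs : ∀ x, s x * s x = 1)
    (hg : ∀ x, g * X.e x = s x • (X.e (σ x) * g))
    (hw : ∀ x y, X.w (σ x) (σ y) = s x * s y * X.w x y)
    (hf : ∀ x y z, X.f (σ x) (σ y) (σ z) = s x * s y * s z * X.f x y z) (D : Diagram H) :
    Commute g (X.stateSum D) := by
  classical
  have hprod : ∀ (l : List H) (c : H → ι), g * (l.map fun h => X.e (c h)).prod =
      (l.map fun h => s (c h)).prod • ((l.map fun h => X.e (σ (c h))).prod * g) := by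
    intro l c
    induction l with
    | nil => simp
    | cons h l ih =>
      simp only [List.map_cons, List.prod_cons]
      rw [← mul_assoc, hg, smul_mul_assoc, mul_assoc, ih, mul_smul_comm, smul_smul, mul_assoc]
  have hcoef : ∀ c : H → ι, X.coef D.toWeb (σ ∘ c) =
      X.coef D.toWeb c * (D.legs.map fun h => s (c h)).prod := by
    intro c
    simp only [coef, Function.comp_apply, hw, hf, Finset.prod_mul_distrib (f := fun h =>
      s (c h) * s (c (D.edge h))), Finset.prod_mul_distrib (f := fun h =>
      s (c h) * s (c (D.vert h)) * s (c (D.vert (D.vert h))))]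
    rw [D.prod_edge_reps (isReps_reps D.smallOrbits_edge) (fun h => s (c h)),
      D.prod_vert_reps (isReps_reps D.smallOrbits_vert) (fun h => s (c h))]
    have h1 : (D.legs.map fun h => s (c h)).prod = ∏ h with ¬ D.vert h ≠ h, s (c h) := by
      rw [← List.prod_toFinset _ D.nodup]
      refine Finset.prod_congr ?_ fun _ _ => rfl
      ext h
      simp [D.mem_legs]
    have h2 : (∏ h with D.vert h ≠ h, s (c h)) * (∏ h with D.vert h ≠ h, s (c h)) = 1 := by
      rw [← Finset.prod_mul_distrib]
      simp [hs]
    rw [h1, ← Finset.prod_filter_mul_prod_filter_not Finset.univ (fun h => D.vert h ≠ h)]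
    linear_combination (∏ h with ¬ D.vert h ≠ h, s (c h)) *
      (∏ x ∈ reps D.edge, X.w (c x) (c (D.edge x))) *
      (∏ x ∈ reps D.vert, X.f (c x) (c (D.vert x)) (c (D.vert (D.vert x)))) * h2
  rw [Commute, SemiconjBy, stateSum, Finset.mul_sum, Finset.sum_mul]
  refine Fintype.sum_equiv ((Equiv.refl H).arrowCongr σ) _ _ fun c => ?_
  have : (Equiv.refl H).arrowCongr σ c = σ ∘ c := rfl
  rw [this, hcoef, mul_smul_comm, hprod, smul_smul, smul_mul_assoc]
  rfl

end WeightData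

namespace WeightData

variable {R : Type*} [Field R] {ι : Type*} [Fintype ι] {A : Type*} [Ring A] [Algebra R A]
  {B : Type*} [Ring B] [Algebra R B]

/-- The data belonging to the direct sum of `r` copies of a Lie algebra, with the Casimir element
multiplied by `a i` on the `i`-th summand. -/
def power (X : WeightData R ι A) {r : ℕ} (φ : Fin r → A →ₐ[R] B)
    (hφ : ∀ i j, i ≠ j → ∀ x y, Commute (φ i x) (φ j y)) (a : Fin r → R) (ha : ∀ i, a i ≠ 0) :
    WeightData R (Fin r × ι) B where
  e p := φ p.1 (X.e p.2)
  w p q := if p.1 = q.1 then a p.1 * X.w p.2 q.2 else 0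
  f p q s := if p.1 = q.1 ∧ q.1 = s.1 then (a p.1)⁻¹ * X.f p.2 q.2 s.2 else 0
  w_symm := by
    rintro ⟨i, x⟩ ⟨j, y⟩
    by_cases h : i = j
    · subst h; simp [X.w_symm x y]
    · simp [h, Ne.symm h]
  f_cyc := by
    rintro ⟨i, x⟩ ⟨j, y⟩ ⟨k, z⟩
    by_cases h : i = j
    · subst h
      by_cases h' : i = k
      · subst h'; simp [X.f_cyc x y z]
      · simp [h']
    · have : ¬ (j = k ∧ k = i) := fun h' => h (h'.1.trans h'.2).symm
      simp [h, this]
  stu := by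
    rintro ⟨i, x⟩ ⟨j, y⟩
    by_cases h : i = j
    · subst h
      rw [← map_mul, ← map_mul, ← map_sub, ← X.stu, Fintype.sum_prod_type, Finset.sum_eq_single i]
      · rw [map_sum]
        refine Fintype.sum_congr _ _ fun p => ?_
        rw [map_sum, Fintype.sum_prod_type, Finset.sum_eq_single i]
        · refine Fintype.sum_congr _ _ fun q => ?_
          simp only [if_true, true_and, map_smul]
          congr 1
          field_simp [ha i]
        · intro k _ hk; simp [hk.symm]
        · simp
      · intro k _ hk; simp [hk]
      · simp
    · rw [(hφ i j h _ _).eq, sub_self]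
      refine Finset.sum_eq_zero fun p _ => Finset.sum_eq_zero fun q _ => ?_
      have : ¬ (p.1 = j ∧ j = i) := fun h' => h h'.2.symm
      simp [this]

theorem commute_stateSum_power (X : WeightData R ι A) {r : ℕ} (φ : Fin r → A →ₐ[R] B)
    (hφ : ∀ i j, i ≠ j → ∀ x y, Commute (φ i x) (φ j y)) (a : Fin r → R) (ha : ∀ i, a i ≠ 0)
    (g : A) (σ : Equiv.Perm ι) (s : ι → R) (hs : ∀ x, s x * s x = 1)
    (hg : ∀ x, g * X.e x = s x • (X.e (σ x) * g))
    (hw : ∀ x y, X.w (σ x) (σ y) = s x * s y * X.w x y)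
    (hf : ∀ x y z, X.f (σ x) (σ y) (σ z) = s x * s y * s z * X.f x y z)
    {H : Type} [Fintype H] (D : Diagram H) (j : Fin r) :
    Commute (φ j g) ((X.power φ hφ a ha).stateSum D) := by
  let τ : Equiv.Perm (Fin r × ι) :=
    { toFun := fun p => (p.1, if p.1 = j then σ p.2 else p.2)
      invFun := fun p => (p.1, if p.1 = j then σ.symm p.2 else p.2)
      left_inv := by rintro ⟨i, x⟩; by_cases h : i = j <;> simp [h]
      right_inv := by rintro ⟨i, x⟩; by_cases h : i = j <;> simp [h] }
  have hτ1 : ∀ i x, τ (i, x) = (i, if i = j then σ x else x) := fun i x => rfl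
  refine commute_stateSum _ _ τ (fun p => if p.1 = j then s p.2 else 1) ?_ ?_ ?_ ?_ D
  · rintro ⟨i, x⟩
    by_cases h : i = j <;> simp [h, hs]
  · rintro ⟨i, x⟩
    by_cases h : i = j
    · subst h
      simp [hτ1, power, ← map_mul, hg]
    · simpa [hτ1, power, h] using (hφ j i (Ne.symm h) g (X.e x)).eq
  · rintro ⟨i, x⟩ ⟨k, y⟩
    by_cases h : i = k
    · subst h
      by_cases h : i = j
      · subst h; simp [hτ1, power, hw]; ring
      · simp [hτ1, power, h]
    · simp [hτ1, power, h]
  · rintro ⟨i, x⟩ ⟨k, y⟩ ⟨l, z⟩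
    by_cases h : i = k ∧ k = l
    · obtain ⟨rfl, rfl⟩ := h
      by_cases h : i = j
      · subst h; simp [hτ1, power, hf]; ring
      · simp [hτ1, power, h]
    · simp [hτ1, power, h]

end WeightData

/-! ## Tensor products of matrices -/

theorem eq_of_update_eq {α : Type*} {r n : ℕ} {t : (Fin r → Fin n) → α}
    (h : ∀ I j k, t (Function.update I j k) = t I) (I J : Fin r → Fin n) : t I = t J := by
  have : ∀ s : Finset (Fin r), t (s.piecewise I J) = t J := by
    intro s
    induction s using Finset.induction_on with
    | empty => simp
    | insert i s hi ih => rw [Finset.piecewise_insert, h, ih]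
  simpa using this Finset.univ

section tens

variable {R : Type*} [CommRing R] {r n : ℕ}

/-- The tensor product of `r` matrices. -/
def tens (a : Fin r → Matrix (Fin n) (Fin n) R) :
    Matrix (Fin r → Fin n) (Fin r → Fin n) R :=
  Matrix.of fun I J => ∏ i, a i (I i) (J i)

theorem tens_apply (a : Fin r → Matrix (Fin n) (Fin n) R) (I J : Fin r → Fin n) :
    tens a I J = ∏ i, a i (I i) (J i) := rfl

theorem tens_one : tens (1 : Fin r → Matrix (Fin n) (Fin n) R) = 1 := by
  ext I J
  rw [tens_apply]
  by_cases h : I = J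
  · subst h; simp
  · obtain ⟨i, hi⟩ := Function.ne_iff.1 h
    rw [Matrix.one_apply_ne h]
    exact Finset.prod_eq_zero (Finset.mem_univ i) (by simp [Matrix.one_apply_ne hi])

theorem tens_mul (a b : Fin r → Matrix (Fin n) (Fin n) R) :
    tens (a * b) = tens a * tens b := by
  ext I J
  simp only [tens_apply, Matrix.mul_apply, Pi.mul_apply, ← Finset.prod_mul_distrib]
  rw [Finset.prod_univ_sum, Fintype.piFinset_univ]

theorem trace_tens (a : Fin r → Matrix (Fin n) (Fin n) R) :
    (tens a).trace = ∏ i, (a i).trace := by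
  simp only [Matrix.trace, Matrix.diag_apply, tens_apply]
  rw [Finset.prod_univ_sum, Fintype.piFinset_univ]

/-- `tens` as a monoid homomorphism. -/
def tensHom : (Fin r → Matrix (Fin n) (Fin n) R) →*
    Matrix (Fin r → Fin n) (Fin r → Fin n) R where
  toFun := tens
  map_one' := tens_one
  map_mul' := tens_mul

theorem tens_mulSingle_apply (i : Fin r) (a : Matrix (Fin n) (Fin n) R) (I J : Fin r → Fin n) :
    tens (Pi.mulSingle i a) I J =
      a (I i) (J i) * ∏ j ∈ Finset.univ.erase i, (1 : Matrix (Fin n) (Fin n) R) (I j) (J j) := by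
  rw [tens_apply, ← Finset.mul_prod_erase _ _ (Finset.mem_univ i), Pi.mulSingle_eq_same]
  congr 1
  refine Finset.prod_congr rfl fun j hj => ?_
  rw [Pi.mulSingle_eq_of_ne (Finset.ne_of_mem_erase hj)]

/-- The matrix `a` acting on the `i`-th factor. -/
def tensSingle (i : Fin r) : Matrix (Fin n) (Fin n) R →ₐ[R]
    Matrix (Fin r → Fin n) (Fin r → Fin n) R :=
  AlgHom.ofLinearMap
    { toFun := fun a => tens (Pi.mulSingle i a)
      map_add' := fun a b => by
        ext I J; simp [tens_mulSingle_apply, add_mul]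
      map_smul' := fun c a => by
        ext I J; simp [tens_mulSingle_apply, mul_assoc] }
    (by
      change tens (Pi.mulSingle i 1) = 1
      rw [Pi.mulSingle_one, tens_one])
    (fun a b => by
      change tens (Pi.mulSingle i (a * b)) = tens (Pi.mulSingle i a) * tens (Pi.mulSingle i b)
      rw [← tens_mul, Pi.mulSingle_mul])

theorem tensSingle_apply (i : Fin r) (a : Matrix (Fin n) (Fin n) R) :
    tensSingle i a = tens (Pi.mulSingle i a) := rfl

theorem commute_tensSingle (i j : Fin r) (h : i ≠ j) (x y : Matrix (Fin n) (Fin n) R) :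
    Commute (tensSingle i x) (tensSingle j y) := by
  rw [tensSingle_apply, tensSingle_apply]
  exact (Pi.mulSingle_commute (f := fun _ => Matrix (Fin n) (Fin n) R) h x y).map tensHom

theorem tensSingle_diagonal (i : Fin r) (ε : Fin n → R) :
    tensSingle i (Matrix.diagonal ε) = Matrix.diagonal fun I => ε (I i) := by
  ext I J
  rw [tensSingle_apply, tens_mulSingle_apply]
  by_cases h : I = J
  · subst h; simp
  · rw [Matrix.diagonal_apply_ne _ h]
    obtain ⟨j, hj⟩ := Function.ne_iff.1 h
    by_cases hij : j = i
    · subst hij; rw [Matrix.diagonal_apply_ne _ hj, zero_mul]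
    · have h0 : (1 : Matrix (Fin n) (Fin n) R) (I j) (J j) = 0 := Matrix.one_apply_ne hj
      rw [Finset.prod_eq_zero (Finset.mem_erase.2 ⟨hij, Finset.mem_univ j⟩) h0, mul_zero]

/-- The matrix of a permutation. -/
def permMat (R : Type*) [CommRing R] (σ : Equiv.Perm (Fin n)) : Matrix (Fin n) (Fin n) R :=
  Matrix.of fun i j => if i = σ j then 1 else 0

theorem permMat_mul (σ : Equiv.Perm (Fin n)) (a : Matrix (Fin n) (Fin n) R) :
    permMat R σ * a = a.submatrix σ.symm id := by
  ext i j
  rw [Matrix.mul_apply, Finset.sum_eq_single (σ.symm i)]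
  · simp [permMat]
  · intro b _ hb
    have : i ≠ σ b := fun e => hb (by simp [e])
    simp [permMat, this]
  · simp

theorem mul_permMat (σ : Equiv.Perm (Fin n)) (a : Matrix (Fin n) (Fin n) R) :
    a * permMat R σ = a.submatrix id σ := by
  ext i j
  simp [permMat, Matrix.mul_apply]

/-- A matrix commuting with sign changes and permutations in every factor is a scalar. -/
theorem eq_smul_one_of_commute [IsDomain R] [CharZero R]
    (T : Matrix (Fin r → Fin n) (Fin r → Fin n) R)
    (h1 : ∀ j, ∀ ε : Fin n → R, (∀ i, ε i * ε i = 1) →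
      Commute (tensSingle j (Matrix.diagonal ε)) T)
    (h2 : ∀ j, ∀ σ : Equiv.Perm (Fin n), Commute (tensSingle j (permMat R σ)) T) :
    ∃ t : R, T = t • 1 := by
  have hd : T = Matrix.diagonal fun I => T I I := by
    ext I J
    by_cases h : I = J
    · subst h; simp
    · rw [Matrix.diagonal_apply_ne _ h]
      obtain ⟨j, hj⟩ := Function.ne_iff.1 h
      have := (h1 j (fun k => if k = I j then -1 else 1) (fun k => by split_ifs <;> simp)).eq
      rw [tensSingle_diagonal] at this
      have := congrFun (congrFun this I) J
      simp only [Matrix.diagonal_mul, Matrix.mul_diagonal, if_true, hj.symm, if_false, neg_mul,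
        one_mul, mul_one] at this
      have h2 : (2 : R) * T I J = 0 := by linear_combination -this
      simpa using h2
  have hc : ∀ (I : Fin r → Fin n) j k,
      (fun I => T I I) (Function.update I j k) = (fun I => T I I) I := by
    intro I j k
    have := (h2 j (Equiv.swap (I j) k)).eq
    rw [hd] at this
    have := congrFun (congrFun this I) (Function.update I j k)
    rw [Matrix.mul_diagonal, Matrix.diagonal_mul, tensSingle_apply, tens_mulSingle_apply,
      Finset.prod_eq_one, mul_one] at this
    · simpa [permMat] using this
    · intro i hi
      rw [Function.update_of_ne (Finset.ne_of_mem_erase hi), Matrix.one_apply_eq]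
  rcases isEmpty_or_nonempty (Fin r → Fin n) with hE | ⟨⟨I⟩⟩
  · exact ⟨0, Subsingleton.elim _ _⟩
  · refine ⟨T I I, ?_⟩
    rw [hd]
    ext J K
    by_cases h : J = K
    · subst h
      simpa using eq_of_update_eq (t := fun I => T I I) hc J I
    · simp [h]

end tens

namespace ClassicalFamily

variable (R : Type*) [Field R] {n : ℕ}

/-- Generators of `gl_n`, respectively `so_n`. -/
def gen : ClassicalFamily → Fin n × Fin n → Matrix (Fin n) (Fin n) R
  | gl, p => Matrix.single p.1 p.2 1
  | so, p => Matrix.single p.1 p.2 1 - Matrix.single p.2 p.1 1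

/-- The coefficients of the Casimir element with respect to the generators. -/
def casCoef : ClassicalFamily → Fin n × Fin n → Fin n × Fin n → R
  | gl, p, q => if q = p.swap then 1 else 0
  | so, p, q => if q = p then -(1 / 2) else 0

/-- The factor of the trace form in the invariant form. -/
def formCoef : ClassicalFamily → R
  | gl => 1
  | so => 1 / 2

/-- The structure constants with respect to the generators. -/
def structCoef (F : ClassicalFamily) (p q s : Fin n × Fin n) : R :=
  F.formCoef R * (F.gen R p * (F.gen R s * F.gen R q - F.gen R q * F.gen R s)).trace

theorem gen_so_transpose (p : Fin n × Fin n) :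
    (so.gen R p).transpose = -so.gen R p := by
  simp [gen, Matrix.transpose_single]

theorem sum_gl (Y : Matrix (Fin n) (Fin n) R) :
    ∑ p, ∑ q, (casCoef R gl p q * (formCoef R gl * (gen R gl p * Y).trace)) • gen R gl q = Y := by
  have : ∀ p : Fin n × Fin n, ∑ q, (casCoef R gl p q * (formCoef R gl * (gen R gl p * Y).trace)) •
      gen R gl q = Matrix.single p.2 p.1 (Y p.2 p.1) := by
    intro p
    rw [Finset.sum_eq_single p.swap]
    · simp [casCoef, gen, formCoef, Matrix.trace_single_mul]
    · intro q _ hq; simp [casCoef, hq]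
    · simp
  rw [Fintype.sum_congr _ _ this, Fintype.sum_prod_type_right]
  exact (Matrix.matrix_eq_sum_single Y).symm

theorem sum_so [CharZero R] (Y : Matrix (Fin n) (Fin n) R) (hY : Y.transpose = -Y) :
    ∑ p, ∑ q, (casCoef R so p q * (formCoef R so * (gen R so p * Y).trace)) • gen R so q = Y := by
  have hY' : ∀ i j, Y j i = - Y i j := fun i j => congrFun (congrFun hY i) j
  have : ∀ p : Fin n × Fin n, ∑ q, (casCoef R so p q * (formCoef R so * (gen R so p * Y).trace)) •
      gen R so q = (1 / 2 : R) • (Matrix.single p.1 p.2 (Y p.1 p.2) +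
        Matrix.single p.2 p.1 (Y p.2 p.1)) := by
    intro p
    rw [Finset.sum_eq_single p]
    · simp only [casCoef, gen, formCoef, sub_mul, Matrix.trace_sub, Matrix.trace_single_mul,
        hY' p.1 p.2, if_true]
      ext i j
      simp [Matrix.single_apply]
      split_ifs <;> ring
    · intro q _ hq; simp [casCoef, hq]
    · simp
  have h1 : ∑ p : Fin n × Fin n, Matrix.single p.1 p.2 (Y p.1 p.2) = Y := by
    rw [Fintype.sum_prod_type]; exact (Matrix.matrix_eq_sum_single Y).symm
  have h2 : ∑ p : Fin n × Fin n, Matrix.single p.2 p.1 (Y p.2 p.1) = Y := by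
    rw [Fintype.sum_prod_type_right]; exact (Matrix.matrix_eq_sum_single Y).symm
  rw [Fintype.sum_congr _ _ this, ← Finset.smul_sum, Finset.sum_add_distrib, h1, h2, ← two_smul R,
    smul_smul]
  simp

/-- The data of the state sum for `gl_n`, respectively `so_n`. -/
def weightData [CharZero R] (F : ClassicalFamily) (n : ℕ) :
    WeightData R (Fin n × Fin n) (Matrix (Fin n) (Fin n) R) where
  e := F.gen R
  w := F.casCoef R
  f := F.structCoef R
  w_symm p q := by
    cases F
    · have : q = p.swap ↔ p = q.swap := ⟨fun h => by simp [h], fun h => by simp [h]⟩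
      simp [casCoef, this]
    · simp [casCoef, eq_comm]
  f_cyc p q s := by
    simp only [structCoef, mul_sub, Matrix.trace_sub, ← mul_assoc]
    rw [Matrix.trace_mul_cycle (F.gen R p) (F.gen R s) (F.gen R q),
      Matrix.trace_mul_cycle (F.gen R q) (F.gen R s) (F.gen R p)]
  stu a b := by
    cases F
    · exact sum_gl R _
    · refine sum_so R _ ?_
      simp [Matrix.transpose_sub, Matrix.transpose_mul, gen_so_transpose]

theorem structCoef_symm (F : ClassicalFamily) (g g' : Matrix (Fin n) (Fin n) R) (hgg : g' * g = 1)
    (σ : Equiv.Perm (Fin n × Fin n)) (s : Fin n × Fin n → R) (hs : ∀ x, s x * s x = 1)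
    (hg : ∀ x, g * F.gen R x = s x • (F.gen R (σ x) * g)) (x y z : Fin n × Fin n) :
    F.structCoef R (σ x) (σ y) (σ z) = s x * s y * s z * F.structCoef R x y z := by
  have hgg' : g * g' = 1 := mul_eq_one_comm.1 hgg
  have h : ∀ x, F.gen R (σ x) = s x • (g * F.gen R x * g') := by
    intro x
    rw [hg, smul_mul_assoc, smul_smul, hs, one_smul, mul_assoc, hgg', mul_one]
  have h2 : ∀ a b : Matrix (Fin n) (Fin n) R, (g * a * g') * (g * b * g') = g * (a * b) * g' := by
    intro a b
    calc _ = g * a * (g' * g) * b * g' := by simp only [mul_assoc]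
      _ = _ := by rw [hgg]; simp only [mul_assoc, one_mul]
  simp only [structCoef, h, mul_sub, h2, Matrix.trace_sub, Matrix.trace_smul,
    mul_smul_comm, smul_mul_assoc]
  have h3 : ∀ a : Matrix (Fin n) (Fin n) R, (g * a * g').trace = a.trace := by
    intro a
    rw [Matrix.trace_mul_cycle, hgg, one_mul]
  simp only [h3, smul_eq_mul]
  ring

theorem diagonal_mul_gen (F : ClassicalFamily) (ε : Fin n → R) (hε : ∀ i, ε i * ε i = 1)
    (p : Fin n × Fin n) : Matrix.diagonal ε * F.gen R p =
      (ε p.1 * ε p.2) • (F.gen R p * Matrix.diagonal ε) := by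
  have key : ∀ i j, Matrix.diagonal ε * Matrix.single i j (1 : R) =
      (ε i * ε j) • (Matrix.single i j 1 * Matrix.diagonal ε) := by
    intro i j
    ext k l
    simp only [Matrix.diagonal_mul, Matrix.smul_apply, Matrix.mul_diagonal, Matrix.single_apply]
    split_ifs with h
    · obtain ⟨rfl, rfl⟩ := h
      simp [mul_assoc, hε]
    · simp
  cases F
  · exact key _ _
  · simp only [gen, mul_sub, sub_mul, smul_sub, key]
    rw [mul_comm (ε p.2)]

theorem permMat_mul_gen (F : ClassicalFamily) (σ : Equiv.Perm (Fin n)) (p : Fin n × Fin n) :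
    permMat R σ * F.gen R p = (1 : R) • (F.gen R (σ.prodCongr σ p) * permMat R σ) := by
  have key : ∀ i j, permMat R σ * Matrix.single i j (1 : R) =
      Matrix.single (σ i) (σ j) 1 * permMat R σ := by
    intro i j
    rw [permMat_mul, mul_permMat]
    ext k l
    simp [Matrix.single_apply, Equiv.eq_symm_apply]
  rw [one_smul]
  cases F
  · exact key _ _
  · simp [gen, mul_sub, sub_mul, key]

variable [CharZero R] {r : ℕ}

/-- The data of the state sum for the direct sum of `r` copies of `gl_n`, respectively `so_n`. -/
noncomputable def powerData (F : ClassicalFamily) (n : ℕ) (a : Fin r → R) (ha : ∀ i, a i ≠ 0) :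
    WeightData R (Fin r × (Fin n × Fin n)) (Matrix (Fin r → Fin n) (Fin r → Fin n) R) :=
  (F.weightData R n).power tensSingle commute_tensSingle a ha

theorem stateSum_powerData (F : ClassicalFamily) (a : Fin r → R)
    (ha : ∀ i, a i ≠ 0) {H : Type} [Fintype H] (D : Diagram H) :
    ∃ t : R, (F.powerData R n a ha).stateSum D = t • 1 := by
  refine eq_smul_one_of_commute _ ?_ ?_
  · intro j ε hε
    have hs : ∀ x : Fin n × Fin n, (ε x.1 * ε x.2) * (ε x.1 * ε x.2) = 1 := by
      intro x
      linear_combination hε x.1 * ε x.2 * ε x.2 + hε x.2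
    refine (F.weightData R n).commute_stateSum_power _ _ a ha _ (Equiv.refl _)
      (fun p => ε p.1 * ε p.2) hs (F.diagonal_mul_gen R ε hε) ?_ ?_ D j
    · intro x y
      cases F
      · by_cases h : y = x.swap
        · subst h
          simp only [weightData, casCoef, Equiv.refl_apply, if_true, Prod.fst_swap, Prod.snd_swap]
          linear_combination -hs x
        · simp [weightData, casCoef, h]
      · by_cases h : y = x
        · subst h
          simp [weightData, casCoef, hs]
        · simp [weightData, casCoef, h]
    · refine F.structCoef_symm R _ (Matrix.diagonal ε) ?_ (Equiv.refl _) _ hs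
        (F.diagonal_mul_gen R ε hε)
      rw [Matrix.diagonal_mul_diagonal, ← Matrix.diagonal_one]
      simp [hε]
  · intro j σ
    refine (F.weightData R n).commute_stateSum_power _ _ a ha _ (σ.prodCongr σ)
      (fun _ => 1) (by simp) (F.permMat_mul_gen R σ) ?_ ?_ D j
    · intro x y
      cases F
      · have : y.map σ σ = (x.map σ σ).swap ↔ y = x.swap := by
          simp [Prod.ext_iff]
        simp [weightData, casCoef, this]
      · have : y.map σ σ = x.map σ σ ↔ y = x := by
          simp [Prod.ext_iff]
        simp [weightData, casCoef, this]
    · refine F.structCoef_symm R _ (permMat R σ.symm) ?_ _ _ (by simp) (F.permMat_mul_gen R σ)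
      rw [permMat_mul]
      ext i j
      simp [permMat, Matrix.one_apply]

/-- The normalized trace. -/
noncomputable def normTrace (r n : ℕ) : Matrix (Fin r → Fin n) (Fin r → Fin n) R →ₗ[R] R :=
  ((n : R) ^ r)⁻¹ • Matrix.traceLinearMap (Fin r → Fin n) R R

omit [CharZero R] in
theorem normTrace_apply (x : Matrix (Fin r → Fin n) (Fin r → Fin n) R) :
    normTrace R r n x = ((n : R) ^ r)⁻¹ * x.trace := rfl

omit [CharZero R] in
theorem normTrace_mul_comm (x y : Matrix (Fin r → Fin n) (Fin r → Fin n) R) :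
    normTrace R r n (x * y) = normTrace R r n (y * x) := by
  rw [normTrace_apply, normTrace_apply, Matrix.trace_mul_comm]

theorem normTrace_one [NeZero n] : normTrace R r n 1 = 1 := by
  have hn : (n : R) ≠ 0 := Nat.cast_ne_zero.2 (NeZero.ne n)
  simp [normTrace_apply, Matrix.trace_one, hn]

/-- The weight system of the direct sum of `r` copies of `gl_n`, respectively `so_n`, normalized
so that it is multiplicative. -/
noncomputable def algWeight (F : ClassicalFamily) (n : ℕ) [NeZero n] (a : Fin r → R)
    (ha : ∀ i, a i ≠ 0) : DiagramAlgebra R →ₐ[R] R :=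
  AlgHom.ofLinearMap ((F.powerData R n a ha).linearWeight (normTrace R r n) (normTrace_mul_comm R))
    (by
      rw [DiagramAlgebra.one_def, WeightData.linearWeight_mk, WeightData.stateSum_circle,
        normTrace_one])
    (by
      set L := (F.powerData R n a ha).linearWeight (normTrace R r n) (normTrace_mul_comm R) with hL
      have key : (LinearMap.mul R (DiagramAlgebra R)).compr₂ L =
          (LinearMap.mul R R).compl₁₂ L L := by
        refine DiagramAlgebra.linearMap_ext R fun x => DiagramAlgebra.linearMap_ext R fun y => ?_
        obtain ⟨m, D, rfl⟩ := DiagramAlgebra.exists_toClass x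
        obtain ⟨k, E, rfl⟩ := DiagramAlgebra.exists_toClass y
        change L (DiagramAlgebra.mk R D * DiagramAlgebra.mk R E) =
          L (DiagramAlgebra.mk R D) * L (DiagramAlgebra.mk R E)
        rw [DiagramAlgebra.mk_mul_mk, hL, WeightData.linearWeight_mk, WeightData.linearWeight_mk,
          WeightData.linearWeight_mk, WeightData.stateSum_append]
        obtain ⟨s, hs⟩ := F.stateSum_powerData R a ha D
        obtain ⟨t, ht⟩ := F.stateSum_powerData R a ha E
        rw [hs, ht, smul_mul_smul_comm, one_mul, map_smul, map_smul, map_smul, normTrace_one]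
        simp
      exact fun x y => LinearMap.congr_fun (LinearMap.congr_fun key x) y)

theorem algWeight_mk (F : ClassicalFamily) (n : ℕ) [NeZero n] (a : Fin r → R)
    (ha : ∀ i, a i ≠ 0) {H : Type} [Fintype H] (D : Diagram H) :
    F.algWeight R n a ha (DiagramAlgebra.mk R D) =
      ((n : R) ^ r)⁻¹ * ((F.powerData R n a ha).stateSum D).trace :=
  WeightData.linearWeight_mk _ _ (normTrace_mul_comm R) D

end ClassicalFamily

namespace ClassicalFamily

/-! ## Evaluation of chords between closed strands -/

section localIdentities

variable (R : Type*) [Field R] {n : ℕ}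

/-- The coefficient of the reversing term in the resolution of a chord. -/
def twist : ClassicalFamily → R
  | gl => 0
  | so => 1

theorem trace_single_mul_mul_single_mul (i j k l : Fin n) (U V : Matrix (Fin n) (Fin n) R) :
    (Matrix.single i j 1 * U * Matrix.single k l 1 * V).trace = U j k * V l i := by
  rw [Matrix.trace, Finset.sum_eq_single i]
  · rw [Matrix.diag_apply, Matrix.mul_apply, Finset.sum_eq_single l]
    · simp [Matrix.single_mul_apply_same, Matrix.mul_single_apply_same]
    · intro b _ hb
      rw [Matrix.mul_single_apply_of_ne _ _ _ _ _ hb, zero_mul]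
    · simp
  · intro b _ hb
    rw [Matrix.diag_apply, mul_assoc, mul_assoc, Matrix.single_mul_apply_of_ne _ _ _ _ _ hb]
  · simp

theorem sum_trace_chord [CharZero R] (F : ClassicalFamily) (U V : Matrix (Fin n) (Fin n) R) :
    ∑ x, ∑ y, F.casCoef R x y * (F.gen R x * U * F.gen R y * V).trace =
      U.trace * V.trace - F.twist R * (U.transpose * V).trace := by
  have h1 : ∑ x : Fin n × Fin n, U x.2 x.2 * V x.1 x.1 = U.trace * V.trace := by
    rw [Fintype.sum_prod_type_right, Matrix.trace, Matrix.trace, Finset.sum_mul_sum]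
    rfl
  have h2 : ∑ x : Fin n × Fin n, U x.1 x.1 * V x.2 x.2 = U.trace * V.trace := by
    rw [Fintype.sum_prod_type, Matrix.trace, Matrix.trace, Finset.sum_mul_sum]
    rfl
  have h3 : ∑ x : Fin n × Fin n, U x.1 x.2 * V x.1 x.2 = (U.transpose * V).trace := by
    rw [Fintype.sum_prod_type_right, Matrix.trace]
    simp [Matrix.mul_apply]
  have h4 : ∑ x : Fin n × Fin n, U x.2 x.1 * V x.2 x.1 = (U.transpose * V).trace := by
    rw [Fintype.sum_prod_type, Matrix.trace]
    simp [Matrix.mul_apply]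
  cases F
  · rw [twist, zero_mul, sub_zero, ← h1]
    refine Fintype.sum_congr _ _ fun x => ?_
    rw [Finset.sum_eq_single x.swap]
    · simp only [casCoef, gen, if_true, one_mul, trace_single_mul_mul_single_mul, Prod.fst_swap,
        Prod.snd_swap]
    · intro y _ hy; simp [casCoef, hy]
    · simp
  · have : ∀ x : Fin n × Fin n, ∑ y, so.casCoef R x y * (so.gen R x * U * so.gen R y * V).trace =
        1 / 2 * (U x.2 x.2 * V x.1 x.1 + U x.1 x.1 * V x.2 x.2 - U x.1 x.2 * V x.1 x.2 -
          U x.2 x.1 * V x.2 x.1) := by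
      intro x
      rw [Finset.sum_eq_single x]
      · simp only [casCoef, gen, sub_mul, mul_sub, Matrix.trace_sub,
          trace_single_mul_mul_single_mul, if_true]
        ring
      · intro y _ hy; simp [casCoef, hy]
      · simp
    rw [Fintype.sum_congr _ _ this, ← Finset.mul_sum, Finset.sum_sub_distrib,
      Finset.sum_sub_distrib, Finset.sum_add_distrib, h1, h2, h3, h4, twist]
    ring

theorem sum_trace_mul_trace [CharZero R] (F : ClassicalFamily) (U V : Matrix (Fin n) (Fin n) R) :
    ∑ x, ∑ y, F.casCoef R x y * ((F.gen R x * U).trace * (F.gen R y * V).trace) =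
      (U * V).trace - F.twist R * (U.transpose * V).trace := by
  have h1 : ∑ x : Fin n × Fin n, U x.2 x.1 * V x.1 x.2 = (U * V).trace := by
    rw [Fintype.sum_prod_type_right, Matrix.trace]
    simp [Matrix.mul_apply]
  have h2 : ∑ x : Fin n × Fin n, U x.1 x.2 * V x.2 x.1 = (U * V).trace := by
    rw [Fintype.sum_prod_type, Matrix.trace]
    simp [Matrix.mul_apply]
  have h3 : ∑ x : Fin n × Fin n, U x.1 x.2 * V x.1 x.2 = (U.transpose * V).trace := by
    rw [Fintype.sum_prod_type_right, Matrix.trace]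
    simp [Matrix.mul_apply]
  have h4 : ∑ x : Fin n × Fin n, U x.2 x.1 * V x.2 x.1 = (U.transpose * V).trace := by
    rw [Fintype.sum_prod_type, Matrix.trace]
    simp [Matrix.mul_apply]
  cases F
  · rw [twist, zero_mul, sub_zero, ← h1]
    refine Fintype.sum_congr _ _ fun x => ?_
    rw [Finset.sum_eq_single x.swap]
    · simp [casCoef, gen, Matrix.trace_single_mul]
    · intro y _ hy; simp [casCoef, hy]
    · simp
  · have : ∀ x : Fin n × Fin n, ∑ y, so.casCoef R x y *
        ((so.gen R x * U).trace * (so.gen R y * V).trace) =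
        1 / 2 * (U x.2 x.1 * V x.1 x.2 + U x.1 x.2 * V x.2 x.1 - U x.1 x.2 * V x.1 x.2 -
          U x.2 x.1 * V x.2 x.1) := by
      intro x
      rw [Finset.sum_eq_single x]
      · simp only [casCoef, gen, sub_mul, Matrix.trace_sub, Matrix.trace_single_mul, if_true]
        simp only [smul_eq_mul, one_mul]
        ring
      · intro y _ hy; simp [casCoef, hy]
      · simp
    rw [Fintype.sum_congr _ _ this, ← Finset.mul_sum, Finset.sum_sub_distrib,
      Finset.sum_sub_distrib, Finset.sum_add_distrib, h1, h2, h3, h4, twist]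
    ring

end localIdentities

section words

variable (R : Type*) [Field R] {n : ℕ} {H : Type}

/-- The product of the generators along a strand. -/
def wordMat (F : ClassicalFamily) (c : H → Fin n × Fin n) (w : List H) : Matrix (Fin n) (Fin n) R :=
  (w.map fun h => F.gen R (c h)).prod

theorem wordMat_append (F : ClassicalFamily) (c : H → Fin n × Fin n) (u v : List H) :
    F.wordMat R c (u ++ v) = F.wordMat R c u * F.wordMat R c v := by
  simp [wordMat]

theorem wordMat_cons (F : ClassicalFamily) (c : H → Fin n × Fin n) (h : H) (v : List H) :
    F.wordMat R c (h :: v) = F.gen R (c h) * F.wordMat R c v := by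
  simp [wordMat]

theorem wordMat_congr (F : ClassicalFamily) {c c' : H → Fin n × Fin n} {w : List H}
    (h : ∀ x ∈ w, c x = c' x) : F.wordMat R c w = F.wordMat R c' w := by
  rw [wordMat, wordMat, List.map_congr_left fun x hx => by rw [h x hx]]

theorem twist_transpose_wordMat (F : ClassicalFamily) (c : H → Fin n × Fin n) (w : List H) :
    F.twist R • (F.wordMat R c w).transpose =
      (F.twist R * (-1) ^ w.length) • F.wordMat R c w.reverse := by
  cases F
  · simp [twist]
  · simp only [twist, one_mul, one_smul]
    induction w with
    | nil => simp [wordMat]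
    | cons h w ih =>
      rw [wordMat_cons, Matrix.transpose_mul, ih, gen_so_transpose, List.reverse_cons,
        wordMat_append, List.length_cons, pow_succ]
      simp [wordMat]

/-- The product of the traces along several closed strands. -/
def strandsVal {r : ℕ} (F : ClassicalFamily) (s : List (Fin r × List H)) (c : H → Fin n × Fin n) :
    R :=
  (s.map fun p => (F.wordMat R c p.2).trace).prod

theorem strandsVal_cons {r : ℕ} (F : ClassicalFamily) (p : Fin r × List H)
    (s : List (Fin r × List H)) (c : H → Fin n × Fin n) :
    F.strandsVal R (p :: s) c = (F.wordMat R c p.2).trace * F.strandsVal R s c := by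
  simp [strandsVal]

theorem strandsVal_congr {r : ℕ} (F : ClassicalFamily) {c c' : H → Fin n × Fin n}
    {s : List (Fin r × List H)} (h : ∀ x ∈ s.flatMap Prod.snd, c x = c' x) :
    F.strandsVal R s c = F.strandsVal R s c' := by
  rw [strandsVal, strandsVal, List.map_congr_left fun p hp => ?_]
  rw [wordMat_congr]
  exact fun x hx => h x (List.mem_flatMap.2 ⟨p, hp, hx⟩)

/-- The sum over all states of a collection of closed strands connected by the chords
`{h, edge h}` for `h` in `L`. -/
def strandsSum [Fintype H] [DecidableEq H] {r : ℕ} (F : ClassicalFamily) (n : ℕ) (edge : H → H)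
    (L : List H) (s : List (Fin r × List H)) : R :=
  ∑ c : H → Fin n × Fin n, (L.map fun h => F.casCoef R (c h) (c (edge h))).prod *
    F.strandsVal R s c

theorem sum_update {ι M : Type*} [Fintype ι] [AddCommMonoid M] [Fintype H] [DecidableEq H] (a : H)
    (G : (H → ι) → M) :
    ∑ c : H → ι, ∑ x, G (Function.update c a x) = Fintype.card ι • ∑ c : H → ι, G c := by
  have h1 : ∑ c : H → ι, ∑ x, G (Function.update c a x) =
      ∑ p : (H → ι) × ι, G (Function.update p.1 a p.2) := by rw [Fintype.sum_prod_type]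
  have h2 : ∑ p : (H → ι) × ι, G p.1 = Fintype.card ι • ∑ c : H → ι, G c := by
    rw [Fintype.sum_prod_type, Finset.smul_sum]
    simp
  rw [h1, ← h2]
  refine Fintype.sum_equiv ⟨fun p => (Function.update p.1 a p.2, p.1 a),
    fun p => (Function.update p.1 a p.2, p.1 a), ?_, ?_⟩ _ _ fun p => rfl
  · rintro ⟨c, x⟩; simp
  · rintro ⟨c, x⟩; simp

variable [Fintype H] [DecidableEq H] {r : ℕ}

/-- Summation over the states of the chord `{x, edge x}`. -/
theorem strandsSum_cons (F : ClassicalFamily) {edge : H → H} {x : H} {L : List H}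
    (s : List (Fin r × List H)) (hx : x ≠ edge x)
    (hL : ∀ h ∈ L, h ≠ x ∧ h ≠ edge x ∧ edge h ≠ x ∧ edge h ≠ edge x) :
    ((n : R) ^ 2) ^ 2 * F.strandsSum R n edge (x :: L) s =
      ∑ c : H → Fin n × Fin n, (L.map fun h => F.casCoef R (c h) (c (edge h))).prod *
        ∑ k, ∑ l, F.casCoef R k l *
          F.strandsVal R s (Function.update (Function.update c x k) (edge x) l) := by
  let G : (H → Fin n × Fin n) → R := fun c =>
    ((x :: L).map fun h => F.casCoef R (c h) (c (edge h))).prod * F.strandsVal R s c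
  have h1 := sum_update x (fun c => ∑ l, G (Function.update c (edge x) l))
  rw [sum_update (edge x) G] at h1
  have hc : Fintype.card (Fin n × Fin n) = n ^ 2 := by simp [sq]
  rw [hc, ← mul_smul, nsmul_eq_mul] at h1
  rw [strandsSum]
  push_cast at h1
  rw [sq ((n : R) ^ 2), ← h1]
  refine Fintype.sum_congr _ _ fun c => ?_
  rw [Finset.mul_sum]
  refine Fintype.sum_congr _ _ fun k => ?_
  rw [Finset.mul_sum]
  refine Fintype.sum_congr _ _ fun l => ?_
  simp only [G]
  rw [List.map_cons, List.prod_cons]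
  have : (L.map fun h => F.casCoef R (Function.update (Function.update c x k) (edge x) l h)
      (Function.update (Function.update c x k) (edge x) l (edge h))) =
      L.map fun h => F.casCoef R (c h) (c (edge h)) := by
    refine List.map_congr_left fun h hh => ?_
    obtain ⟨h1, h2, h3, h4⟩ := hL h hh
    simp [h1, h2, h3, h4]
  rw [this]
  simp [hx]
  ring

end words
end ClassicalFamily

/-! ## Planarity of closed strands with chords -/

/-- The chords with representatives in `L` connect the closed strands `s`, strands of every color
occur, and no chord connects strands of different colors. -/
structure IsStrands {H : Type} {r : ℕ} (edge : H → H) (φ : H → Fin r) (L : List H)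
    (s : List (Fin r × List H)) : Prop where
  letters : (s.flatMap Prod.snd).Perm (L ++ L.map edge)
  nodup : (L ++ L.map edge).Nodup
  color : ∀ p ∈ s, ∀ h ∈ p.2, φ h = p.1
  surj : ∀ i, ∃ p ∈ s, p.1 = i

/-- No two chords intersect and no chord connects different strands. -/
def IsPlanar {H : Type} {r : ℕ} (edge : H → H) (s : List (Fin r × List H)) : Prop :=
  ∀ p ∈ s, (∀ h ∈ p.2, edge h ∈ p.2) ∧ ¬ ∃ a b, [a, b, edge a, edge b].Sublist p.2

section
variable {H : Type} {r : ℕ} {edge : H → H} {φ : H → Fin r} {L : List H}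
  {s t : List (Fin r × List H)}

theorem IsStrands.perm (h : IsStrands edge φ L s) (p : s.Perm t) : IsStrands edge φ L t :=
  ⟨(p.flatMap_right _).symm.trans h.letters, h.nodup, fun q hq => h.color q (p.mem_iff.2 hq),
    fun i => (h.surj i).imp fun _ hq => ⟨p.mem_iff.1 hq.1, hq.2⟩⟩

theorem IsPlanar.perm_iff (p : s.Perm t) : IsPlanar edge s ↔ IsPlanar edge t := by
  simp only [IsPlanar, p.mem_iff]

theorem IsStrands.le_length (h : IsStrands edge φ L s) : r ≤ s.length := by
  classical
  have h1 : (Finset.univ : Finset (Fin r)) ⊆ (s.map Prod.fst).toFinset := by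
    intro i _
    obtain ⟨p, hp, rfl⟩ := h.surj i
    simp only [List.mem_toFinset, List.mem_map]
    exact ⟨p, hp, rfl⟩
  have h2 := (Finset.card_le_card h1).trans (List.toFinset_card_le _)
  simpa using h2

theorem quad_sublist_iff {pos : H → ℕ} {w : List H} (hw : w.Pairwise fun a b => pos a < pos b)
    (a b c d : H) : [a, b, c, d].Sublist w ↔
      (a ∈ w ∧ b ∈ w ∧ c ∈ w ∧ d ∈ w) ∧ pos a < pos b ∧ pos b < pos c ∧ pos c < pos d := by
  constructor
  · intro h
    have h1 := h.subset
    have h2 := hw.sublist h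
    simp at h1 h2
    tauto
  · rintro ⟨⟨ha, hb, hc, hd⟩, h1, h2, h3⟩
    have hp : [a, b, c, d].Pairwise fun a b => pos a < pos b := by
      simp; omega
    have hnd : [a, b, c, d].Nodup := hp.imp fun h e => by rw [e] at h; exact lt_irrefl _ h
    have hsub : List.Subperm [a, b, c, d] w := by
      refine List.subperm_of_subset hnd ?_
      intro x hx
      simp at hx
      rcases hx with rfl | rfl | rfl | rfl <;> assumption
    obtain ⟨l, hl, hls⟩ := hsub
    have : l = [a, b, c, d] := by
      refine List.Perm.eq_of_pairwise (le := fun a b => pos a < pos b) ?_ (hw.sublist hls) hp hl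
      intro x y _ _ h1 h2
      omega
    exact this ▸ hls

theorem isPlanar_split {i : Fin r} {p u v : List H} {x y : H} (he : ∀ h, edge (edge h) = h)
    (hxy : edge x = y) (hn : (p ++ x :: (u ++ y :: v)).Nodup) :
    IsPlanar edge ((i, p ++ x :: (u ++ y :: v)) :: s) ↔
      IsPlanar edge ((i, u) :: (i, p ++ v) :: s) := by
  classical
  have hyx : edge y = x := by rw [← hxy, he]
  simp only [IsPlanar, List.forall_mem_cons, ← and_assoc]
  refine and_congr_left fun _ => ?_
  set w := p ++ x :: (u ++ y :: v) with hw
  let pos : H → ℕ := fun h => w.idxOf h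
  have hpos : w.Pairwise fun a b => pos a < pos b := by
    rw [List.pairwise_iff_getElem]
    intro i j hi hj hij
    simpa [pos, hn.idxOf_getElem] using hij
  have hu : u.Sublist w := by
    rw [hw]
    exact ((List.sublist_append_left u _).cons x).trans (List.sublist_append_right p _)
  have hpv : (p ++ v).Sublist w := by
    rw [hw]
    exact List.Sublist.append (List.Sublist.refl p)
      (((List.sublist_cons_self y v).trans (List.sublist_append_right u _)).cons x)
  have hposu := hpos.sublist hu
  have hpospv := hpos.sublist hpv
  simp only [quad_sublist_iff hpos, quad_sublist_iff hposu, quad_sublist_iff hpospv]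
  have hpw := hpos
  rw [hw] at hpw
  simp only [List.pairwise_append, List.pairwise_cons, List.mem_append, List.mem_cons] at hpw
  obtain ⟨-, ⟨hx, -, ⟨hy, -⟩, huy⟩, hp⟩ := hpw
  have hmem : ∀ h, h ∈ w ↔ h ∈ p ∨ h = x ∨ h ∈ u ∨ h = y ∨ h ∈ v := by
    intro h; rw [hw]; simp
  have hinj : ∀ a b, edge a = edge b → a = b := fun a b h => by rw [← he a, h, he]
  have hxu : ∀ h ∈ u, pos x < pos h := fun h hh => hx h (Or.inl hh)
  have huy' : ∀ h ∈ u, pos h < pos y := fun h hh => huy h hh y (Or.inl rfl)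
  have hxy' : pos x < pos y := hx y (Or.inr (Or.inl rfl))
  have hpx : ∀ h ∈ p, pos h < pos x := fun h hh => hp h hh x (Or.inl rfl)
  have hyv : ∀ h ∈ v, pos y < pos h := hy
  have hmu : ∀ h, h ∈ u ↔ h ∈ w ∧ pos x < pos h ∧ pos h < pos y := by
    intro h
    rw [hmem]
    constructor
    · intro hh; exact ⟨by tauto, hxu h hh, huy' h hh⟩
    · rintro ⟨h1 | rfl | h1 | rfl | h1, h2, h3⟩
      · have := hpx h h1; omega
      · omega
      · exact h1
      · omega
      · have := hyv h h1; omega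
  have hmpv : ∀ h, h ∈ p ++ v ↔ h ∈ w ∧ (pos h < pos x ∨ pos y < pos h) := by
    intro h
    rw [hmem, List.mem_append]
    constructor
    · rintro (hh | hh)
      · exact ⟨by tauto, Or.inl (hpx h hh)⟩
      · exact ⟨by tauto, Or.inr (hyv h hh)⟩
    · rintro ⟨h1 | rfl | h1 | rfl | h1, h2⟩
      · exact Or.inl h1
      · omega
      · have := hxu h h1; have := huy' h h1; omega
      · omega
      · exact Or.inr h1
  have hxw : x ∈ w := by rw [hmem]; tauto
  have hyw : y ∈ w := by rw [hmem]; tauto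
  have hposinj : ∀ a b, a ∈ w → pos a = pos b → a = b := fun a b ha hab =>
    (List.idxOf_inj ha).1 hab
  clear_value pos w
  constructor
  · rintro ⟨h1, h2⟩
    have hcu : ∀ h ∈ u, edge h ∈ u := by
      intro h hh
      rw [hmu] at hh ⊢
      refine ⟨h1 h hh.1, ?_⟩
      have e1 : pos (edge h) ≠ pos x := fun e => by
        have h4 := hposinj _ _ (h1 h hh.1) e
        have h5 : h = y := by rw [← he h, h4, hxy]
        rw [h5] at hh; omega
      have e2 : pos (edge h) ≠ pos y := fun e => by
        have h4 := hposinj _ _ (h1 h hh.1) e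
        have h5 : h = x := by rw [← he h, h4, hyx]
        rw [h5] at hh; omega
      by_contra hcon
      refine h2 ?_
      by_cases h6 : pos (edge h) < pos x
      · refine ⟨edge h, x, ⟨h1 h hh.1, hxw, ?_, ?_⟩, ?_⟩
        · rw [he]; exact hh.1
        · rw [hxy]; exact hyw
        · rw [he, hxy]; omega
      · refine ⟨x, h, ⟨hxw, hh.1, ?_, h1 h hh.1⟩, ?_⟩
        · rw [hxy]; exact hyw
        · rw [hxy]; omega
    refine ⟨⟨⟨hcu, ?_⟩, ?_⟩, ?_⟩
    · rintro ⟨a, b, ⟨h3, h4, h5, h6⟩, h7⟩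
      exact h2 ⟨a, b, ⟨hu.subset h3, hu.subset h4, hu.subset h5, hu.subset h6⟩, h7⟩
    · intro h hh
      rw [hmpv] at hh ⊢
      refine ⟨h1 h hh.1, ?_⟩
      by_contra hcon
      have e1 : pos (edge h) ≠ pos x := fun e => by
        have h4 := hposinj _ _ (h1 h hh.1) e
        have h5 : h = y := by rw [← he h, h4, hxy]
        rw [h5] at hh; omega
      have e2 : pos (edge h) ≠ pos y := fun e => by
        have h4 := hposinj _ _ (h1 h hh.1) e
        have h5 : h = x := by rw [← he h, h4, hyx]
        rw [h5] at hh; omega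
      have := hcu (edge h) ((hmu _).2 ⟨h1 h hh.1, by omega⟩)
      rw [he, hmu] at this
      omega
    · rintro ⟨a, b, ⟨h3, h4, h5, h6⟩, h7⟩
      exact h2 ⟨a, b, ⟨hpv.subset h3, hpv.subset h4, hpv.subset h5, hpv.subset h6⟩, h7⟩
  · rintro ⟨⟨⟨h1, h2⟩, h3⟩, h4⟩
    have htri : ∀ h ∈ w, h = x ∨ h = y ∨ h ∈ u ∨ h ∈ p ++ v := by
      intro h hh
      rw [hmem] at hh
      rw [List.mem_append]
      tauto
    constructor
    · intro h hh
      rcases htri h hh with rfl | rfl | h5 | h5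
      · rw [hxy]; exact hyw
      · rw [hyx]; exact hxw
      · exact hu.subset (h1 h h5)
      · exact hpv.subset (h3 h h5)
    · rintro ⟨a, b, ⟨ha, hb, ha', hb'⟩, h7⟩
      rcases htri a ha with rfl | rfl | h5 | h5
      · rw [hxy] at h7
        have hbu : b ∈ u := (hmu b).2 ⟨hb, by omega⟩
        have := (hmu _).1 (h1 b hbu)
        omega
      · rw [hyx] at h7; omega
      · have h6 := (hmu _).1 (h1 a h5)
        have h5' := (hmu _).1 h5
        have hbu : b ∈ u := (hmu b).2 ⟨hb, by omega⟩
        exact h2 ⟨a, b, ⟨h5, hbu, h1 a h5, h1 b hbu⟩, h7⟩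
      · have h6 := (hmpv _).1 (h3 a h5)
        have h5' := (hmpv _).1 h5
        rcases htri b hb with rfl | rfl | h8 | h8
        · rw [hxy] at h7; omega
        · rw [hyx] at h7; omega
        · have := (hmu _).1 h8
          have := (hmu _).1 (h1 b h8)
          omega
        · exact h4 ⟨a, b, ⟨h5, h8, h3 a h5, h3 b h8⟩, h7⟩

end

section
variable {H : Type} {r : ℕ} {edge : H → H} {φ : H → Fin r} {L : List H}
  {s : List (Fin r × List H)} {i : Fin r} {x : H}

/-- Removing a chord, when the strands through its ends are replaced by strands `t` consisting of
the remaining points. -/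
theorem IsStrands.replace {t t' : List (Fin r × List H)} (h : IsStrands edge φ (x :: L) (t' ++ s))
    (hp : (t'.flatMap Prod.snd).Perm (x :: edge x :: t.flatMap Prod.snd))
    (ht' : ∀ p ∈ t', p.1 = i) (ht : ∀ p ∈ t, p.1 = i) (hne : t ≠ []) :
    IsStrands edge φ L (t ++ s) := by
  classical
  have hl := h.letters
  have hc : ∀ q ∈ t, ∀ h ∈ q.2, φ h = i := by
    intro q hq a ha
    have h1 : a ∈ t'.flatMap Prod.snd := by
      rw [hp.mem_iff]
      simp only [List.mem_cons, List.mem_flatMap]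
      exact Or.inr (Or.inr ⟨q, hq, ha⟩)
    obtain ⟨q', hq', ha'⟩ := List.mem_flatMap.1 h1
    rw [h.color q' (List.mem_append_left _ hq') a ha', ht' q' hq']
  refine ⟨?_, ?_, ?_, ?_⟩
  · rw [List.perm_iff_count] at hl hp ⊢
    intro a
    have h1 := hl a
    have h2 := hp a
    simp only [List.flatMap_append, List.count_append, List.map_cons, List.count_cons,
      List.cons_append] at h1 h2 ⊢
    omega
  · have := h.nodup
    simp only [List.map_cons, List.cons_append, List.nodup_cons] at this
    refine this.2.sublist ?_
    exact List.Sublist.append (List.Sublist.refl L) (List.sublist_cons_self _ _)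
  · intro q hq a ha
    rcases List.mem_append.1 hq with hq | hq
    · rw [hc q hq a ha, ht q hq]
    · exact h.color q (List.mem_append_right _ hq) a ha
  · intro j
    obtain ⟨q, hq, rfl⟩ := h.surj j
    rcases List.mem_append.1 hq with hq | hq
    · obtain ⟨q', hq'⟩ := List.exists_mem_of_ne_nil t hne
      exact ⟨q', List.mem_append_left _ hq', by rw [ht q' hq', ht' q hq]⟩
    · exact ⟨q, List.mem_append_right _ hq, rfl⟩

theorem IsStrands.nodup_letters (h : IsStrands edge φ L s) : (s.flatMap Prod.snd).Nodup :=
  h.letters.nodup_iff.2 h.nodup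

theorem IsStrands.ne_of_mem (h : IsStrands edge φ (x :: L) s) {a : H} (ha : a ∈ L) :
    a ≠ x ∧ a ≠ edge x ∧ edge a ≠ x ∧ edge a ≠ edge x := by
  have hn := h.nodup
  simp only [List.map_cons, List.cons_append, List.nodup_cons, List.mem_append, List.mem_cons,
    not_or, List.nodup_append] at hn
  obtain ⟨⟨h1, h2, h3⟩, -, ⟨h4, -⟩, h5⟩ := hn
  refine ⟨?_, ?_, ?_, ?_⟩
  · rintro rfl; exact h1 ha
  · exact h5 a ha _ (Or.inl rfl)
  · rintro h6; exact h3 (h6 ▸ List.mem_map_of_mem ha)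
  · rintro h6; exact h4 (h6 ▸ List.mem_map_of_mem ha)

theorem IsStrands.ne_edge (h : IsStrands edge φ (x :: L) s) : x ≠ edge x := by
  have hn := h.nodup
  simp only [List.map_cons, List.cons_append, List.nodup_cons, List.mem_append, List.mem_cons,
    not_or] at hn
  exact hn.1.2.1

end

namespace ClassicalFamily
section
variable (R : Type*) [Field R] {n : ℕ} {H : Type} {r : ℕ}
  {edge : H → H} {φ : H → Fin r} {L : List H}
  {s : List (Fin r × List H)} {i : Fin r} {x : H}

theorem strandsVal_perm (F : ClassicalFamily) {s t : List (Fin r × List H)} (h : s.Perm t)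
    (c : H → Fin n × Fin n) : F.strandsVal R s c = F.strandsVal R t c :=
  (h.map _).prod_eq

theorem strandsSum_perm [Fintype H] [DecidableEq H] (F : ClassicalFamily)
    {s t : List (Fin r × List H)} (h : s.Perm t) :
    F.strandsSum R n edge L s = F.strandsSum R n edge L t := by
  simp only [strandsSum, F.strandsVal_perm R h]

variable [CharZero R]

theorem casCoef_comm (F : ClassicalFamily) (p q : Fin n × Fin n) :
    F.casCoef R p q = F.casCoef R q p :=
  (F.weightData R n).w_symm p q

variable [Fintype H] [DecidableEq H]

theorem strandsSum_split (F : ClassicalFamily)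
    {p u v : List H} {y z : H} (hyz : y = x ∧ z = edge x ∨ y = edge x ∧ z = x)
    (h : IsStrands edge φ (x :: L) ((i, p ++ y :: (u ++ z :: v)) :: s)) :
    ((n : R) ^ 2) ^ 2 * F.strandsSum R n edge (x :: L) ((i, p ++ y :: (u ++ z :: v)) :: s) =
      F.strandsSum R n edge L ((i, u) :: (i, p ++ v) :: s) -
        F.twist R * (-1) ^ u.length * F.strandsSum R n edge L ((i, p ++ u.reverse ++ v) :: s) := by
  rw [strandsSum_cons R F _ h.ne_edge fun a ha => h.ne_of_mem ha]
  simp only [strandsSum]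
  rw [Finset.mul_sum, ← Finset.sum_sub_distrib]
  refine Fintype.sum_congr _ _ fun c => ?_
  rw [mul_left_comm, ← mul_sub]
  congr 1
  have hn := h.nodup_letters
  have hx : x ≠ edge x := h.ne_edge
  have hyz' : y ≠ z := by rcases hyz with ⟨rfl, rfl⟩ | ⟨rfl, rfl⟩ <;> [exact hx; exact hx.symm]
  have hmem : ∀ a, (a ∈ p ∨ a ∈ u ∨ a ∈ v ∨ a ∈ s.flatMap Prod.snd) → a ≠ y ∧ a ≠ z := by
    intro a ha
    simp only [List.flatMap_cons, List.append_assoc, List.cons_append, List.nodup_append,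
      List.nodup_cons, List.mem_append, List.mem_cons] at hn
    obtain ⟨-, ⟨h1, -, ⟨h2, -⟩, h3⟩, h4⟩ := hn
    constructor
    · rintro rfl
      rcases ha with ha | ha
      · exact h4 a ha a (Or.inl rfl) rfl
      · exact h1 (by tauto)
    · rintro rfl
      rcases ha with ha | ha | ha
      · exact h4 a ha a (Or.inr (Or.inr (Or.inl rfl))) rfl
      · exact h3 a ha a (Or.inl rfl) rfl
      · exact h2 ha
  have hmem' : ∀ a, (a ∈ p ∨ a ∈ u ∨ a ∈ v ∨ a ∈ s.flatMap Prod.snd) → a ≠ x ∧ a ≠ edge x := by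
    intro a ha
    have := hmem a ha
    rcases hyz with ⟨rfl, rfl⟩ | ⟨rfl, rfl⟩
    · exact this
    · exact this.symm
  have hval : ∀ k l, F.strandsVal R ((i, p ++ y :: (u ++ z :: v)) :: s)
      (Function.update (Function.update c x k) (edge x) l) =
      (F.gen R (Function.update (Function.update c x k) (edge x) l y) * F.wordMat R c u *
        F.gen R (Function.update (Function.update c x k) (edge x) l z) *
          (F.wordMat R c v * F.wordMat R c p)).trace * F.strandsVal R s c := by
    intro k l
    set c' := Function.update (Function.update c x k) (edge x) l with hc'
    have hcc : ∀ a, (a ∈ p ∨ a ∈ u ∨ a ∈ v ∨ a ∈ s.flatMap Prod.snd) → c' a = c a := by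
      intro a ha
      obtain ⟨h1, h2⟩ := hmem' a ha
      rw [hc', Function.update_of_ne h2, Function.update_of_ne h1]
    rw [strandsVal_cons, strandsVal_congr R F (c' := c) fun a ha => hcc a (by tauto)]
    simp only [wordMat_append, wordMat_cons]
    rw [wordMat_congr R F (c' := c) (w := p) fun a ha => hcc a (by tauto),
      wordMat_congr R F (c' := c) (w := u) fun a ha => hcc a (by tauto),
      wordMat_congr R F (c' := c) (w := v) fun a ha => hcc a (by tauto), Matrix.trace_mul_comm]
    simp only [mul_assoc]
  have hsum : ∑ k, ∑ l, F.casCoef R k l * F.strandsVal R ((i, p ++ y :: (u ++ z :: v)) :: s)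
      (Function.update (Function.update c x k) (edge x) l) =
      (∑ k, ∑ l, F.casCoef R k l * (F.gen R k * F.wordMat R c u * F.gen R l *
        (F.wordMat R c v * F.wordMat R c p)).trace) * F.strandsVal R s c := by
    simp only [hval, Finset.sum_mul]
    rcases hyz with ⟨rfl, rfl⟩ | ⟨rfl, rfl⟩
    · simp [hx, mul_assoc]
    · rw [Finset.sum_comm]
      refine Fintype.sum_congr _ _ fun k => Fintype.sum_congr _ _ fun l => ?_
      rw [F.casCoef_comm R l k]
      simp [hx, mul_assoc]
  rw [hsum, sum_trace_chord, ← smul_eq_mul (F.twist R), ← Matrix.trace_smul, ← smul_mul_assoc,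
    twist_transpose_wordMat]
  simp only [strandsVal_cons, wordMat_append, smul_mul_assoc, Matrix.trace_smul, smul_eq_mul]
  rw [Matrix.trace_mul_comm (F.wordMat R c v), ← mul_assoc, Matrix.trace_mul_cycle (F.wordMat R c p)]
  rw [Matrix.trace_mul_cycle (F.wordMat R c v)]
  ring

theorem strandsSum_merge (F : ClassicalFamily)
    {p u q v : List H} (h : IsStrands edge φ (x :: L) ((i, p ++ x :: u) :: (i, q ++ edge x :: v) :: s)) :
    ((n : R) ^ 2) ^ 2 * F.strandsSum R n edge (x :: L)
        ((i, p ++ x :: u) :: (i, q ++ edge x :: v) :: s) =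
      F.strandsSum R n edge L ((i, (u ++ p) ++ (v ++ q)) :: s) -
        F.twist R * (-1) ^ (u ++ p).length *
          F.strandsSum R n edge L ((i, (u ++ p).reverse ++ (v ++ q)) :: s) := by
  rw [strandsSum_cons R F _ h.ne_edge fun a ha => h.ne_of_mem ha]
  simp only [strandsSum]
  rw [Finset.mul_sum, ← Finset.sum_sub_distrib]
  refine Fintype.sum_congr _ _ fun c => ?_
  rw [mul_left_comm, ← mul_sub]
  congr 1
  have hn := h.nodup_letters
  have hx : x ≠ edge x := h.ne_edge
  have hmem : ∀ a, (a ∈ p ∨ a ∈ u ∨ a ∈ q ∨ a ∈ v ∨ a ∈ s.flatMap Prod.snd) →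
      a ≠ x ∧ a ≠ edge x := by
    intro a ha
    simp only [List.flatMap_cons, List.append_assoc, List.cons_append, List.nodup_append,
      List.nodup_cons, List.mem_append, List.mem_cons] at hn
    obtain ⟨-, ⟨h1, -, ⟨-, ⟨h2, -⟩, h3⟩, h5⟩, h4⟩ := hn
    constructor
    · rintro rfl
      rcases ha with ha | ha
      · exact h4 a ha a (Or.inl rfl) rfl
      · exact h1 (by tauto)
    · rintro rfl
      rcases ha with ha | ha | ha | ha
      · exact h4 _ ha _ (Or.inr (Or.inr (Or.inr (Or.inl rfl)))) rfl
      · exact h5 _ ha _ (Or.inr (Or.inl rfl)) rfl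
      · exact h3 _ ha _ (Or.inl rfl) rfl
      · exact h2 (by tauto)
  have hval : ∀ k l, F.strandsVal R ((i, p ++ x :: u) :: (i, q ++ edge x :: v) :: s)
      (Function.update (Function.update c x k) (edge x) l) =
      (F.gen R k * (F.wordMat R c (u ++ p))).trace * (F.gen R l * (F.wordMat R c (v ++ q))).trace *
        F.strandsVal R s c := by
    intro k l
    set c' := Function.update (Function.update c x k) (edge x) l with hc'
    have hcc : ∀ a, (a ∈ p ∨ a ∈ u ∨ a ∈ q ∨ a ∈ v ∨ a ∈ s.flatMap Prod.snd) → c' a = c a := by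
      intro a ha
      obtain ⟨h1, h2⟩ := hmem a ha
      rw [hc', Function.update_of_ne h2, Function.update_of_ne h1]
    have hcx : c' x = k := by rw [hc', Function.update_of_ne hx, Function.update_self]
    have hcy : c' (edge x) = l := by rw [hc', Function.update_self]
    rw [strandsVal_cons, strandsVal_cons, strandsVal_congr R F (c' := c) fun a ha => hcc a (by tauto)]
    simp only [wordMat_append, wordMat_cons, hcx, hcy]
    rw [wordMat_congr R F (c' := c) (w := p) fun a ha => hcc a (by tauto),
      wordMat_congr R F (c' := c) (w := u) fun a ha => hcc a (by tauto),
      wordMat_congr R F (c' := c) (w := v) fun a ha => hcc a (by tauto),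
      wordMat_congr R F (c' := c) (w := q) fun a ha => hcc a (by tauto),
      Matrix.trace_mul_comm (F.wordMat R c p), Matrix.trace_mul_comm (F.wordMat R c q)]
    simp only [mul_assoc]
  simp only [hval]
  simp only [← mul_assoc (F.casCoef R _ _), ← Finset.sum_mul]
  simp only [mul_assoc (F.casCoef R _ _)]
  rw [sum_trace_mul_trace, ← smul_eq_mul (F.twist R), ← Matrix.trace_smul, ← smul_mul_assoc,
    twist_transpose_wordMat]
  simp only [strandsVal_cons, smul_mul_assoc, Matrix.trace_smul, smul_eq_mul]
  rw [wordMat_append R F c (u ++ p), wordMat_append R F c (u ++ p).reverse]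
  ring

end
end ClassicalFamily

namespace ClassicalFamily
section
variable (R : Type*) [Field R] [CharZero R] {n : ℕ} {H : Type} {r : ℕ} [Fintype H] [DecidableEq H]
  {edge : H → H} {φ : H → Fin r} {L : List H}
  {s : List (Fin r × List H)} {i : Fin r} {x : H}

open Classical in
/-- The polynomial `q` computes the sum over all states of a collection of strands. -/
def IsStrandsPoly (F : ClassicalFamily) (edge : H → H) (L : List H) (s : List (Fin r × List H))
    (q : Polynomial R) : Prop :=
  (∀ n : ℕ, n ≠ 0 → ((n : R) ^ 2) ^ (2 * L.length) * F.strandsSum R n edge L s =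
    ((n : R) ^ 2) ^ Fintype.card H * ((n : R) ^ r * q.eval (n : R))) ∧
  ∀ m, m + r = L.length + s.length → q.natDegree ≤ m ∧
    q.coeff m = if IsPlanar edge s then 1 else 0

variable {R}

omit [CharZero R] in
theorem IsStrandsPoly.of_step {F : ClassicalFamily} {s t t' : List (Fin r × List H)}
    {q q' : Polynomial R} {e : R} (hq : F.IsStrandsPoly R edge L t q)
    (hq' : F.IsStrandsPoly R edge L t' q')
    (hs : ∀ n : ℕ, ((n : R) ^ 2) ^ 2 * F.strandsSum R n edge (x :: L) s =
      F.strandsSum R n edge L t - e * F.strandsSum R n edge L t')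
    (ht : r ≤ t.length) (ht' : r ≤ t'.length) (hl' : t'.length ≤ s.length)
    (hl : t.length = s.length + 1 ∧ (IsPlanar edge s ↔ IsPlanar edge t) ∨
      t.length ≤ s.length ∧ ¬ IsPlanar edge s) :
    F.IsStrandsPoly R edge (x :: L) s (q - Polynomial.C e * q') := by
  classical
  constructor
  · intro n hn
    have h1 := hq.1 n hn
    have h2 := hq'.1 n hn
    rw [List.length_cons, mul_add, pow_add, mul_one, mul_assoc, hs, mul_sub, mul_left_comm _ e, h1, h2,
      Polynomial.eval_sub, Polynomial.eval_C_mul]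
    ring
  · intro m hm
    rw [List.length_cons] at hm
    have h2 := hq'.2 (L.length + t'.length - r) (by omega)
    have h3 : (Polynomial.C e * q').natDegree < m :=
      (Polynomial.natDegree_C_mul_le _ _).trans_lt (by omega)
    rw [Polynomial.coeff_sub, Polynomial.coeff_eq_zero_of_natDegree_lt h3, sub_zero]
    rcases hl with ⟨hl, hP⟩ | ⟨hl, hP⟩
    · have h1 := hq.2 m (by omega)
      refine ⟨(Polynomial.natDegree_sub_le _ _).trans (max_le h1.1 h3.le), ?_⟩
      simp only [h1.2, hP]
    · have h1 := hq.2 (L.length + t.length - r) (by omega)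
      have h4 : q.natDegree < m := h1.1.trans_lt (by omega)
      refine ⟨(Polynomial.natDegree_sub_le _ _).trans (max_le h4.le h3.le), ?_⟩
      rw [Polynomial.coeff_eq_zero_of_natDegree_lt h4, if_neg hP]

omit [CharZero R] in
theorem IsStrandsPoly.perm {F : ClassicalFamily} {s t : List (Fin r × List H)}
    {q : Polynomial R} (hq : F.IsStrandsPoly R edge L t q) (p : s.Perm t) :
    F.IsStrandsPoly R edge L s q := by
  classical
  refine ⟨fun n hn => by rw [strandsSum_perm R F p]; exact hq.1 n hn, fun m hm => ?_⟩
  rw [p.length_eq] at hm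
  have := hq.2 m hm
  simpa only [IsPlanar.perm_iff p] using this

/-- The sum over all states of a collection of strands is polynomial in `n`. -/
theorem exists_isStrandsPoly (F : ClassicalFamily) (he : ∀ h, edge (edge h) = h)
    (hφ : ∀ h, φ (edge h) = φ h) (L : List H) (s : List (Fin r × List H)) (h : IsStrands edge φ L s) :
    ∃ q, F.IsStrandsPoly R edge L s q := by
  classical
  induction L generalizing s with
  | nil =>
    refine ⟨Polynomial.X ^ (s.length - r), fun n hn => ?_, fun m hm => ?_⟩
    · have hs : ∀ p ∈ s, p.2 = [] := by
        have := h.letters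
        simp only [List.map_nil, List.append_nil, List.perm_nil, List.flatMap_eq_nil_iff] at this
        exact this
      have hv : ∀ c : H → Fin n × Fin n, F.strandsVal R s c = (n : R) ^ s.length := by
        intro c
        rw [strandsVal, List.map_congr_left (g := fun _ => (n : R))]
        · simp
        · intro p hp
          rw [hs p hp]
          simp [wordMat, Matrix.trace_one]
      have h1 : (n : R) ^ s.length = (n : R) ^ r * (n : R) ^ (s.length - r) := by
        rw [← pow_add, Nat.add_sub_cancel' h.le_length]
      simp [strandsSum, hv, h1, sq]
    · have hm' : m = s.length - r := by simp at hm; omega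
      have hP : IsPlanar edge s := by
        intro p hp
        have := h.letters
        simp only [List.map_nil, List.append_nil, List.perm_nil, List.flatMap_eq_nil_iff] at this
        simp [this p hp]
      simp [hm', hP]
  | cons x L ih =>
    have hxs : x ∈ s.flatMap Prod.snd := by rw [h.letters.mem_iff]; simp
    have hys : edge x ∈ s.flatMap Prod.snd := by rw [h.letters.mem_iff]; simp
    obtain ⟨⟨i, w⟩, hp, hxw⟩ := List.mem_flatMap.1 hxs
    obtain ⟨s1, s2, rfl⟩ := List.append_of_mem hp
    have hperm : (s1 ++ (i, w) :: s2).Perm ((i, w) :: (s1 ++ s2)) := List.perm_middle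
    replace h := h.perm hperm
    generalize s1 ++ s2 = s' at h hperm
    suffices ∃ q, F.IsStrandsPoly R edge (x :: L) ((i, w) :: s') q from
      this.imp fun q hq => hq.perm hperm
    have hys : edge x ∈ ((i, w) :: s').flatMap Prod.snd := by rw [h.letters.mem_iff]; simp
    clear hperm hp hxs
    have hx := h.ne_edge
    have hn := h.nodup_letters
    by_cases hyw : edge x ∈ w
    · have : ∃ y z p u v, (y = x ∧ z = edge x ∨ y = edge x ∧ z = x) ∧
          w = p ++ y :: (u ++ z :: v) := by
        obtain ⟨w1, w2, rfl⟩ := List.append_of_mem hxw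
        rcases List.mem_append.1 hyw with h1 | h1
        · obtain ⟨p, u, rfl⟩ := List.append_of_mem h1
          exact ⟨edge x, x, p, u, w2, Or.inr ⟨rfl, rfl⟩, by simp⟩
        · obtain ⟨u, v, rfl⟩ := List.append_of_mem ((List.mem_cons.1 h1).resolve_left hx.symm)
          exact ⟨x, edge x, w1, u, v, Or.inl ⟨rfl, rfl⟩, rfl⟩
      obtain ⟨y, z, p, u, v, hyz, rfl⟩ := this
      have hcount : ∀ l : List H, (y :: z :: l).Perm (x :: edge x :: l) := by
        intro l
        rcases hyz with ⟨rfl, rfl⟩ | ⟨rfl, rfl⟩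
        · exact List.Perm.refl _
        · exact List.Perm.swap _ _ _
      have h1 : IsStrands edge φ L ([(i, u), (i, p ++ v)] ++ s') := by
        refine IsStrands.replace (t' := [(i, p ++ y :: (u ++ z :: v))]) (i := i) h ?_ (by simp)
          (by simp) (by simp)
        refine List.Perm.trans ?_ (hcount _)
        rw [List.perm_iff_count]
        intro a
        simp [List.count_append, List.count_cons]
        omega
      have h2 : IsStrands edge φ L ([(i, p ++ u.reverse ++ v)] ++ s') := by
        refine IsStrands.replace (t' := [(i, p ++ y :: (u ++ z :: v))]) (i := i) h ?_ (by simp)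
          (by simp) (by simp)
        refine List.Perm.trans ?_ (hcount _)
        rw [List.perm_iff_count]
        intro a
        simp [List.count_append, List.count_cons]
        omega
      obtain ⟨q, hq⟩ := ih _ h1
      obtain ⟨q', hq'⟩ := ih _ h2
      refine ⟨_, hq.of_step hq' (fun n => F.strandsSum_split R hyz h) h1.le_length h2.le_length
        (by simp) (Or.inl ⟨by simp, ?_⟩)⟩
      refine isPlanar_split he ?_ ?_
      · rcases hyz with ⟨rfl, rfl⟩ | ⟨rfl, rfl⟩
        · rfl
        · exact he _
      · rw [List.flatMap_cons, List.nodup_append] at hn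
        exact hn.1
    · have hys' : edge x ∈ s'.flatMap Prod.snd := by
        rw [List.flatMap_cons, List.mem_append] at hys
        exact hys.resolve_left hyw
      obtain ⟨⟨j, w'⟩, hp', hyw'⟩ := List.mem_flatMap.1 hys'
      obtain ⟨s1, s2, rfl⟩ := List.append_of_mem hp'
      have hij : j = i := by
        have h1 := h.color (j, w') (by simp) _ hyw'
        rw [hφ, h.color (i, w) (by simp) _ hxw] at h1
        exact h1.symm
      subst hij
      have hperm : ((j, w) :: (s1 ++ (j, w') :: s2)).Perm ((j, w) :: (j, w') :: (s1 ++ s2)) :=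
        List.perm_middle.cons _
      replace h := h.perm hperm
      generalize s1 ++ s2 = s' at h hperm
      suffices ∃ q, F.IsStrandsPoly R edge (x :: L) ((j, w) :: (j, w') :: s') q from
        this.imp fun q hq => hq.perm hperm
      obtain ⟨p, u, rfl⟩ := List.append_of_mem hxw
      obtain ⟨p', v, rfl⟩ := List.append_of_mem hyw'
      have h1 : IsStrands edge φ L ([(j, (u ++ p) ++ (v ++ p'))] ++ s') := by
        refine IsStrands.replace (t' := [(j, p ++ x :: u), (j, p' ++ edge x :: v)]) (i := j) h ?_
          (by simp) (by simp) (by simp)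
        rw [List.perm_iff_count]
        intro a
        simp [List.count_append, List.count_cons]
        omega
      have h2 : IsStrands edge φ L ([(j, (u ++ p).reverse ++ (v ++ p'))] ++ s') := by
        refine IsStrands.replace (t' := [(j, p ++ x :: u), (j, p' ++ edge x :: v)]) (i := j) h ?_
          (by simp) (by simp) (by simp)
        rw [List.perm_iff_count]
        intro a
        simp [List.count_append, List.count_cons]
        omega
      obtain ⟨q, hq⟩ := ih _ h1
      obtain ⟨q', hq'⟩ := ih _ h2
      refine ⟨_, hq.of_step hq' (fun n => F.strandsSum_merge R h) h1.le_length h2.le_length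
        (by simp) (Or.inr ⟨by simp, fun hP => hyw ?_⟩)⟩
      exact (hP (j, p ++ x :: u) (by simp)).1 x hxw

end
end ClassicalFamily

namespace Diagram

variable {H : Type} [Fintype H] {r : ℕ}

theorem perm_reps (D : Diagram H) {l : List H} (hl : l.Nodup) (hl' : ∀ h, h ∈ l) :
    l.Perm ((reps D.edge).toList ++ (reps D.edge).toList.map D.edge) ∧
      ((reps D.edge).toList ++ (reps D.edge).toList.map D.edge).Nodup := by
  have hS := isReps_reps D.smallOrbits_edge
  have hn : ((reps D.edge).toList ++ (reps D.edge).toList.map D.edge).Nodup := by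
    refine (Finset.nodup_toList _).append ((Finset.nodup_toList _).map
      D.smallOrbits_edge.injective) ?_
    intro h h1 h2
    obtain ⟨k, hk, rfl⟩ := List.mem_map.1 h2
    rw [Finset.mem_toList] at h1 hk
    exact D.edge_ne k ((hS.2 k (D.edge_ne k)).unique ⟨h1, Or.inr (Or.inl rfl)⟩ ⟨hk, Or.inl rfl⟩)
  refine ⟨(List.perm_ext_iff_of_nodup hl hn).2 fun h => ?_, hn⟩
  simp only [hl', true_iff, List.mem_append, List.mem_map, Finset.mem_toList]
  obtain ⟨s, ⟨hs, hs'⟩, -⟩ := hS.2 h (D.edge_ne h)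
  rcases hs' with rfl | rfl | rfl
  · exact Or.inl hs
  · exact Or.inr ⟨_, hs, D.edge_edge h⟩
  · rw [D.edge_edge] at hs
    exact Or.inl hs

/-- The strands of the different colors of a colored chord diagram. -/
def strands (D : Diagram H) (φ : H → Fin r) : List (Fin r × List H) :=
  List.ofFn fun i => (i, D.legs.filter fun h => φ h = i)

omit [Fintype H] in
theorem mem_strands {D : Diagram H} {φ : H → Fin r} {p : Fin r × List H} :
    p ∈ D.strands φ ↔ p.2 = D.legs.filter fun h => φ h = p.1 := by
  rw [strands, List.mem_ofFn]
  constructor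
  · rintro ⟨i, rfl⟩; rfl
  · intro h; exact ⟨p.1, Prod.ext rfl h.symm⟩

omit [Fintype H] in
theorem mk_mem_strands (D : Diagram H) (φ : H → Fin r) (i : Fin r) :
    (i, D.legs.filter fun h => φ h = i) ∈ D.strands φ :=
  mem_strands.2 rfl

theorem isStrands (D : Diagram H) (hD : ∀ h, D.vert h = h) (φ : H → Fin r) :
    IsStrands D.edge φ (reps D.edge).toList (D.strands φ) := by
  classical
  have hmem : ∀ h, h ∈ D.legs := fun h => (D.mem_legs h).2 (hD h)
  have hn : ((D.strands φ).flatMap Prod.snd).Nodup := by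
    rw [List.nodup_flatMap]
    refine ⟨fun p hp => ?_, ?_⟩
    · rw [mem_strands.1 hp]; exact D.nodup.filter _
    · rw [strands, List.ofFn_eq_map, List.pairwise_map]
      refine (List.nodup_finRange r).imp fun {i j} hij x hx hy => hij ?_
      simp only [List.mem_filter, decide_eq_true_eq] at hx hy
      rw [← hx.2, hy.2]
  have hm : ∀ h, h ∈ (D.strands φ).flatMap Prod.snd := fun h => by
    rw [List.mem_flatMap]
    exact ⟨_, D.mk_mem_strands φ (φ h), by simp [hmem]⟩
  obtain ⟨h1, h2⟩ := D.perm_reps hn hm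
  refine ⟨h1, h2, fun p hp h hh => ?_, fun i => ⟨_, D.mk_mem_strands φ i, rfl⟩⟩
  rw [mem_strands.1 hp] at hh
  simpa using (List.mem_filter.1 hh).2

theorem card_eq (D : Diagram H) : Fintype.card H = 2 * (reps D.edge).card := by
  have h1 := (D.perm_reps (l := Finset.univ.toList) (Finset.nodup_toList _) (by simp)).1.length_eq
  simp at h1
  omega

omit [Fintype H] in
theorem sigma_legs_map {D : Diagram H} (φ : D.Coloring r) (i : Fin r) :
    (D.sub φ i).legs.map Subtype.val = D.legs.filter fun h => φ.1 h = i := by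
  simp [sub]

omit [Fintype H] in
theorem isPlanar_strands_iff (D : Diagram H) (hD : ∀ h, D.vert h = h) (φ : D.Coloring r) :
    IsPlanar D.edge (D.strands φ.1) ↔ ¬ ∃ a b : Σ i, {h : H // φ.1 h = i},
      [a, b, (sigma fun i => D.sub φ i).edge a, (sigma fun i => D.sub φ i).edge b].Sublist
        (sigma fun i => D.sub φ i).legs := by
  classical
  have hmem : ∀ h, h ∈ D.legs := fun h => (D.mem_legs h).2 (hD h)
  constructor
  · rintro hP ⟨a, b, hab⟩
    have hpw : (sigma fun i => D.sub φ i).legs.Pairwise fun x y => x.1 ≤ y.1 := by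
      simp only [sigma, List.pairwise_flatMap, List.pairwise_map]
      refine ⟨fun i _ => List.pairwise_of_forall fun _ _ => le_refl i, ?_⟩
      refine (List.pairwise_le_finRange r).imp fun {i j} hij x hx y hy => ?_
      obtain ⟨x, -, rfl⟩ := List.mem_map.1 hx
      obtain ⟨y, -, rfl⟩ := List.mem_map.1 hy
      exact hij
    have h1 := hpw.sublist hab
    obtain ⟨i, a⟩ := a
    obtain ⟨j, b⟩ := b
    have hij : i = j := by
      rw [List.pairwise_cons, List.pairwise_cons] at h1
      exact le_antisymm (h1.1 ⟨j, b⟩ (by simp))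
        (h1.2.1 ((sigma fun i => D.sub φ i).edge ⟨i, a⟩) (by simp))
    subst hij
    refine (hP _ (D.mk_mem_strands φ.1 i)).2 ⟨a, b, ?_⟩
    have h2 := (hab.filter fun x => x.1 = i).map fun x => x.2.1
    have h3 : ((sigma fun i => D.sub φ i).legs.filter fun x => x.1 = i).map (fun x => x.2.1) =
        D.legs.filter fun h => φ.1 h = i := by
      rw [← sigma_legs_map φ i]
      simp only [sigma, List.filter_flatMap, List.map_flatMap, List.filter_map, List.map_map]
      have h4 : ∀ j, ((D.sub φ j).legs.filter ((fun x : Σ i, {h : H // φ.1 h = i} =>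
          decide (x.1 = i)) ∘ Sigma.mk j)) = if j = i then (D.sub φ j).legs else [] := by
        intro j
        by_cases h : j = i <;> simp [h, Function.comp_def]
      simp only [h4]
      have h5 : ∀ l : List (Fin r), l.Nodup → i ∈ l → l.flatMap (fun j =>
          (if j = i then (D.sub φ j).legs else []).map
            ((fun x : Σ i, {h : H // φ.1 h = i} => x.2.1) ∘ Sigma.mk j)) =
            (D.sub φ i).legs.map Subtype.val := by
        intro l
        induction l with
        | nil => simp
        | cons k l ih =>
          intro hl hi
          rw [List.flatMap_cons]
          rw [List.nodup_cons] at hl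
          by_cases hk : k = i
          · subst hk
            rw [if_pos rfl, List.flatMap_eq_nil_iff.2, List.append_nil]
            · rfl
            · intro x hx
              have : x ≠ k := by rintro rfl; exact hl.1 hx
              simp [this]
          · simp only [if_neg hk, List.map_nil, List.nil_append]
            exact ih hl.2 ((List.mem_cons.1 hi).resolve_left (Ne.symm hk))
      exact h5 _ (List.nodup_finRange r) (List.mem_finRange i)
    rw [h3] at h2
    simpa [sigma, sub] using h2
  · intro h
    rintro ⟨i, w⟩ hp
    obtain rfl : w = D.legs.filter fun h => φ.1 h = i := mem_strands.1 hp
    refine ⟨fun x hx => ?_, ?_⟩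
    · simp only [List.mem_filter, hmem, true_and, decide_eq_true_eq] at hx ⊢
      rw [(φ.2 x).1, hx]
    · rintro ⟨a, b, hab⟩
      have ha := hab.subset (show a ∈ _ by simp)
      have hb := hab.subset (show b ∈ _ by simp)
      simp only [List.mem_filter, hmem, true_and, decide_eq_true_eq] at ha hb
      refine h ⟨⟨i, a, ha⟩, ⟨i, b, hb⟩, ?_⟩
      have h1 : [(⟨a, ha⟩ : {h // φ.1 h = i}), ⟨b, hb⟩, (D.sub φ i).edge ⟨a, ha⟩,
          (D.sub φ i).edge ⟨b, hb⟩].Sublist (D.sub φ i).legs := by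
        rw [← sigma_legs_map φ i] at hab
        obtain ⟨l, hl, hl'⟩ := List.sublist_map_iff.1 hab
        have : l = [(⟨a, ha⟩ : {h // φ.1 h = i}), ⟨b, hb⟩, (D.sub φ i).edge ⟨a, ha⟩,
            (D.sub φ i).edge ⟨b, hb⟩] := by
          apply Subtype.val_injective.list_map
          rw [← hl']
          rfl
        exact this ▸ hl
      have h2 := List.Sublist.map (Sigma.mk (β := fun i => {h // φ.1 h = i}) i) h1
      refine h2.trans ?_
      exact List.sublist_flatten_of_mem (List.mem_map.2 ⟨i, List.mem_finRange i, rfl⟩)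

open Classical in
theorem W_sigma (R : Type*) [CommRing R] (D : Diagram H) (hD : ∀ h, D.vert h = h)
    (φ : D.Coloring r) :
    W R (sigma fun i => D.sub φ i) = if IsPlanar D.edge (D.strands φ.1) then 1 else 0 := by
  rw [W, isPlanar_strands_iff D hD φ]
  by_cases h : ∃ a b : Σ i, {h : H // φ.1 h = i},
      [a, b, (sigma fun i => D.sub φ i).edge a, (sigma fun i => D.sub φ i).edge b].Sublist
        (sigma fun i => D.sub φ i).legs
  · rw [if_pos h, if_neg (not_not.2 h)]
  · rw [if_neg h, if_pos h]

open Classical in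
theorem degree_sub (D : Diagram H) (hD : ∀ h, D.vert h = h) (φ : D.Coloring r) (i : Fin r) :
    (D.sub φ i).degree = ((reps D.edge).filter fun h => φ.1 h = i).card := by
  have h1 : (D.sub φ i).legs.length = Fintype.card {h : H // φ.1 h = i} := by
    rw [← List.toFinset_card_of_nodup (D.sub φ i).nodup, ← Finset.card_univ]
    congr 1
    ext h
    simpa [sub] using ⟨(D.mem_legs _).2 (hD _), h.2⟩
  have h2 : Fintype.card {h : H // φ.1 h = i} =
      2 * ((reps D.edge).filter fun h => φ.1 h = i).card := by
    have := D.sum_edge_reps (isReps_reps D.smallOrbits_edge) fun h => if φ.1 h = i then 1 else 0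
    simp only [(φ.2 _).1] at this
    rw [Fintype.card_subtype, Finset.card_filter, ← this, Finset.card_filter, Finset.mul_sum]
    refine Finset.sum_congr rfl fun h _ => ?_
    split_ifs <;> rfl
  rw [degree, h1]
  convert_to (2 * ((reps D.edge).filter fun h => φ.1 h = i).card + (_ - _) / 3) / 2 = _
  · rw [h2]
  · omega

open Classical in
theorem Wx_eq (R : Type*) [CommRing R] (D : Diagram H) (hD : ∀ h, D.vert h = h) :
    D.Wx R r = ∑ φ : D.Coloring r, (∏ h ∈ reps D.edge, MvPolynomial.X (φ.1 h)) *
      MvPolynomial.C (if IsPlanar D.edge (D.strands φ.1) then 1 else 0) := by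
  rw [Wx]
  refine Fintype.sum_congr _ _ fun φ => ?_
  rw [W_sigma R D hD φ, ← Finset.prod_fiberwise (reps D.edge) φ.1]
  congr 1
  refine Fintype.prod_congr _ _ fun i => ?_
  rw [degree_sub D hD φ i, Finset.prod_congr rfl (g := fun _ => MvPolynomial.X i)]
  · simp
  · intro h hh
    rw [(Finset.mem_filter.1 hh).2]

end Diagram

theorem tens_list_prod {R : Type*} [CommRing R] {r n : ℕ} {H : Type} (φ : H → Fin r)
    (m : H → Matrix (Fin n) (Fin n) R) (l : List H) :
    (l.map fun h => tensSingle (φ h) (m h)).prod =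
      tens fun i => ((l.filter fun h => φ h = i).map m).prod := by
  induction l with
  | nil => exact tens_one.symm
  | cons h l ih =>
    rw [List.map_cons, List.prod_cons, ih, tensSingle_apply, ← tens_mul]
    congr 1
    funext i
    by_cases hi : φ h = i
    · subst hi; simp
    · simp [hi]

namespace ClassicalFamily

variable (R : Type*) [Field R] {r : ℕ} {H : Type} [Fintype H]

/-- The coefficients of `(a_1 ω, …, a_r ω)` with respect to the generators. -/
def powCoef (F : ClassicalFamily) (n : ℕ) (a : Fin r → R) (p q : Fin r × (Fin n × Fin n)) : R :=
  if p.1 = q.1 then a p.1 * F.casCoef R p.2 q.2 else 0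

open Classical in
/-- The weight system of the direct sum of `r` copies of `gl_n`, respectively `so_n`, on chord
diagrams. -/
noncomputable def chordSum (F : ClassicalFamily) (n : ℕ) (a : Fin r → R) (D : Diagram H) : R :=
  ∑ c : H → Fin r × (Fin n × Fin n), (∏ h ∈ reps D.edge, F.powCoef R n a (c h) (c (D.edge h))) *
    ((D.legs.map fun h => tensSingle (c h).1 (F.gen R (c h).2)).prod).trace

theorem trace_stateSum_powerData [CharZero R] (F : ClassicalFamily) (n : ℕ) (a : Fin r → R)
    (ha : ∀ i, a i ≠ 0) (D : Diagram H) (hD : ∀ h, D.vert h = h) :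
    ((F.powerData R n a ha).stateSum D).trace = F.chordSum R n a D := by
  classical
  have hr : reps D.vert = ∅ := by
    rw [Finset.eq_empty_iff_forall_notMem]
    intro h hh
    exact (isReps_reps D.smallOrbits_vert).1 h hh (hD h)
  rw [WeightData.stateSum_def, chordSum, Matrix.trace_sum]
  refine Finset.sum_congr (by congr!) fun c _ => ?_
  rw [Matrix.trace_smul, WeightData.coef, hr, Finset.prod_empty, mul_one, smul_eq_mul]
  rfl

open Classical in
theorem chordSum_eq (F : ClassicalFamily) (n : ℕ) (a : Fin r → R) (D : Diagram H)
    (hD : ∀ h, D.vert h = h) :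
    F.chordSum R n a D = ∑ φ : D.Coloring r, (∏ h ∈ reps D.edge, a (φ.1 h)) *
      F.strandsSum R n D.edge (reps D.edge).toList (D.strands φ.1) := by
  rw [chordSum, ← (Equiv.arrowProdEquivProdArrow H (fun _ => Fin r)
    (fun _ => Fin n × Fin n)).symm.sum_comp, Fintype.sum_prod_type]
  symm
  refine Fintype.sum_of_injective Subtype.val Subtype.val_injective _ _ ?_ ?_
  · intro φ hφ
    refine Finset.sum_eq_zero fun c _ => ?_
    have : ∃ h ∈ reps D.edge, φ h ≠ φ (D.edge h) := by
      by_contra! hcon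
      refine hφ ⟨⟨φ, fun h => ⟨?_, by rw [hD]⟩⟩, rfl⟩
      obtain ⟨s, ⟨hs, hs'⟩, -⟩ := (isReps_reps D.smallOrbits_edge).2 h (D.edge_ne h)
      have := hcon s hs
      rcases hs' with rfl | rfl | rfl
      · exact this.symm
      · rw [D.edge_edge] at this; exact this
      · rw [D.edge_edge] at this; exact this.symm
    obtain ⟨h, hh, hne⟩ := this
    rw [Finset.prod_eq_zero hh, zero_mul]
    simp [powCoef, Equiv.arrowProdEquivProdArrow, hne]
  · intro φ
    rw [strandsSum, Finset.mul_sum]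
    refine Fintype.sum_congr _ _ fun c => ?_
    have h1 : ∏ h ∈ reps D.edge, F.powCoef R n a
        ((Equiv.arrowProdEquivProdArrow H (fun _ => Fin r) (fun _ => Fin n × Fin n)).symm
          (φ.1, c) h) ((Equiv.arrowProdEquivProdArrow H (fun _ => Fin r)
            (fun _ => Fin n × Fin n)).symm (φ.1, c) (D.edge h)) =
        (∏ h ∈ reps D.edge, a (φ.1 h)) *
          ((reps D.edge).toList.map fun h => F.casCoef R (c h) (c (D.edge h))).prod := by
      rw [Finset.prod_map_toList, ← Finset.prod_mul_distrib]
      refine Finset.prod_congr rfl fun h _ => ?_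
      simp [powCoef, Equiv.arrowProdEquivProdArrow, (φ.2 h).1]
    rw [h1]
    have h2 : ((D.legs.map fun h => tensSingle
        ((Equiv.arrowProdEquivProdArrow H (fun _ => Fin r) (fun _ => Fin n × Fin n)).symm
          (φ.1, c) h).1 (F.gen R ((Equiv.arrowProdEquivProdArrow H (fun _ => Fin r)
            (fun _ => Fin n × Fin n)).symm (φ.1, c) h).2)).prod).trace =
        F.strandsVal R (D.strands φ.1) c := by
      have := tens_list_prod φ.1 (fun h => F.gen R (c h)) D.legs
      simp only [Equiv.arrowProdEquivProdArrow, Equiv.coe_fn_symm_mk]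
      rw [this, trace_tens, strandsVal, Diagram.strands, List.map_ofFn, List.prod_ofFn]
      rfl
    rw [h2, mul_assoc]

variable [CharZero R]

/-- The polynomial of the strands of a colored chord diagram. -/
noncomputable def strandsPoly (F : ClassicalFamily) (D : Diagram H) (φ : H → Fin r) :
    Polynomial R := by
  classical
  exact if h : ∃ q, F.IsStrandsPoly R D.edge (reps D.edge).toList (D.strands φ) q then h.choose
    else 0

open Classical in
theorem isStrandsPoly_strandsPoly (F : ClassicalFamily) (D : Diagram H) (hD : ∀ h, D.vert h = h)
    (φ : D.Coloring r) : F.IsStrandsPoly R D.edge (reps D.edge).toList (D.strands φ.1)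
      (F.strandsPoly R D φ.1) := by
  have h := F.exists_isStrandsPoly (R := R) D.edge_edge (fun h => (φ.2 h).1) _ _
    (D.isStrands hD φ.1)
  rw [strandsPoly, dif_pos h]
  exact h.choose_spec

open Classical in
theorem strandsSum_eq_eval (F : ClassicalFamily) (D : Diagram H) (hD : ∀ h, D.vert h = h)
    (φ : D.Coloring r) (n : ℕ) (hn : n ≠ 0) :
    F.strandsSum R n D.edge (reps D.edge).toList (D.strands φ.1) =
      (n : R) ^ r * (F.strandsPoly R D φ.1).eval (n : R) := by
  have h := (F.isStrandsPoly_strandsPoly R D hD φ).1 n hn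
  rw [Finset.length_toList, D.card_eq] at h
  exact mul_left_cancel₀ (pow_ne_zero _ (pow_ne_zero _ (Nat.cast_ne_zero.2 hn))) h

open Classical in
theorem natDegree_strandsPoly_le (F : ClassicalFamily) (D : Diagram H) (hD : ∀ h, D.vert h = h)
    (φ : D.Coloring r) : (F.strandsPoly R D φ.1).natDegree ≤ (reps D.edge).card ∧
      (F.strandsPoly R D φ.1).coeff (reps D.edge).card =
        if IsPlanar D.edge (D.strands φ.1) then 1 else 0 :=
  (F.isStrandsPoly_strandsPoly R D hD φ).2 _ (by simp [Diagram.strands])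

theorem eq_of_eval_natCast {p q : Polynomial R}
    (h : ∀ n : ℕ, n ≠ 0 → p.eval (n : R) = q.eval (n : R)) : p = q := by
  refine Polynomial.eq_of_infinite_eval_eq p q (Set.Infinite.mono (s := Set.range fun n : ℕ =>
    ((n + 1 : ℕ) : R)) ?_ (Set.infinite_range_of_injective fun a b hab => ?_))
  · rintro _ ⟨n, rfl⟩
    exact h _ (Nat.succ_ne_zero n)
  · simpa using hab

/-- Renaming the colors. -/
def _root_.Diagram.Coloring.rename {D : Diagram H} (φ : D.Coloring r) (σ : Equiv.Perm (Fin r)) :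
    D.Coloring r :=
  ⟨fun h => σ (φ.1 h), fun h => by simp [(φ.2 h).1, (φ.2 h).2]⟩

theorem strandsPoly_rename (F : ClassicalFamily) (D : Diagram H) (hD : ∀ h, D.vert h = h)
    (φ : D.Coloring r) (σ : Equiv.Perm (Fin r)) :
    F.strandsPoly R D (φ.rename σ).1 = F.strandsPoly R D φ.1 := by
  classical
  refine eq_of_eval_natCast R fun n hn => ?_
  have h1 := F.strandsSum_eq_eval R D hD φ n hn
  have h2 := F.strandsSum_eq_eval R D hD (φ.rename σ) n hn
  refine mul_left_cancel₀ (pow_ne_zero r (Nat.cast_ne_zero.2 hn : (n : R) ≠ 0)) ?_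
  rw [← h1, ← h2, strandsSum, strandsSum]
  refine Fintype.sum_congr _ _ fun c => ?_
  congr 1
  rw [strandsVal, strandsVal, Diagram.strands, Diagram.strands, List.map_ofFn, List.map_ofFn,
    List.prod_ofFn, List.prod_ofFn, ← Equiv.prod_comp σ]
  simp [Diagram.Coloring.rename]

/-- The coefficient of `t^k` in the polynomial of a chord diagram. -/
noncomputable def polyCoeff (F : ClassicalFamily) (r : ℕ) (D : Diagram H) (k : ℕ) :
    MvPolynomial (Fin r) R :=
  ∑ φ : D.Coloring r, (∏ h ∈ reps D.edge, MvPolynomial.X (φ.1 h)) *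
    MvPolynomial.C ((F.strandsPoly R D φ.1).coeff k)

theorem polyCoeff_mem (F : ClassicalFamily) (D : Diagram H) (hD : ∀ h, D.vert h = h) (k : ℕ) :
    F.polyCoeff R r D k ∈ MvPolynomial.symmetricSubalgebra (Fin r) R := by
  rw [MvPolynomial.mem_symmetricSubalgebra]
  intro σ
  rw [polyCoeff, map_sum]
  refine Fintype.sum_equiv ⟨fun φ => φ.rename σ, fun φ => φ.rename σ.symm, fun φ => ?_,
    fun φ => ?_⟩ _ _ fun φ => ?_
  · exact Subtype.ext (funext fun h => by simp [Diagram.Coloring.rename])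
  · exact Subtype.ext (funext fun h => by simp [Diagram.Coloring.rename])
  · change _ = (∏ h ∈ reps D.edge, MvPolynomial.X ((φ.rename σ).1 h)) *
      MvPolynomial.C ((F.strandsPoly R D (φ.rename σ).1).coeff k)
    rw [strandsPoly_rename R F D hD]
    simp [Diagram.Coloring.rename]

/-- The polynomial of a chord diagram. -/
noncomputable def chordPoly (F : ClassicalFamily) (r : ℕ) (D : Diagram H)
    (hD : ∀ h, D.vert h = h) : Polynomial (MvPolynomial.symmetricSubalgebra (Fin r) R) :=
  ∑ k ∈ Finset.range ((reps D.edge).card + 1),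
    Polynomial.monomial k ⟨F.polyCoeff R r D k, F.polyCoeff_mem R D hD k⟩

theorem natDegree_chordPoly_le (F : ClassicalFamily) (D : Diagram H) (hD : ∀ h, D.vert h = h) :
    (F.chordPoly R r D hD).natDegree ≤ (reps D.edge).card := by
  refine Polynomial.natDegree_sum_le_of_forall_le _ _ fun k hk => ?_
  refine (Polynomial.natDegree_monomial_le _).trans ?_
  simpa [Nat.lt_succ_iff] using hk

theorem coeff_chordPoly (F : ClassicalFamily) (D : Diagram H) (hD : ∀ h, D.vert h = h) :
    ((F.chordPoly R r D hD).coeff (reps D.edge).card : MvPolynomial (Fin r) R) = D.Wx R r := by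
  classical
  rw [chordPoly, Polynomial.finsetSum_coeff, Finset.sum_eq_single (reps D.edge).card]
  · rw [Polynomial.coeff_monomial, if_pos rfl, D.Wx_eq R hD]
    change F.polyCoeff R r D _ = _
    rw [polyCoeff]
    refine Fintype.sum_congr _ _ fun φ => ?_
    rw [(F.natDegree_strandsPoly_le R D hD φ).2]
  · intro k _ hk
    rw [Polynomial.coeff_monomial, if_neg hk]
  · simp

/-- Evaluation of the variables `x` at `a` and of `t` at `n`. -/
noncomputable def evalAt (a : Fin r → R) (n : ℕ) :
    Polynomial (MvPolynomial.symmetricSubalgebra (Fin r) R) →ₐ[R] R :=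
  { ((MvPolynomial.eval a).comp
      (MvPolynomial.symmetricSubalgebra (Fin r) R).val.toRingHom).comp
      (Polynomial.evalRingHom (n : MvPolynomial.symmetricSubalgebra (Fin r) R)) with
    commutes' := fun c => by
      simp [Polynomial.algebraMap_apply] }

omit [CharZero R] in
theorem evalAt_apply (a : Fin r → R) (n : ℕ)
    (W : Polynomial (MvPolynomial.symmetricSubalgebra (Fin r) R)) :
    evalAt R a n W = MvPolynomial.eval a
      (W.eval (n : MvPolynomial.symmetricSubalgebra (Fin r) R)).1 := rfl

theorem evalAt_chordPoly (F : ClassicalFamily) (D : Diagram H) (hD : ∀ h, D.vert h = h)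
    (a : Fin r → R) (n : ℕ) (hn : n ≠ 0) :
    F.chordSum R n a D = (n : R) ^ r * evalAt R a n (F.chordPoly R r D hD) := by
  classical
  have h1 : ∀ (k : ℕ) x, evalAt R a n (Polynomial.monomial k x) =
      MvPolynomial.eval a x.1 * (n : R) ^ k := by
    intro k x
    rw [evalAt_apply, Polynomial.eval_monomial]
    simp
  rw [chordSum_eq R F n a D hD, chordPoly, map_sum, Finset.mul_sum]
  simp only [h1, polyCoeff, map_sum, map_mul, map_prod, MvPolynomial.eval_X, MvPolynomial.eval_C,
    Finset.sum_mul, Finset.mul_sum]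
  rw [Finset.sum_comm]
  refine Fintype.sum_congr _ _ fun φ => ?_
  rw [strandsSum_eq_eval R F D hD φ n hn, Polynomial.eval_eq_sum_range'
    (Nat.lt_succ_of_le (F.natDegree_strandsPoly_le R D hD φ).1), Finset.mul_sum, Finset.mul_sum]
  refine Finset.sum_congr rfl fun k _ => ?_
  ring

end ClassicalFamily

/-! ## Lie algebra weight systems as state sums -/

section
variable {R : Type*} [Field R]

/-- Functions on `2d` points are functions on `d` pairs of points. -/
def pairsEquiv (ι : Type*) (d : ℕ) : (Fin d → ι × ι) ≃ (Fin (2 * d) → ι) where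
  toFun κ j := if j.1 % 2 = 0 then (κ ⟨j.1 / 2, by omega⟩).1 else (κ ⟨j.1 / 2, by omega⟩).2
  invFun c k := (c ⟨2 * k.1, by omega⟩, c ⟨2 * k.1 + 1, by omega⟩)
  left_inv κ := by
    funext k
    have h1 : (2 * k.1 + 1) % 2 = 1 := by omega
    have h2 : (2 * k.1 + 1) / 2 = k.1 := by omega
    simp [h1, h2]
  right_inv c := by
    funext j
    by_cases h : j.1 % 2 = 0
    · have : 2 * (j.1 / 2) = j.1 := by omega
      simp [h, this]
    · have : 2 * (j.1 / 2) + 1 = j.1 := by omega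
      simp [h, this]

theorem tensorPow_sum {V : Type*} [AddCommGroup V] [Module R V] {ι : Type*} [Fintype ι]
    (w : ι → ι → R) (x : ι → V) (d : ℕ) :
    tensorPow (∑ p, ∑ q, w p q • x p ⊗ₜ[R] x q) d = ∑ c : Fin (2 * d) → ι,
      (∏ k : Fin d, w (c ⟨2 * k.1, by omega⟩) (c ⟨2 * k.1 + 1, by omega⟩)) •
        PiTensorProduct.tprod R fun j => x (c j) := by
  have h1 : TensorProduct.lift ((LinearMap.mul R (TensorAlgebra R V)).compl₁₂ (TensorAlgebra.ι R)
      (TensorAlgebra.ι R)) (∑ p, ∑ q, w p q • x p ⊗ₜ[R] x q) =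
      ∑ pq : ι × ι, w pq.1 pq.2 • (TensorAlgebra.ι R (x pq.1) * TensorAlgebra.ι R (x pq.2)) := by
    rw [Fintype.sum_prod_type]
    simp
  have h2 := (MultilinearMap.mkPiAlgebraFin R d (TensorAlgebra R V)).map_sum
    (fun (_ : Fin d) (pq : ι × ι) =>
      w pq.1 pq.2 • (TensorAlgebra.ι R (x pq.1) * TensorAlgebra.ι R (x pq.2)))
  rw [MultilinearMap.mkPiAlgebraFin_apply, List.ofFn_const, List.prod_replicate] at h2
  rw [tensorPow, h1, h2, map_sum]
  have h3 : ∀ f : (Fin d → ι × ι) → ⨁ n, ⨂[R]^n V,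
      (∑ κ, f κ) (2 * d) = ∑ κ, f κ (2 * d) := fun f =>
    map_sum (DirectSum.component R ℕ (fun n => ⨂[R]^n V) (2 * d)) f Finset.univ
  rw [h3]
  refine Fintype.sum_equiv (pairsEquiv ι d) _ _ fun κ => ?_
  have h4 : ∏ k : Fin d, w (pairsEquiv ι d κ ⟨2 * k.1, by omega⟩)
      (pairsEquiv ι d κ ⟨2 * k.1 + 1, by omega⟩) = ∏ k, w (κ k).1 (κ k).2 := by
    refine Fintype.prod_congr _ _ fun k => ?_
    have := congrFun ((pairsEquiv ι d).symm_apply_apply κ) k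
    rw [← congrArg Prod.fst this, ← congrArg Prod.snd this]
    rfl
  have h5 : (List.ofFn fun k : Fin d => TensorAlgebra.ι R (x (κ k).1) *
      TensorAlgebra.ι R (x (κ k).2)).prod =
      TensorAlgebra.tprod R V (2 * d) fun j => x (pairsEquiv ι d κ j) := by
    rw [TensorAlgebra.tprod_apply, List.ofFn_mul', List.prod_flatten, List.map_ofFn]
    congr 2
    funext k
    have := congrFun ((pairsEquiv ι d).symm_apply_apply κ) k
    rw [← congrArg Prod.fst this, ← congrArg Prod.snd this]
    simp [List.ofFn_succ, pairsEquiv]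
  rw [h4, MultilinearMap.map_smul_univ, MultilinearMap.mkPiAlgebraFin_apply, h5, map_smul,
    TensorAlgebra.toDirectSum_tensorPower_tprod, DirectSum.smul_apply, DirectSum.of_eq_same]

theorem lieWeight_sum {g M : Type*} [LieRing g] [LieAlgebra R g] [AddCommGroup M] [Module R M]
    {ι : Type*} [Fintype ι] (w : ι → ι → R) (x : ι → g) (ρ : g →ₗ⁅R⁆ Module.End R M) {d : ℕ}
    (π : Equiv.Perm (Fin (2 * d))) :
    lieWeight (∑ p, ∑ q, w p q • x p ⊗ₜ[R] x q) ρ π = ∑ c : Fin (2 * d) → ι,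
      (∏ k : Fin d, w (c ⟨2 * k.1, by omega⟩) (c ⟨2 * k.1 + 1, by omega⟩)) *
        LinearMap.trace R M (List.ofFn fun j => ρ (x (c (π.symm j)))).prod := by
  rw [lieWeight, tensorPow_sum]
  simp only [map_sum, map_smul, smul_eq_mul]
  refine Fintype.sum_congr _ _ fun c => ?_
  rw [PiTensorProduct.map_tprod, PiTensorProduct.reindex_tprod, PiTensorProduct.lift.tprod,
    MultilinearMap.mkPiAlgebraFin_apply]
  rfl

theorem casimir_eq_sum {g : Type*} [AddCommGroup g] [Module R g] [FiniteDimensional R g]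
    (B : LinearMap.BilinForm R g) (hB : B.Nondegenerate) {ι : Type*} [Fintype ι] (w : ι → ι → R)
    (x : ι → g) (h : ∀ y, ∑ p, ∑ q, (w p q * B y (x p)) • x q = y) :
    casimir B hB = ∑ p, ∑ q, w p q • x p ⊗ₜ[R] x q := by
  set b := Module.finBasis R g
  have hr : ∀ y, y = ∑ i, B (B.dualBasis hB b i) y • b i := by
    intro y
    have h1 : ∀ i, B (B.dualBasis hB b i) y = b.repr y i := by
      intro i
      conv_lhs => rw [← b.sum_repr y]
      simp only [map_sum, map_smul, LinearMap.BilinForm.apply_dualBasis_left]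
      simp
    simp only [h1]
    exact (b.sum_repr y).symm
  rw [casimir]
  have h2 : ∀ p q, w p q • x p ⊗ₜ[R] x q =
      ∑ i, b i ⊗ₜ[R] ((w p q * B (B.dualBasis hB b i) (x p)) • x q) := by
    intro p q
    conv_lhs => rw [hr (x p)]
    rw [TensorProduct.sum_tmul, Finset.smul_sum]
    refine Fintype.sum_congr _ _ fun i => ?_
    rw [TensorProduct.smul_tmul, ← TensorProduct.tmul_smul, smul_smul]
  simp only [h2]
  conv_rhs =>
    enter [2, p]
    rw [Finset.sum_comm]
  rw [Finset.sum_comm]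
  refine Fintype.sum_congr _ _ fun i => ?_
  simp only [← TensorProduct.tmul_sum]
  rw [h]

theorem tensorRep_lof {g M : Type*} [LieRing g] [LieAlgebra R g] [AddCommGroup M] [Module R M]
    (r : ℕ) (τ : g →ₗ⁅R⁆ Module.End R M) (i : Fin r) (y : g) :
    tensorRep r τ (DirectSum.lof R (Fin r) (fun _ => g) i y) = actOn i (τ y) :=
  DirectSum.toModule_lof R (φ := fun i => actOn i ∘ₗ (τ : g →ₗ[R] Module.End R M)) i y

theorem toMatrix_actOn {r n : ℕ} (i : Fin r) (A : Matrix (Fin n) (Fin n) R) :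
    LinearMap.toMatrixAlgEquiv (Basis.piTensorProduct fun _ : Fin r => Pi.basisFun R (Fin n))
      (actOn i (Matrix.toLin' A)) = tensSingle i A := by
  ext I J
  rw [LinearMap.toMatrixAlgEquiv_apply, Basis.piTensorProduct_apply, actOn_apply,
    PiTensorProduct.map_tprod, Basis.piTensorProduct_repr_tprod_apply, tensSingle_apply,
    tens_apply]
  refine Fintype.prod_congr _ _ fun k => ?_
  by_cases h : k = i
  · subst h; simp
  · simp [h, Matrix.one_apply, Pi.single_apply]

end

namespace ClassicalFamily
variable (R : Type*) [Field R] {n r : ℕ}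

/-- The generators as elements of the Lie algebra. -/
def lieGen (F : ClassicalFamily) (p : Fin n × Fin n) : F.lieAlg R n :=
  ⟨F.gen R p, by
    cases F
    · trivial
    · simp [lieAlg, gen]⟩

theorem casimirElement_eq [CharZero R] (F : ClassicalFamily) (n : ℕ) :
    F.casimirElement R n =
      ∑ p, ∑ q, F.casCoef R p q • F.lieGen R p ⊗ₜ[R] F.lieGen R q := by
  refine casimir_eq_sum _ _ _ _ fun y => Subtype.ext ?_
  have hf : ∀ p : Fin n × Fin n, F.form R n y (F.lieGen R p) =
      F.formCoef R * (F.gen R p * y.1).trace := by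
    intro p
    rw [Matrix.trace_mul_comm]
    cases F
    · simp only [form, formCoef, one_mul]
      exact repForm_definingRep R gl n y _
    · simp only [form, formCoef, LinearMap.smul_apply, smul_eq_mul]
      rw [repForm_definingRep R so n y]
      rfl
  have h1 : ((∑ p, ∑ q, (F.casCoef R p q * F.form R n y (F.lieGen R p)) • F.lieGen R q :
      F.lieAlg R n) : Matrix (Fin n) (Fin n) R) =
      ∑ p, ∑ q, (F.casCoef R p q * (F.formCoef R * (F.gen R p * y.1).trace)) • F.gen R q := by
    simp only [hf]
    push_cast
    rfl
  rw [h1]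
  cases F
  · exact sum_gl R y.1
  · exact sum_so R y.1 ((LieAlgebra.Orthogonal.mem_so (Fin n) R y.1).1 y.2)

theorem sumTensor_casimirElement [CharZero R] (F : ClassicalFamily) (n : ℕ) (a : Fin r → R) :
    sumTensor a (F.casimirElement R n) = ∑ p, ∑ q, F.powCoef R n a p q •
      DirectSum.lof R (Fin r) (fun _ => F.lieAlg R n) p.1 (F.lieGen R p.2) ⊗ₜ[R]
      DirectSum.lof R (Fin r) (fun _ => F.lieAlg R n) q.1 (F.lieGen R q.2) := by
  rw [sumTensor, casimirElement_eq]
  conv_rhs => rw [Fintype.sum_prod_type]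
  refine Fintype.sum_congr _ _ fun i => ?_
  rw [map_sum, Finset.smul_sum]
  refine Fintype.sum_congr _ _ fun p => ?_
  rw [map_sum, Finset.smul_sum]
  conv_rhs => rw [Fintype.sum_prod_type]
  have h0 : ∀ j ∈ Finset.univ, j ≠ i → ∑ q, F.powCoef R n a (i, p) (j, q) •
      DirectSum.lof R (Fin r) (fun _ => F.lieAlg R n) i (F.lieGen R p) ⊗ₜ[R]
      DirectSum.lof R (Fin r) (fun _ => F.lieAlg R n) j (F.lieGen R q) = 0 := by
    intro j _ hj
    simp [powCoef, hj.symm]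
  refine Eq.trans ?_ (Finset.sum_eq_single i h0 (by simp)).symm
  refine Fintype.sum_congr _ _ fun q => ?_
  rw [map_smul, TensorProduct.map_tmul, smul_smul, powCoef, if_pos rfl]

theorem _root_.chordDiagram_edge_val {d : ℕ} (π : Equiv.Perm (Fin (2 * d))) (h : Fin (2 * d)) :
    ((chordDiagram π).edge h).1 = if h.1 % 2 = 0 then h.1 + 1 else h.1 - 1 := by
  by_cases hh : h.1 % 2 = 0 <;> simp [chordDiagram, hh]

/-- The first ends of the chords of a standard chord diagram. -/
def _root_.evenEmb (d : ℕ) : Fin d ↪ Fin (2 * d) :=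
  ⟨fun k => ⟨2 * k.1, by omega⟩, fun k l h => by simpa [Fin.ext_iff] using h⟩

theorem _root_.isReps_chordDiagram {d : ℕ} (π : Equiv.Perm (Fin (2 * d))) :
    IsReps (chordDiagram π).edge
      (Finset.univ.map (evenEmb d)) := by
  constructor
  · intro s _
    exact (chordDiagram π).edge_ne s
  · intro h _
    refine ⟨⟨2 * (h.1 / 2), by omega⟩, ⟨?_, ?_⟩, ?_⟩
    · rw [Finset.mem_map]
      exact ⟨⟨h.1 / 2, by omega⟩, Finset.mem_univ _, rfl⟩
    · by_cases hh : h.1 % 2 = 0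
      · left; apply Fin.ext; simp; omega
      · right; left; apply Fin.ext; rw [chordDiagram_edge_val, if_neg hh]; simp; omega
    · rintro s ⟨hs, hs'⟩
      obtain ⟨k, -, rfl⟩ := Finset.mem_map.1 hs
      rw [(chordDiagram π).edge_edge] at hs'
      have hk : (evenEmb d k).1 = 2 * k.1 := rfl
      have he := chordDiagram_edge_val π h
      apply Fin.ext
      simp only [hk]
      rcases hs' with e | e | e <;> replace e := congrArg Fin.val e <;> rw [hk] at e <;>
        split_ifs at he <;> omega

theorem lieWeight_eq_chordSum [CharZero R] (F : ClassicalFamily) {d : ℕ}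
    (π : Equiv.Perm (Fin (2 * d))) (a : Fin r → R) (n : ℕ) :
    lieWeight (sumTensor a (F.casimirElement R n)) (tensorRep r (F.definingRep R n)) π =
      F.chordSum R n a (chordDiagram π) := by
  classical
  rw [sumTensor_casimirElement, lieWeight_sum, chordSum]
  refine Finset.sum_congr (by congr!) fun c _ => ?_
  congr 1
  · rw [(isReps_reps (chordDiagram π).smallOrbits_edge).prod_eq (chordDiagram π).smallOrbits_edge
      (isReps_chordDiagram π) (fun h => F.powCoef R n a (c h) (c ((chordDiagram π).edge h))) ?_,
      Finset.prod_map]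
    · refine Fintype.prod_congr _ _ fun k => ?_
      have hk : (evenEmb d k).1 = 2 * k.1 := rfl
      have : (chordDiagram π).edge (evenEmb d k) = ⟨2 * k.1 + 1, by omega⟩ := by
        apply Fin.ext; rw [chordDiagram_edge_val, hk]; simp
      rw [this]
      rfl
    · intro h
      rw [(chordDiagram π).edge_edge, powCoef, powCoef]
      by_cases hh : (c h).1 = (c ((chordDiagram π).edge h)).1
      · rw [if_pos hh, if_pos hh.symm, casCoef_comm, hh]
      · rw [if_neg hh, if_neg (Ne.symm hh)]
  · have h1 : ∀ f : Module.End R (⨂[R] _ : Fin r, (Fin n → R)),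
        LinearMap.trace R _ f = (LinearMap.toMatrixAlgEquiv
          (Basis.piTensorProduct fun _ : Fin r => Pi.basisFun R (Fin n)) f).trace := fun f =>
      LinearMap.trace_eq_matrix_trace R _ f
    rw [h1, map_list_prod, List.map_ofFn]
    have h2 : (chordDiagram π).legs = List.ofFn fun j => π.symm j := rfl
    rw [h2, List.map_ofFn]
    congr 3
    funext j
    simp only [Function.comp_apply]
    rw [tensorRep_lof]
    exact toMatrix_actOn _ _

end ClassicalFamily

/-! ## Chord diagrams span `A` -/

namespace Diagram

variable {H : Type} [Fintype H]

theorem legs_length_of_vert (D : Diagram H) (hD : ∀ h, D.vert h = h) :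
    D.legs.length = Fintype.card H := by
  classical
  rw [← List.toFinset_card_of_nodup D.nodup, ← Finset.card_univ]
  congr 1
  ext h
  simp [D.mem_legs, hD]

theorem degree_of_vert (D : Diagram H) (hD : ∀ h, D.vert h = h) :
    D.degree = (reps D.edge).card := by
  rw [degree, D.legs_length_of_vert hD, D.card_eq]
  omega

theorem exists_edge_equiv (D : Diagram H) {d : ℕ} (hd : (reps D.edge).card = d) :
    ∃ e : Fin (2 * d) ≃ H, ∀ j, D.edge (e j) = e ((chordDiagram (Equiv.refl _)).edge j) := by
  subst hd
  let s := (reps D.edge).equivFin.symm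
  let g : Fin (2 * (reps D.edge).card) → H := fun j =>
    if j.1 % 2 = 0 then (s ⟨j.1 / 2, by omega⟩).1 else D.edge (s ⟨j.1 / 2, by omega⟩).1
  have hg : ∀ j, D.edge (g j) = g ((chordDiagram (Equiv.refl _)).edge j) := by
    intro j
    have h1 := chordDiagram_edge_val (Equiv.refl _) j
    simp only [g]
    generalize (chordDiagram (Equiv.refl _)).edge j = k at h1 ⊢
    have h2 : k.1 / 2 = j.1 / 2 := by split_ifs at h1 <;> omega
    have h3 : k.1 % 2 = 0 ↔ ¬ j.1 % 2 = 0 := by split_ifs at h1 <;> omega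
    simp only [h2, h3]
    by_cases hj : j.1 % 2 = 0 <;> simp [hj, D.edge_edge]
  have hs : ∀ h ∈ reps D.edge, ∃ k : Fin (2 * (reps D.edge).card), g k = h := by
    intro h hh
    refine ⟨⟨2 * (s.symm ⟨h, hh⟩).1, by have := (s.symm ⟨h, hh⟩).2; omega⟩, ?_⟩
    simp [g]
  have hsurj : Function.Surjective g := by
    intro h
    obtain ⟨t, ⟨ht, ht'⟩, -⟩ := (isReps_reps D.smallOrbits_edge).2 h (D.edge_ne h)
    obtain ⟨k, hk⟩ := hs t ht
    rcases ht' with rfl | rfl | rfl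
    · exact ⟨k, hk⟩
    · exact ⟨_, (hg k).symm.trans (by rw [hk, D.edge_edge])⟩
    · rw [D.edge_edge] at hk; exact ⟨k, hk⟩
  have hbij : Function.Bijective g :=
    (Fintype.bijective_iff_surjective_and_card g).2 ⟨hsurj, by simp [D.card_eq]⟩
  exact ⟨Equiv.ofBijective g hbij, hg⟩

theorem exists_equivalent_chordDiagram (D : Diagram H) (hD : ∀ h, D.vert h = h) {d : ℕ}
    (hd : (reps D.edge).card = d) :
    ∃ π : Equiv.Perm (Fin (2 * d)), D.Equivalent (chordDiagram π) := by
  classical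
  obtain ⟨e, he⟩ := D.exists_edge_equiv hd
  let l := D.legs.map e.symm
  have hl : l.length = 2 * d := by
    rw [List.length_map, D.legs_length_of_vert hD, D.card_eq, hd]
  have hn : l.Nodup := D.nodup.map e.symm.injective
  let f : Fin (2 * d) → Fin (2 * d) := fun j => l[j.1]'(by rw [hl]; exact j.2)
  have hf : Function.Injective f := fun i j hij => Fin.ext (hn.getElem_inj_iff.1 hij)
  refine ⟨(Equiv.ofBijective f (Finite.injective_iff_bijective.1 hf)).symm, e.symm, ?_, ?_, ?_⟩
  · intro h
    rw [Equiv.symm_apply_eq]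
    have := he (e.symm h)
    rw [e.apply_symm_apply] at this
    exact this
  · intro h
    rw [hD]
    rfl
  · have : (chordDiagram (Equiv.ofBijective f (Finite.injective_iff_bijective.1 hf)).symm).legs =
        l := by
      change List.ofFn f = l
      refine List.ext_getElem (by simp [hl]) fun i h1 h2 => ?_
      simp [f]
    rw [this]

end Diagram

namespace DiagramAlgebra

variable (R : Type*) [CommRing R]

/-- The span of the chord diagrams of degree `d`. -/
noncomputable def chordSpan (d : ℕ) : Submodule R (DiagramAlgebra R) :=
  Submodule.span R (Set.range fun π : Equiv.Perm (Fin (2 * d)) => mk R (chordDiagram π))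

theorem mk_mem_chordSpan (N : ℕ) : ∀ {H : Type} [Fintype H] (_ : Fintype.card H = N)
    (D : Diagram H), mk R D ∈ chordSpan R D.degree := by
  classical
  induction N using Nat.strong_induction_on with
  | _ N ih =>
  intro H _ hN D
  by_cases hch : ∀ c ∈ D.legs, D.vert (D.edge c) = D.edge c
  · have hD : ∀ h, D.vert h = h := by
      refine D.connected {h | D.vert h = h} (fun h hh => hch h ((D.mem_legs h).2 hh)) ?_
        (fun h hh => hh)
      intro h hh
      exact congrArg D.vert hh
    obtain ⟨π, hπ⟩ := D.exists_equivalent_chordDiagram hD (D.degree_of_vert hD).symm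
    rw [mk_eq hπ]
    exact Submodule.subset_span ⟨π, rfl⟩
  · push Not at hch
    obtain ⟨c, hc, hp⟩ := hch
    obtain ⟨l1, l2, hl⟩ := List.append_of_mem hc
    have hrot : D.legs ~r c :: (l2 ++ l1) := by
      rw [hl]
      exact List.isRotated_append (l := l1) (l' := c :: l2)
    have hL : Lists D.toWeb (c :: (l2 ++ l1)) := Lists.perm ⟨D.nodup, D.mem_legs⟩ hrot.perm
    have hcv := (D.mem_legs c).1 hc
    obtain ⟨a, b, l, hll, hL', -, -, hE⟩ := br_unfuse (R := R) hL hcv hp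
    rw [mk_eq_br, br_rot hrot, hE]
    have hcard : Fintype.card {h : H // h ≠ c ∧ h ≠ D.edge c} + 2 = Fintype.card H := by
      rw [Fintype.card_subtype]
      have h1 : (Finset.univ.filter fun h => h ≠ c ∧ h ≠ D.edge c) =
          (Finset.univ.erase c).erase (D.edge c) := by
        ext h; simp [and_comm]
      have h2 : D.edge c ∈ Finset.univ.erase c := by simp [D.edge_ne]
      have h3 := Finset.card_erase_add_one h2
      have h4 := Finset.card_erase_add_one (Finset.mem_univ c)
      rw [h1, ← Finset.card_univ]
      omega
    have hlen : l.length + 1 = D.legs.length := by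
      have h1 := congrArg List.length hll
      have h2 := hrot.perm.length_eq
      simp at h1 h2
      omega
    have hthree : D.legs.length + 3 ≤ Fintype.card H := by
      have e1 : D.vert (D.vert (D.edge c)) ≠ D.vert (D.edge c) := fun e => hp (D.vert_inj e)
      have e2 : D.vert (D.vert (D.edge c)) ≠ D.edge c := fun e => hp (by
        have := congrArg D.vert e; rw [D.vert_vert_vert] at this; exact this.symm)
      have hnd : (D.edge c :: D.vert (D.edge c) :: D.vert (D.vert (D.edge c)) :: D.legs).Nodup := by
        have n1 : D.edge c ∉ D.legs := fun h => hp ((D.mem_legs _).1 h)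
        have n2 : D.vert (D.edge c) ∉ D.legs := fun h => e1 ((D.mem_legs _).1 h)
        have n3 : D.vert (D.vert (D.edge c)) ∉ D.legs := fun h => e1 (by
          have := (D.mem_legs _).1 h
          exact D.vert_inj this)
        simp only [List.nodup_cons, List.mem_cons, not_or]
        exact ⟨⟨hp.symm, e2.symm, n1⟩, ⟨e1.symm, n2⟩, n3, D.nodup⟩
      have := hnd.length_le_card
      simp only [List.length_cons] at this
      omega
    have key : ∀ m, Lists (D.unfuse c hcv hp) m → m.length = l.length + 2 →
        br R (D.unfuse c hcv hp) m ∈ chordSpan R D.degree := by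
      intro m hm hml
      have h1 := ih _ (by omega) rfl ⟨D.unfuse c hcv hp, m, hm.1, hm.2⟩
      rw [mk_eq_br] at h1
      convert h1 using 2
      simp only [Diagram.degree]
      omega
    exact Submodule.sub_mem _ (key _ hL' (by simp))
      (key _ (hL'.perm (List.Perm.swap _ _ _)) (by simp))

theorem homogeneous_le_chordSpan (d : ℕ) : homogeneous R d ≤ chordSpan R d := by
  rw [homogeneous, Submodule.span_le]
  rintro _ ⟨n, D, rfl, rfl⟩
  exact mk_mem_chordSpan R _ rfl D

theorem iSup_chordSpan : ⨆ d, chordSpan R d = ⊤ := by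
  rw [eq_top_iff]
  rintro x -
  obtain ⟨y, rfl⟩ := Submodule.mkQ_surjective (Submodule.span R (stuRelations R)) x
  induction y using Finsupp.induction_linear with
  | zero => exact Submodule.zero_mem _
  | add f g hf hg => exact Submodule.add_mem _ hf hg
  | single D c =>
    obtain ⟨n, D, rfl⟩ := exists_toClass D
    have : Finsupp.single D.toClass c = c • Finsupp.single D.toClass 1 := by simp
    rw [this]
    exact Submodule.smul_mem _ c
      (Submodule.mem_iSup_of_mem D.degree (mk_mem_chordSpan R _ rfl D))

end DiagramAlgebra

/-! ## The universal weight system -/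

theorem MvPolynomial.eq_zero_of_eval_units {R : Type*} [Field R] [CharZero R] {r : ℕ}
    {p : MvPolynomial (Fin r) R}
    (h : ∀ a : Fin r → R, (∀ i, a i ≠ 0) → MvPolynomial.eval a p = 0) : p = 0 := by
  have h1 : p * ∏ i, MvPolynomial.X i = 0 := by
    refine MvPolynomial.funext fun a => ?_
    rw [map_mul, map_prod, map_zero]
    by_cases ha : ∀ i, a i ≠ 0
    · rw [h a ha, zero_mul]
    · push Not at ha
      obtain ⟨i, hi⟩ := ha
      rw [Finset.prod_eq_zero (Finset.mem_univ i) (by simpa using hi), mul_zero]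
  exact (mul_eq_zero.1 h1).resolve_right
    (Finset.prod_ne_zero_iff.2 fun i _ => MvPolynomial.X_ne_zero i)

namespace ClassicalFamily

variable (R : Type*) [Field R] (r : ℕ)

/-- The points at which the weight systems are compared: nonzero multiples of the Casimir elements
and sizes of matrices. -/
abbrev WeightPoint : Type _ := {a : Fin r → R // ∀ i, a i ≠ 0} × {n : ℕ // 2 ≤ n}

/-- Simultaneous evaluation at all points. -/
noncomputable def evalAll : Polynomial (MvPolynomial.symmetricSubalgebra (Fin r) R) →ₐ[R]
    (WeightPoint R r → R) :=
  AlgHom.pi fun p : WeightPoint R r => evalAt R p.1.1 p.2.1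

/-- The weight systems at all points. -/
noncomputable def weightAll (F : ClassicalFamily) [CharZero R] :
    DiagramAlgebra R →ₐ[R] (WeightPoint R r → R) :=
  AlgHom.pi fun p : WeightPoint R r =>
    haveI : NeZero p.2.1 := ⟨by have := p.2.2; omega⟩
    F.algWeight R p.2.1 p.1.1 p.1.2

theorem evalAll_injective [CharZero R] : Function.Injective (evalAll R r) := by
  rw [injective_iff_map_eq_zero]
  intro W hW
  ext1 k
  refine Subtype.ext (MvPolynomial.eq_zero_of_eval_units fun a ha => ?_)
  let f : MvPolynomial.symmetricSubalgebra (Fin r) R →+* R :=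
    (MvPolynomial.eval a).comp (MvPolynomial.symmetricSubalgebra (Fin r) R).subtype
  have h1 : W.map f = 0 := by
    refine Polynomial.eq_zero_of_infinite_isRoot _ (Set.Infinite.mono ?_
      ((Set.Ici_infinite 2).image (Nat.cast_injective (R := R)).injOn))
    rintro _ ⟨n, hn, rfl⟩
    have h2 : evalAt R a n W = 0 := congrFun hW (⟨a, ha⟩, ⟨n, hn⟩)
    rw [evalAt_apply] at h2
    change (W.map f).eval (n : R) = 0
    have h3 : (n : R) = f n := (map_natCast f n).symm
    rw [h3, Polynomial.eval_map_apply]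
    exact h2
  have h2 := congrArg (fun q => Polynomial.coeff q k) h1
  rw [Polynomial.coeff_map] at h2
  exact h2

variable {r}

theorem weightAll_mk (F : ClassicalFamily) [CharZero R] {H : Type} [Fintype H] (D : Diagram H)
    (hD : ∀ h, D.vert h = h) :
    weightAll R r F (DiagramAlgebra.mk R D) = evalAll R r (F.chordPoly R r D hD) := by
  funext p
  have hn : p.2.1 ≠ 0 := by have := p.2.2; omega
  have : NeZero p.2.1 := ⟨hn⟩
  change F.algWeight R p.2.1 p.1.1 p.1.2 (DiagramAlgebra.mk R D) =
    evalAt R p.1.1 p.2.1 (F.chordPoly R r D hD)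
  rw [algWeight_mk, trace_stateSum_powerData R F _ _ _ D hD, evalAt_chordPoly R F D hD _ _ hn,
    inv_mul_cancel_left₀ (pow_ne_zero _ (Nat.cast_ne_zero.2 hn))]

theorem weightAll_mem_range (F : ClassicalFamily) [CharZero R] (x : DiagramAlgebra R) :
    weightAll R r F x ∈ (evalAll R r).range := by
  have hx : x ∈ ⨆ d, DiagramAlgebra.chordSpan R d := by
    rw [DiagramAlgebra.iSup_chordSpan]; trivial
  suffices ⨆ d, DiagramAlgebra.chordSpan R d ≤
      (Subalgebra.toSubmodule (evalAll R r).range).comap (weightAll R r F).toLinearMap from this hx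
  refine iSup_le fun d => Submodule.span_le.2 ?_
  rintro _ ⟨π, rfl⟩
  exact ⟨_, (weightAll_mk R F (chordDiagram π) fun _ => rfl).symm⟩

/-- The universal weight system of a classical family. -/
noncomputable def universalWeight (F : ClassicalFamily) [CharZero R] (r : ℕ) :
    DiagramAlgebra R →ₐ[R] Polynomial (MvPolynomial.symmetricSubalgebra (Fin r) R) :=
  ((AlgEquiv.ofInjective (evalAll R r) (evalAll_injective R r)).symm : (evalAll R r).range →ₐ[R] _).comp
    ((weightAll R r F).codRestrict _ (weightAll_mem_range R F))

theorem universalWeight_mk (F : ClassicalFamily) [CharZero R] {H : Type} [Fintype H]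
    (D : Diagram H) (hD : ∀ h, D.vert h = h) :
    F.universalWeight R r (DiagramAlgebra.mk R D) = F.chordPoly R r D hD := by
  refine (AlgEquiv.symm_apply_eq (AlgEquiv.ofInjective (evalAll R r) (evalAll_injective R r))).2
    (Subtype.ext ?_)
  exact weightAll_mk R F D hD

end ClassicalFamily

theorem card_reps_chordDiagram {d : ℕ} (π : Equiv.Perm (Fin (2 * d))) :
    (reps (chordDiagram π).edge).card = d := by
  have := (chordDiagram π).card_eq
  rw [Fintype.card_fin] at this
  omega

theorem mainTheorem8 {R : Type*} [Field R] [CharZero R] (F : ClassicalFamily) (r : ℕ)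
    (hr : 1 ≤ r) :
    ∃ W : DiagramAlgebra R →ₐ[R] Polynomial (MvPolynomial.symmetricSubalgebra (Fin r) R),
      (∀ (d : ℕ) (π : Equiv.Perm (Fin (2 * d))) (a : Fin r → R) (n : ℕ), 2 ≤ n →
        lieWeight (sumTensor a (F.casimirElement R n)) (tensorRep r (F.definingRep R n)) π =
          (n : R) ^ r * MvPolynomial.eval a
            ((W (DiagramAlgebra.mk R (chordDiagram π))).eval
              (n : MvPolynomial.symmetricSubalgebra (Fin r) R)).1) ∧
      (∀ (d : ℕ), ∀ x ∈ DiagramAlgebra.homogeneous R d, (W x).natDegree ≤ d) ∧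
      (∀ (d : ℕ) (π : Equiv.Perm (Fin (2 * d))),
        ((W (DiagramAlgebra.mk R (chordDiagram π))).coeff d : MvPolynomial (Fin r) R) =
          (chordDiagram π).Wx R r) := by
  refine ⟨F.universalWeight R r, fun d π a n hn => ?_, fun d x hx => ?_, fun d π => ?_⟩
  · rw [F.lieWeight_eq_chordSum R π a n,
      F.evalAt_chordPoly R (chordDiagram π) (fun _ => rfl) a n (by omega),
      F.universalWeight_mk R (chordDiagram π) fun _ => rfl]
    rfl
  · have hle : DiagramAlgebra.chordSpan R d ≤ ((Polynomial.degreeLE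
        (MvPolynomial.symmetricSubalgebra (Fin r) R) d).restrictScalars R).comap
        (F.universalWeight R r).toLinearMap := by
      refine Submodule.span_le.2 ?_
      rintro _ ⟨π, rfl⟩
      refine Polynomial.mem_degreeLE.2 (Polynomial.natDegree_le_iff_degree_le.1 ?_)
      have := F.natDegree_chordPoly_le R (r := r) (chordDiagram π) fun _ => rfl
      rw [card_reps_chordDiagram] at this
      exact (congrArg Polynomial.natDegree
        (F.universalWeight_mk R (chordDiagram π) fun _ => rfl)).trans_le this
    exact Polynomial.natDegree_le_iff_degree_le.2
      (Polynomial.mem_degreeLE.1 (hle (DiagramAlgebra.homogeneous_le_chordSpan R d hx)))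
  · have := F.coeff_chordPoly R (r := r) (chordDiagram π) fun _ => rfl
    rw [card_reps_chordDiagram] at this
    rw [F.universalWeight_mk R (chordDiagram π) fun _ => rfl, this]
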